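/- **Circuits.** A quantum circuit on $N$ qubits is a finite sequence of layers. Each layer is a collection of gates acting on pairwise disjoint sets of qubits. The gates are arbitrary one-qubit unitary gates and fan-out gates of arbitrary arity, $|y_1\rangle\cdots|y_k\rangle|x\rangle \mapsto |y_1\oplus x\rangle\cdots|y_k\oplus x\rangle|x\rangle$. The depth of a circuit is its number of layers. The size of a gate is the number of qubits it affects, and the size of a circuit is the total size of its gates. Circuits may use ancilla qubits, which are initialised to $|0\rangle$ and must be returned to $|0\rangle$. A family $(C_n)_n$ of circuits is *uniform* if some log-space Turing machine (read-only input tape, work tapes on which it uses $O(\log n)$ cells, write-only output tape) on input $1^n$ outputs a description of $C_n$: the number of qubits, and the list of the layers with their gates and the (binary) indices of the qubits they act on. In a description, one-qubit gates are named by finite means, namely as the Hadamard gate or as a rotation $R_z(2\pi r/s)=|0\rangle\langle 0|+e^{2\pi i r/s}|1\rangle\langle 1|$ with $r,s\in\mathbb N$, $s\ge 1$, written in binary. The rotation angles may depend on $n$, so the basis is not fixed. **Or-reductions.** For $x\in\{0,1\}^n$ let $|x|$ be its Hamming weight, and let $\mathrm{Or}(x)=1$ if $|x|>0$ and $\mathrm{Or}(x)=0$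 otherwise. An *Or-reduction* $n\to m$ with error $\varepsilon$ is a circuit that, for every $x\in\{0,1\}^n$, maps $|x\rangle|0^m\rangle \mapsto |x\rangle|\varphi\rangle$, where $|\varphi\rangle$ (which may depend on $x$) satisfies $|\varphi\rangle=|0^m\rangle$ if $|x|=0$, and $|\langle 0^m|\varphi\rangle|\le\varepsilon$ if $|x|\ne 0$. **Log-star.** $\log^* x$ is the maximum number $k$ such that the $k$-times iterated binary logarithm $\log\log\cdots\log x$ exists and is real. **Theorem.** There are a constant $K$ and a uniform family $(C_n)$ of quantum circuits with fan-out such that, for every $n\ge 1$, the circuit $C_n$ is an Or-reduction $n\to 1$ with error $0$, has depth at most $K\log^* n$ and size at most $K n$. Moreover $C_n$ computes the Or gate on $n$ qubits exactly: $|x\rangle|y\rangle\mapsto|x\rangle|y\oplus \mathrm{Or}(x)\rangle$ for all $x\in\{0,1\}^n$, $y\in\{0,1\}$. -/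

import Mathlib

namespace QuantumFanOut

/-! ### The iterated logarithm -/

/-- The `k`-times iterated binary logarithm of `x`. It exists (as a real number) only if
every earlier iterate is positive, see `IterLogExists`. -/
noncomputable def iterLog (k : ℕ) (x : ℝ) : ℝ := (Real.logb 2)^[k] x

/-- The `k`-times iterated logarithm of `x` exists and is real: a logarithm is only ever
taken of a positive number. -/
def IterLogExists (k : ℕ) (x : ℝ) : Prop := ∀ j < k, 0 < iterLog j x

/-- `log* x` is the maximum number of iterations `k` such that the `k`-times iterated
logarithm of `x` exists and is real. The maximum exists, see `logStar_isGreatest`. -/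
noncomputable def logStar (x : ℝ) : ℕ := sSup {k | IterLogExists k x}

theorem logb_two_le_sub {x : ℝ} (hx : 0 < x) : Real.logb 2 x ≤ x - 1 / 2 := by
  have h2 := Real.log_two_gt_d9
  have h2' := Real.log_two_lt_d9
  have hl : 0 < Real.log 2 := by linarith
  have h1 : Real.log (x * Real.log 2) ≤ x * Real.log 2 - 1 :=
    Real.log_le_sub_one_of_pos (by positivity)
  have h3 : Real.log (Real.log 2)⁻¹ ≤ (Real.log 2)⁻¹ - 1 :=
    Real.log_le_sub_one_of_pos (by positivity)
  rw [Real.log_mul hx.ne' hl.ne'] at h1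
  rw [Real.log_inv] at h3
  have h4 : (Real.log 2)⁻¹ ≤ 1.5 := by
    rw [inv_le_comm₀ hl (by norm_num)]
    norm_num
    linarith
  rw [Real.logb, div_le_iff₀ hl]
  nlinarith

theorem iterLogExists_bddAbove (x : ℝ) : BddAbove {k | IterLogExists k x} := by
  refine ⟨2 * ⌈x⌉₊ + 1, fun k hk => ?_⟩
  by_contra hlt
  push Not at hlt
  have hk' : ∀ j < k, iterLog j x ≤ x - j / 2 := by
    intro j
    induction j with
    | zero => intro _; simp [iterLog]
    | succ j ih =>
      intro hj
      have h1 := ih (by omega)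
      have h2 := logb_two_le_sub (hk j (by omega))
      have h3 : iterLog (j + 1) x = Real.logb 2 (iterLog j x) := by
        simp only [iterLog, Function.iterate_succ_apply']
      rw [h3]
      push_cast
      linarith
  have h1 := hk' (2 * ⌈x⌉₊ + 1) hlt
  have h2 := hk (2 * ⌈x⌉₊ + 1) hlt
  have h3 := Nat.le_ceil x
  push_cast at h1
  linarith

theorem logStar_isGreatest (x : ℝ) : IsGreatest {k | IterLogExists k x} (logStar x) :=
  ⟨Nat.sSup_mem ⟨0, fun _ hj => absurd hj (Nat.not_lt_zero _)⟩ (iterLogExists_bddAbove x),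
    fun _ hk => le_csSup (iterLogExists_bddAbove x) hk⟩

/-! ### Quantum circuits with fan-out and arbitrary one-qubit gates -/

/-- Bit strings indexed by `N` qubits; `false` is `0` and `true` is `1`. -/
abbrev Bits (N : ℕ) : Type := Fin N → Bool

/-- State vectors of `N` qubits, given by their amplitudes in the computational basis. -/
abbrev QState (N : ℕ) : Type := Bits N → ℂ

/-- The computational basis state `|x⟩`. -/
def ket {N : ℕ} (x : Bits N) : QState N := Pi.single x 1

/-- One-qubit gates: arbitrary unitary `2 × 2` matrices, indexed by bits. -/
abbrev OneQubit : Type := Matrix.unitaryGroup Bool ℂ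

/-- A gate on `N` qubits is an arbitrary one-qubit gate applied to qubit `q`, or a fan-out gate
of arbitrary arity with control qubit `c` and target qubits `T` (a controlled-not gate is
the case of one target). -/
inductive Gate (N : ℕ) : Type
  | one (U : OneQubit) (q : Fin N) : Gate N
  | fanOut (c : Fin N) (T : Finset (Fin N)) (h : c ∉ T) : Gate N

/-- The qubits that a gate affects. -/
def Gate.qubits {N : ℕ} : Gate N → Finset (Fin N)
  | .one _ q => {q}
  | .fanOut c T _ => insert c T

/-- The size of a gate is the number of affected qubits. -/
def Gate.size {N : ℕ} (g : Gate N) : ℕ := g.qubits.card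

/-- The classical action of fan-out: each target is xored with the control. -/
def fanOutBits {N : ℕ} (c : Fin N) (T : Finset (Fin N)) (x : Bits N) : Bits N :=
  fun q => if q ∈ T then xor (x q) (x c) else x q

/-- The action of a gate on a state. As `fanOutBits c T` is an involution (`c ∉ T`), the fan-out
gate, which maps `|x⟩` to `|fanOutBits c T x⟩`, acts on amplitudes by precomposition with it. -/
noncomputable def Gate.apply {N : ℕ} : Gate N → QState N → QState N
  | .one U q, ψ => fun x => ∑ b : Bool, U.1 (x q) b * ψ (Function.update x q b)
  | .fanOut c T _, ψ => fun x => ψ (fanOutBits c T x)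

/-- A quantum circuit on `N` qubits: a sequence of layers, each consisting of gates on pairwise
disjoint sets of qubits. -/
structure Circuit (N : ℕ) : Type where
  layers : List (List (Gate N))
  disjoint : ∀ L ∈ layers, L.Pairwise fun g h => Disjoint g.qubits h.qubits

/-- The number of layers. -/
def Circuit.depth {N : ℕ} (C : Circuit N) : ℕ := C.layers.length

/-- The total size of all gates. -/
def Circuit.size {N : ℕ} (C : Circuit N) : ℕ :=
  (C.layers.map fun L => (L.map Gate.size).sum).sum

/-- The operator computed by a circuit: layers are applied in order. (Gates of one layer act on
disjoint qubits, hence commute.) -/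
noncomputable def Circuit.run {N : ℕ} (C : Circuit N) (ψ : QState N) : QState N :=
  C.layers.flatten.foldl (fun χ g => g.apply χ) ψ

/-! ### Or-reductions and the Or gate -/

/-- The string of zeros. -/
def zeros (N : ℕ) : Bits N := fun _ => false

/-- The concatenation `x y z` of three bit strings. -/
def join {n m a : ℕ} (x : Bits n) (y : Bits m) (z : Bits a) : Bits (n + m + a) :=
  Fin.append (Fin.append x y) z

/-- The product state `|x⟩ |φ⟩ |z⟩`. -/
noncomputable def ketJoin {n m a : ℕ} (x : Bits n) (φ : QState m) (z : Bits a) :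
    QState (n + m + a) :=
  ∑ y : Bits m, φ y • ket (join x y z)

/-- An Or-reduction `n → m` with error `ε`: with `a` ancilla qubits, which are initialised to `0`
and end up clean, the circuit maps `|x⟩ |0^m⟩` to `|x⟩ |φ⟩`, where `|φ⟩ = |0^m⟩` if `x` is zero,
and `⟨0^m|φ⟩` has absolute value at most `ε` otherwise. -/
def IsOrReduction (n m : ℕ) {a : ℕ} (ε : ℝ) (C : Circuit (n + m + a)) : Prop :=
  ∀ x : Bits n, ∃ φ : QState m,
    C.run (ket (join x (zeros m) (zeros a))) = ketJoin x φ (zeros a) ∧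
    (x = zeros n → φ = ket (zeros m)) ∧
    (x ≠ zeros n → ‖φ (zeros m)‖ ≤ ε)

/-- The logical Or of a bit string. -/
def logicalOr {n : ℕ} (x : Bits n) : Bool := decide (∃ i, x i = true)

/-- The circuit computes the `(n+1)`-qubit Or gate `|x⟩ |y⟩ → |x⟩ |y ⊕ Or x⟩` exactly, with `a`
ancilla qubits, which are initialised to `0` and end up clean. -/
def ComputesOr (n : ℕ) {a : ℕ} (C : Circuit (n + 1 + a)) : Prop :=
  ∀ (x : Bits n) (y : Bool),
    C.run (ket (join x (fun _ : Fin 1 => y) (zeros a))) =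
      ket (join x (fun _ : Fin 1 => xor y (logicalOr x)) (zeros a))

/-! ### Descriptions of circuits

A circuit is written down as a word over a finite alphabet. A description has to name its
one-qubit gates by finite means: the names available are the Hadamard gate and the rotations by
rational multiples of `2π`. -/

/-- The Hadamard gate. -/
noncomputable def hadamard : OneQubit :=
  ⟨Matrix.of fun i j => ((1 / √2 : ℝ) : ℂ) * (if i && j then -1 else 1), by
    have h : ((√2 : ℝ) : ℂ) ^ 2 = 2 := by
      rw [← Complex.ofReal_pow, Real.sq_sqrt (by norm_num)]; norm_num
    rw [Matrix.mem_unitaryGroup_iff]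
    ext i j
    cases i <;> cases j <;>
      simp [Matrix.mul_apply, Matrix.star_apply, Complex.conj_ofReal] <;>
      field_simp <;> simp [h] <;> norm_num⟩

/-- The rotation `R_z(α) = |0⟩⟨0| + e^{iα} |1⟩⟨1|`. -/
noncomputable def rotZ (α : ℝ) : OneQubit :=
  ⟨Matrix.diagonal fun b => if b then Complex.exp (α * Complex.I) else 1, by
    rw [Matrix.mem_unitaryGroup_iff, Matrix.star_eq_conjTranspose,
      Matrix.diagonal_conjTranspose, Matrix.diagonal_mul_diagonal, ← Matrix.diagonal_one]
    congr 1
    funext b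
    cases b
    · simp
    · simp [← Complex.exp_conj, ← Complex.exp_add]⟩

/-- The alphabet of circuit descriptions. -/
inductive Letter : Type
  | bit (b : Bool)
  | comma
  | had
  | rot
  | fan
  | endGate
  | endLayer

/-- A number is written in binary, least significant bit first, followed by a comma. -/
def numeral (k : ℕ) : List Letter := k.bits.map Letter.bit ++ [Letter.comma]

/-- `GateCode g w`: the word `w` describes the gate `g`. The targets of a fan-out gate are listed
in any order without repetition. -/
inductive GateCode {N : ℕ} : Gate N → List Letter → Prop
  | had (q : Fin N) :
      GateCode (.one hadamard q) ([Letter.had] ++ numeral q ++ [Letter.endGate])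
  | rot (r s : ℕ) (hs : 0 < s) (q : Fin N) :
      GateCode (.one (rotZ (2 * Real.pi * (r / s))) q)
        ([Letter.rot] ++ numeral r ++ numeral s ++ numeral q ++ [Letter.endGate])
  | fan (c : Fin N) (l : List (Fin N)) (hl : l.Nodup) (h : c ∉ l.toFinset) :
      GateCode (.fanOut c l.toFinset h)
        ([Letter.fan] ++ numeral c ++ l.flatMap (fun q => numeral q) ++ [Letter.endGate])

/-- The word `w` describes the layer `L`: it lists the gates of the layer. -/
def LayerCode {N : ℕ} (L : List (Gate N)) (w : List Letter) : Prop :=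
  ∃ ws : List (List Letter), List.Forall₂ GateCode L ws ∧ w = ws.flatten ++ [Letter.endLayer]

/-- The word `w` describes the circuit `C`: it consists of the number of qubits and the list of
the layers in order. -/
def CircuitCode {N : ℕ} (C : Circuit N) (w : List Letter) : Prop :=
  ∃ ws : List (List Letter), List.Forall₂ LayerCode C.layers ws ∧ w = numeral N ++ ws.flatten

/-! ### Log-space Turing machines and uniform families -/

/-- Head movements. -/
inductive Move : Type
  | left
  | stay
  | right

/-- The contents of a cell of the input tape, which holds the word `1^n` between two end
markers. -/
inductive InputCell : Type
  | leftEnd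
  | one
  | rightEnd

/-- A deterministic Turing machine with a two-way read-only input tape, finitely many read-write
work tapes and a write-only output tape. In each step it depends on its state and on the
cells under its heads, and it either halts (`none`) or changes its state, moves its input head,
writes on and moves along each work tape, and appends at most one letter to its output. -/
structure Machine : Type 1 where
  State : Type
  finiteState : Finite State
  Alphabet : Type
  finiteAlphabet : Finite Alphabet
  blank : Alphabet
  tapes : ℕ
  start : State
  step : State → InputCell → (Fin tapes → Alphabet) →
    Option (State × Move × (Fin tapes → Alphabet × Move) × Option Letter)

/-- Configurations of a machine. The cells of each one-way infinite work tape are numbered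
`0, 1, 2, …`. -/
structure Machine.Config (M : Machine) : Type where
  state : M.State
  inputHead : ℕ
  work : Fin M.tapes → ℕ → M.Alphabet
  head : Fin M.tapes → ℕ
  output : List Letter

/-- The input tape holds the left end marker in cell `0`, ones in cells `1, …, n`, and the right
end marker in cell `n + 1`. -/
def inputCell (n p : ℕ) : InputCell :=
  if p = 0 then .leftEnd else if p ≤ n then .one else .rightEnd

/-- Heads do not move left of cell `0`. -/
def Move.act : Move → ℕ → ℕ
  | .left, p => p - 1
  | .stay, p => p
  | .right, p => p + 1

/-- The initial configuration: empty work tapes, empty output. -/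
def Machine.init (M : Machine) : M.Config where
  state := M.start
  inputHead := 0
  work := fun _ _ => M.blank
  head := fun _ => 0
  output := []

/-- One step on input `1^n`; `none` if the machine halts. The input head does not leave the cells
`0, …, n + 1`. -/
def Machine.next (M : Machine) (n : ℕ) (c : M.Config) : Option M.Config :=
  (M.step c.state (inputCell n c.inputHead) (fun i => c.work i (c.head i))).map fun r =>
    { state := r.1
      inputHead := min (r.2.1.act c.inputHead) (n + 1)
      work := fun i => Function.update (c.work i) (c.head i) (r.2.2.1 i).1
      head := fun i => (r.2.2.1 i).2.act (c.head i)
      output := c.output ++ r.2.2.2.toList }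

/-- On input `1^n` the machine halts with output `w`. -/
def Machine.Outputs (M : Machine) (n : ℕ) (w : List Letter) : Prop :=
  ∃ c : M.Config, StateTransition.Reaches (M.next n) M.init c ∧ M.next n c = none ∧ c.output = w

/-- The machine works in logarithmic space: on input `1^n` it visits only the first
`O(log n)` cells of its work tapes. -/
def Machine.IsLogSpace (M : Machine) : Prop :=
  ∃ k : ℕ, ∀ (n : ℕ) (c : M.Config), StateTransition.Reaches (M.next n) M.init c →
    ∀ i, c.head i < k * (Nat.log 2 n + 1)

/-- A family of circuits is uniform if a log-space Turing machine generates, on input `1^n`, a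
description of the `n`-th circuit. -/
def IsUniform {N : ℕ → ℕ} (C : ∀ n, Circuit (N n)) : Prop :=
  ∃ M : Machine, M.IsLogSpace ∧ ∀ n, ∃ w, M.Outputs n w ∧ CircuitCode (C n) w

end QuantumFanOut

/-! Hadamard tests reduce Or to Or. Let `A` be the number of ones among some wires. An output wire
placed between two Hadamard gates that receives the relative phase `e^{2πiA/2^(j+1)}` ends as
exactly `1` if `A ≡ 2^j` and exactly `0` if `A ≡ 0` modulo `2^(j+1)`. If `A = 0`, the outputs of all
rows `j` are `0`. If `0 < A < 2^m`, the 2-adic valuation of `A` is one of the rows `j < m`, and the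
output of that row is surely `1`. The other outputs may be in superposition, but in every branch the
Or of the outputs is the Or of the inputs. A level applies the phases in constant depth: each wire
is fanned out into one copy per row, each output wire is added to its copies and to companions of
these, copies and companions are rotated in opposite directions, and everything is undone
(`level_support`).

A level of width `w` is cut into blocks of length at most `2^m - 1` with `m` outputs each, at cost
`O(w * m)`. Choosing `m` as the minimum of the binary length of `w` and `(8n/2^k)/w` makes the costs
of the levels `k` a geometric series (`symSize_levels_le`). The quota `(8n/2^k)/w` starts at `8` and
grows exponentially from level to level (`le_quota_succ`). Once it reaches the binary length of `w`,
one block suffices and the width drops to its binary length on each level (`width_succ_eq_size`,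
`Sufficient.succ`). Both phases last about `log* n` levels at most (`height_le`).

When at most two wires `a`, `b` remain, the wire `a ⊕ b` is added. The weight is then `0` or `2`, so
row `1` of a last level carries the Or with certainty (`blockWeight_three`). This wire is added to
the target and the computation is inverted (`runGates_orLayers`). Amplitudes are never computed: it
suffices to follow the supports of the states (`hadamards_diagonal`, `LevelState`).

For uniformity, the work tapes of a machine serve as binary registers. The polynomially bounded
functions computable in logarithmic space are closed under bounded recursion (`Comp.recursion`), and
printable words under indexed concatenation (`Word.flatMap`); `Word.exists_machine` turns such words
into machines. Powers of two in `blockLen` and `den` are capped to remain polynomially bounded. A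
capped block still exceeds the width, and the cap in `den` is inactive on the rows in use. -/

namespace QuantumFanOut

/-! ### Machine fragments -/

/-- Tape symbols of machine fragments: an optional bit together with a position mark. -/
abbrev Cell : Type := Option Bool × Bool

/-- The memory of a machine with `R` work tapes. -/
@[ext] structure Mem (R : ℕ) : Type where
  inp : ℕ
  work : Fin R → ℕ → Cell
  head : Fin R → ℕ
  out : List Letter

/-- The action of a machine in one step. -/
abbrev Act (R : ℕ) : Type := Move × (Fin R → Cell × Move) × Option Letter

/-- The effect of an action on the memory, on input `1^n`. -/
def Mem.act {R : ℕ} (n : ℕ) (a : Act R) (m : Mem R) : Mem R where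
  inp := min (a.1.act m.inp) (n + 1)
  work := fun i => Function.update (m.work i) (m.head i) (a.2.1 i).1
  head := fun i => (a.2.1 i).2.act (m.head i)
  out := m.out ++ a.2.2.toList

/-- A machine fragment with `R` work tapes, which stops with a result in `β`. -/
structure Frag (R : ℕ) (β : Type) : Type 1 where
  St : Type
  fin : Finite St
  start : St
  step : St → InputCell → (Fin R → Cell) → β ⊕ (St × Act R)

namespace Frag

variable {R : ℕ} {β : Type}

/-- One step of a fragment in a given memory. -/
def stepMem (F : Frag R β) (n : ℕ) (s : F.St) (m : Mem R) : β ⊕ (F.St × Act R) :=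
  F.step s (inputCell n m.inp) (fun i => m.work i (m.head i))

/-- A computation path along which all heads stay at positions at most `H`. -/
inductive Path (F : Frag R β) (n H : ℕ) : F.St → Mem R → F.St → Mem R → Prop
  | refl (s : F.St) (m : Mem R) (h : ∀ i, m.head i ≤ H) : Path F n H s m s m
  | cons (s s' t : F.St) (m m' : Mem R) (a : Act R) (h : ∀ i, m.head i ≤ H)
      (hs : F.stepMem n s m = .inr (s', a)) (hp : Path F n H s' (m.act n a) t m') :
      Path F n H s m t m'

/-- The fragment runs from memory `m` to memory `m'` and stops with the result `b`. -/
def Runs (F : Frag R β) (n H : ℕ) (m : Mem R) (b : β) (m' : Mem R) : Prop :=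
  ∃ t, F.Path n H F.start m t m' ∧ F.stepMem n t m' = .inl b

theorem Path.trans {F : Frag R β} {n H : ℕ} {s t u : F.St} {m m' m'' : Mem R}
    (h : F.Path n H s m t m') (h' : F.Path n H t m' u m'') : F.Path n H s m u m'' := by
  induction h with
  | refl => exact h'
  | cons s s' t m m' a h hs _ ih => exact .cons _ _ _ _ _ _ h hs (ih h')

theorem Path.mono {F : Frag R β} {n H H' : ℕ} (hH : H ≤ H') {s t : F.St} {m m' : Mem R}
    (h : F.Path n H s m t m') : F.Path n H' s m t m' := by
  induction h with
  | refl s m h => exact .refl _ _ fun i => (h i).trans hH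
  | cons s s' t m m' a h hs _ ih => exact .cons _ _ _ _ _ _ (fun i => (h i).trans hH) hs ih

theorem Path.head_le {F : Frag R β} {n H : ℕ} {s t : F.St} {m m' : Mem R}
    (h : F.Path n H s m t m') (i : Fin R) : m.head i ≤ H := by
  cases h with
  | refl _ _ h => exact h i
  | cons _ _ _ _ _ _ h _ _ => exact h i

theorem Path.inp_le {F : Frag R β} {n H : ℕ} {s t : F.St} {m m' : Mem R}
    (h : F.Path n H s m t m') (hm : m.inp ≤ n + 1) : m'.inp ≤ n + 1 := by
  induction h with
  | refl => exact hm
  | cons s s' t m m' a h hs _ ih => exact ih (min_le_right _ _)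

theorem Runs.mono {F : Frag R β} {n H H' : ℕ} (hH : H ≤ H') {m m' : Mem R} {b : β}
    (h : F.Runs n H m b m') : F.Runs n H' m b m' := by
  obtain ⟨t, h1, h2⟩ := h
  exact ⟨t, h1.mono hH, h2⟩

theorem Path.snoc {F : Frag R β} {n H : ℕ} {s t u : F.St} {m m' m'' : Mem R} {a : Act R}
    (h : F.Path n H s m t m') (hs : F.stepMem n t m' = .inr (u, a)) (hm : m'.act n a = m'')
    (hH : ∀ i, m''.head i ≤ H) (hH' : ∀ i, m'.head i ≤ H) : F.Path n H s m u m'' := by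
  subst hm
  exact h.trans (.cons _ _ _ _ _ _ hH' hs (.refl _ _ hH))

/-! #### Sequential composition and loops -/

/-- The action that changes nothing, given the cells under the heads. -/
def idle (ρ : Fin R → Cell) : Act R := (.stay, fun i => (ρ i, .stay), none)

/-- The bound on the input head matters, since every action clips it at `n + 1`. -/
theorem act_idle {n : ℕ} {m : Mem R} (hm : m.inp ≤ n + 1) :
    m.act n (idle fun i => m.work i (m.head i)) = m := by
  ext <;> simp [Mem.act, idle, Move.act, hm]

/-- First `F`, then `G`. -/
def seq (F : Frag R Unit) (G : Frag R β) : Frag R β where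
  St := F.St ⊕ G.St
  fin := by have := F.fin; have := G.fin; infer_instance
  start := .inl F.start
  step
    | .inl s, c, ρ => match F.step s c ρ with
      | .inl () => .inr (.inr G.start, idle ρ)
      | .inr (s', a) => .inr (.inl s', a)
    | .inr s, c, ρ => match G.step s c ρ with
      | .inl b => .inl b
      | .inr (s', a) => .inr (.inr s', a)

theorem Path.seq_left {F : Frag R Unit} {G : Frag R β} {n H : ℕ} {s t : F.St} {m m' : Mem R}
    (h : F.Path n H s m t m') : (F.seq G).Path n H (.inl s) m (.inl t) m' := by
  induction h with
  | refl s m h => exact .refl _ _ h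
  | cons s s' t m m' a h hs _ ih =>
    refine .cons _ (Sum.inl s') _ _ _ a h ?_ ih
    simp only [stepMem, seq] at hs ⊢
    rw [hs]

theorem Path.seq_right {F : Frag R Unit} {G : Frag R β} {n H : ℕ} {s t : G.St} {m m' : Mem R}
    (h : G.Path n H s m t m') : (F.seq G).Path n H (.inr s) m (.inr t) m' := by
  induction h with
  | refl s m h => exact .refl _ _ h
  | cons s s' t m m' a h hs _ ih =>
    refine .cons _ (Sum.inr s') _ _ _ a h ?_ ih
    simp only [stepMem, seq] at hs ⊢
    rw [hs]

theorem Runs.seq {F : Frag R Unit} {G : Frag R β} {n H : ℕ} {m m' m'' : Mem R} {b : β}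
    (hF : F.Runs n H m () m') (hG : G.Runs n H m' b m'') (hm : m.inp ≤ n + 1) :
    (F.seq G).Runs n H m b m'' := by
  obtain ⟨t, h1, h2⟩ := hF
  obtain ⟨u, h3, h4⟩ := hG
  refine ⟨.inr u, (h1.seq_left.snoc (u := Sum.inr G.start) (a := idle _) ?_
    (act_idle (h1.inp_le hm)) h3.head_le h3.head_le).trans h3.seq_right, ?_⟩
  · simp only [stepMem, Frag.seq] at h2 ⊢
    rw [h2]
  · simp only [stepMem, Frag.seq] at h4 ⊢
    rw [h4]

/-- Repeat: run the test `T`; as long as it yields `true`, run `F`. -/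
def loop (T : Frag R Bool) (F : Frag R Unit) : Frag R Unit where
  St := T.St ⊕ F.St
  fin := by have := T.fin; have := F.fin; infer_instance
  start := .inl T.start
  step
    | .inl s, c, ρ => match T.step s c ρ with
      | .inl true => .inr (.inr F.start, idle ρ)
      | .inl false => .inl ()
      | .inr (s', a) => .inr (.inl s', a)
    | .inr s, c, ρ => match F.step s c ρ with
      | .inl () => .inr (.inl T.start, idle ρ)
      | .inr (s', a) => .inr (.inr s', a)

theorem Path.loop_left {T : Frag R Bool} {F : Frag R Unit} {n H : ℕ} {s t : T.St} {m m' : Mem R}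
    (h : T.Path n H s m t m') : (T.loop F).Path n H (.inl s) m (.inl t) m' := by
  induction h with
  | refl s m h => exact .refl _ _ h
  | cons s s' t m m' a h hs _ ih =>
    refine .cons _ (Sum.inl s') _ _ _ a h ?_ ih
    simp only [stepMem, loop] at hs ⊢
    rw [hs]

theorem Path.loop_right {T : Frag R Bool} {F : Frag R Unit} {n H : ℕ} {s t : F.St} {m m' : Mem R}
    (h : F.Path n H s m t m') : (T.loop F).Path n H (.inr s) m (.inr t) m' := by
  induction h with
  | refl s m h => exact .refl _ _ h
  | cons s s' t m m' a h hs _ ih =>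
    refine .cons _ (Sum.inr s') _ _ _ a h ?_ ih
    simp only [stepMem, loop] at hs ⊢
    rw [hs]

theorem Runs.loop_done {T : Frag R Bool} {F : Frag R Unit} {n H : ℕ} {m m' : Mem R}
    (hT : T.Runs n H m false m') : (T.loop F).Runs n H m () m' := by
  obtain ⟨t, h1, h2⟩ := hT
  refine ⟨.inl t, h1.loop_left, ?_⟩
  simp only [stepMem, Frag.loop] at h2 ⊢
  rw [h2]

theorem Runs.loop_again {T : Frag R Bool} {F : Frag R Unit} {n H : ℕ} {m m₁ m₂ m' : Mem R}
    (hT : T.Runs n H m true m₁) (hF : F.Runs n H m₁ () m₂) (hL : (T.loop F).Runs n H m₂ () m')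
    (hm : m.inp ≤ n + 1) : (T.loop F).Runs n H m () m' := by
  obtain ⟨t, h1, h2⟩ := hT
  obtain ⟨u, h3, h4⟩ := hF
  obtain ⟨v, h5, h6⟩ := hL
  have hm₁ := h1.inp_le hm
  refine ⟨v, ((h1.loop_left.snoc (u := Sum.inr F.start) (a := idle _) ?_ (act_idle hm₁)
    h3.head_le h3.head_le).trans (h3.loop_right.snoc (u := Sum.inl T.start) (a := idle _) ?_
      (act_idle (h3.inp_le hm₁)) h5.head_le h5.head_le)).trans h5, h6⟩
  · simp only [stepMem, Frag.loop] at h2 ⊢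
    rw [h2]
  · simp only [stepMem, Frag.loop] at h4 ⊢
    rw [h4]

/-! #### A single pass over work tapes -/

/-- The states of a pass. -/
inductive ScanState (β : Type) : Type
  | start
  | run
  | ret (b : β)
  | fin (b : β)

instance [Finite β] : Finite (ScanState β) := by
  let f : ScanState β → Option Unit ⊕ (β ⊕ β)
    | .start => .inl none
    | .run => .inl (some ())
    | .ret b => .inr (.inl b)
    | .fin b => .inr (.inr b)
  refine Finite.of_injective f ?_
  rintro (_ | _ | _ | _) (_ | _ | _ | _) h <;> simp_all [f]

/-- A pass of the heads `mv` to the right, in which the tape `r` is rewritten, until the decision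
`dec` yields a result; then the heads return to the first cell. -/
def scan [Finite β] (r : Fin R) (mv : Fin R → Bool) (wr : (Fin R → Option Bool) → Option Bool)
    (em : (Fin R → Option Bool) → Option Letter) (dec : (Fin R → Option Bool) → Option β) :
    Frag R β where
  St := ScanState β
  fin := inferInstance
  start := .start
  step
    -- A decision in the first cell needs no way back. Otherwise this cell of tape `r` is marked, so
    -- that the returning heads recognise it.
    | .start, _, ρ => match dec fun i => (ρ i).1 with
      | some b => .inr (.fin b, .stay,
          fun i => (if i = r then (wr fun i => (ρ i).1, false) else ρ i, .stay),
          em fun i => (ρ i).1)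
      | none => .inr (.run, .stay,
          fun i => (if i = r then (wr fun i => (ρ i).1, true) else ρ i,
            if mv i then .right else .stay),
          em fun i => (ρ i).1)
    | .run, _, ρ => match dec fun i => (ρ i).1 with
      | some b => .inr (.ret b, .stay,
          fun i => (if i = r then (wr fun i => (ρ i).1, false) else ρ i,
            if mv i then .left else .stay),
          em fun i => (ρ i).1)
      | none => .inr (.run, .stay,
          fun i => (if i = r then (wr fun i => (ρ i).1, false) else ρ i,
            if mv i then .right else .stay),
          em fun i => (ρ i).1)
    | .ret b, _, ρ =>
      if (ρ r).2 then
        .inr (.fin b, .stay, fun i => (if i = r then ((ρ i).1, false) else ρ i, .stay), none)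
      else .inr (.ret b, .stay, fun i => (ρ i, if mv i then .left else .stay), none)
    | .fin b, _, _ => .inl b

end Frag

/-- The memory in which the work tapes hold the registers `e` in binary. -/
def regMem {R : ℕ} (h : ℕ) (e : ℕ → ℕ) (o : List Letter) : Mem R where
  inp := h
  work := fun i p => ((e i).bits[p]?, false)
  head := fun _ => 0
  out := o

namespace Frag

variable {R : ℕ} {β : Type}

/-- What the heads `mv` read in position `p` when the tapes hold the registers `e`. -/
def view (mv : Fin R → Bool) (e : ℕ → ℕ) (p : ℕ) : Fin R → Option Bool :=
  fun i => (e i).bits[if mv i then p else 0]?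

/-- The cell `P` of the decision is still rewritten and still contributes to the output, hence `p ≤
P` and `P + 1`. No head passes `P`, which is the space bound. Tape `r` has to be among the moving
ones because it carries the mark for the return. -/
theorem scan_runs [Finite β] {r : Fin R} {mv : Fin R → Bool}
    {wr : (Fin R → Option Bool) → Option Bool} {em : (Fin R → Option Bool) → Option Letter}
    {dec : (Fin R → Option Bool) → Option β} (hr : mv r = true) {n h : ℕ} (hh : h ≤ n + 1)
    {e e' : ℕ → ℕ} {o : List Letter} {P : ℕ} {b : β}
    (hrun : ∀ p < P, dec (view mv e p) = none) (hret : dec (view mv e P) = some b)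
    (he : ∀ i : Fin R, i ≠ r → e' i = e i)
    (hw : ∀ p, (e' r).bits[p]? = if p ≤ P then wr (view mv e p) else (e r).bits[p]?) :
    (scan r mv wr em dec).Runs n P (regMem h e o) b
      (regMem h e' (o ++ (List.range (P + 1)).flatMap fun p => (em (view mv e p)).toList)) := by
  -- The final memory is described cell by cell, so that the ends of both cases below become
  -- pointwise checks.
  have hend : ∀ (m : Mem R), m = regMem h e' (o ++ (List.range (P + 1)).flatMap
      fun p => (em (view mv e p)).toList) ↔ (m.inp = h ∧ (∀ i, m.head i = 0) ∧
        m.out = o ++ (List.range (P + 1)).flatMap (fun p => (em (view mv e p)).toList) ∧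
        ∀ i p, m.work i p = if i = r then
          (if p ≤ P then (wr (view mv e p), false) else ((e i).bits[p]?, false))
          else ((e i).bits[p]?, false)) := by
    intro m
    constructor
    · rintro rfl
      refine ⟨rfl, fun _ => rfl, rfl, fun i p => ?_⟩
      by_cases hi : i = r
      · subst hi
        simp only [regMem, hw, if_true]
        split_ifs <;> rfl
      · simp [regMem, hi, he]
    · rintro ⟨h1, h2, h3, h4⟩
      ext1
      · exact h1
      · funext i p
        rw [h4]
        by_cases hi : i = r
        · subst hi
          simp only [regMem, hw, if_true]
          split_ifs <;> rfl
        · simp [regMem, hi, he]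
      · funext i
        exact h2 i
      · exact h3
  cases P with
  | zero =>
    refine ⟨.fin b, .cons _ (ScanState.fin b) _ _ _ (.stay,
          fun i => (if i = r then (wr (view mv e 0), false) else ((e i).bits[0]?, false), .stay),
          em (view mv e 0)) (fun _ => le_rfl) ?_ ?_, rfl⟩
    · simp only [stepMem, scan, regMem]
      have : (fun i : Fin R => (e i).bits[0]?) = view mv e 0 := by
        funext i; simp [view]
      rw [this, hret]
    · rw [(hend (Mem.act n _ _)).2]
      · exact .refl _ _ fun _ => le_rfl
      · refine ⟨by simp [Mem.act, Move.act, regMem, hh], fun i => rfl, by simp [Mem.act, regMem],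
          fun i p => ?_⟩
        simp only [Mem.act, regMem, Function.update_apply]
        by_cases hi : i = r
        · rcases p with _ | p <;> simp [hi]
        · rcases p with _ | p <;> simp [hi]
  | succ P =>
    -- `mid p` is the memory on the way out with the cells before `p` processed, `back p` the memory
    -- on the way home; the mark sits in cell `0` of tape `r`.
    let mid : ℕ → Mem R := fun p =>
      { inp := h
        work := fun i q => if i = r ∧ q < p then (wr (view mv e q), decide (q = 0))
          else ((e i).bits[q]?, false)
        head := fun i => if mv i then p else 0
        out := o ++ (List.range p).flatMap fun p => (em (view mv e p)).toList }
    let back : ℕ → Mem R := fun p =>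
      { inp := h
        work := fun i q => if i = r ∧ q ≤ P + 1 then (wr (view mv e q), decide (q = 0))
          else ((e i).bits[q]?, false)
        head := fun i => if mv i then p else 0
        out := o ++ (List.range (P + 2)).flatMap fun p => (em (view mv e p)).toList }
    -- Only cells strictly to the left of the head have been rewritten, so the heads still read the
    -- old registers.
    have hmid : ∀ p, (fun i => ((mid p).work i ((mid p).head i)).1) = view mv e p := by
      intro p
      funext i
      simp only [mid, view]
      rw [if_neg]
      rintro ⟨rfl, hi⟩
      simp [hr] at hi
    have hhead : ∀ p ≤ P + 1, ∀ i, (if mv i then p else 0) ≤ P + 1 := by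
      intro p hp i
      split_ifs <;> omega
    have h0 : (scan r mv wr em dec).Path n (P + 1) .start (regMem h e o) .run (mid 1) := by
      refine .cons _ ScanState.run _ _ _ (.stay,
          fun i => (if i = r then (wr (view mv e 0), true) else ((e i).bits[0]?, false),
            if mv i then .right else .stay),
          em (view mv e 0)) (fun _ => Nat.zero_le _) ?_ ?_
      · simp only [stepMem, scan, regMem]
        have : (fun i : Fin R => (e i).bits[0]?) = view mv e 0 := by
          funext i; simp [view]
        rw [this, hrun 0 (by omega)]
      · have : Mem.act n (.stay,
          fun i => (if i = r then (wr (view mv e 0), true) else ((e i).bits[0]?, false),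
            if mv i then .right else .stay),
          em (view mv e 0)) (regMem h e o) = mid 1 := by
          ext1
          · simp [Mem.act, regMem, Move.act, hh, mid]
          · funext i q
            simp only [Mem.act, regMem, Function.update_apply, mid]
            by_cases hi : i = r
            · rcases q with _ | q <;> simp [hi]
            · rcases q with _ | q <;> simp [hi]
          · funext i
            simp only [Mem.act, regMem, mid]
            cases mv i <;> rfl
          · simp [Mem.act, regMem, mid]
        rw [this]
        exact .refl _ _ (hhead 1 (by omega))
    have h1 : ∀ p ≤ P, (scan r mv wr em dec).Path n (P + 1) .run (mid 1) .run (mid (p + 1)) := by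
      intro p
      induction p with
      | zero => intro _; exact .refl _ _ (hhead 1 (by omega))
      | succ p ih =>
        intro hp
        refine (ih (by omega)).snoc (a := (.stay,
          fun i => (if i = r then (wr (view mv e (p + 1)), false)
              else (mid (p + 1)).work i ((mid (p + 1)).head i),
            if mv i then .right else .stay), em (view mv e (p + 1)))) ?_ ?_
          (hhead _ (by omega)) (hhead _ (by omega))
        · simp only [stepMem, scan]
          rw [hmid, hrun (p + 1) (by omega)]
        · ext1
          · simp [Mem.act, Move.act, hh, mid]
          · funext i q
            simp only [Mem.act, Function.update_apply, mid]
            by_cases hi : i = r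
            · subst hi
              simp only [hr, if_true, true_and]
              rcases lt_trichotomy q (p + 1) with hq | hq | hq
              · simp [hq, hq.ne, hq.trans (Nat.lt_succ_self _)]
              · simp [hq]
              · simp [hq.ne', not_lt.2 hq.le, show ¬ q < p + 1 + 1 by omega]
            · simp only [hi, if_false, false_and]
              split_ifs <;> simp_all
          · funext i
            simp only [Mem.act, mid]
            cases mv i <;> rfl
          · simp [Mem.act, mid, List.range_succ]
    have h2 : (scan r mv wr em dec).Path n (P + 1) .run (mid (P + 1)) (.ret b) (back P) := by
      refine .cons _ (ScanState.ret b) _ _ _ (.stay,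
          fun i => (if i = r then (wr (view mv e (P + 1)), false)
              else (mid (P + 1)).work i ((mid (P + 1)).head i),
            if mv i then .left else .stay), em (view mv e (P + 1))) (hhead _ le_rfl) ?_ ?_
      · simp only [stepMem, scan]
        rw [hmid, hret]
      · have : Mem.act n (.stay,
          fun i => (if i = r then (wr (view mv e (P + 1)), false)
              else (mid (P + 1)).work i ((mid (P + 1)).head i),
            if mv i then .left else .stay), em (view mv e (P + 1))) (mid (P + 1)) = back P := by
          ext1
          · simp [Mem.act, Move.act, hh, mid, back]
          · funext i q
            simp only [Mem.act, Function.update_apply, mid, back]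
            by_cases hi : i = r
            · subst hi
              simp only [hr, if_true, true_and]
              rcases lt_trichotomy q (P + 1) with hq | hq | hq
              · simp [hq, hq.ne, hq.le]
              · simp [hq]
              · simp [hq.ne', not_lt.2 hq.le, not_le.2 hq]
            · simp only [hi, if_false, false_and]
              split_ifs <;> simp_all
          · funext i
            simp only [Mem.act, mid, back]
            cases mv i <;> rfl
          · simp [Mem.act, mid, back, List.range_succ]
        rw [this]
        exact .refl _ _ (hhead P (by omega))
    have h3 : ∀ p ≤ P, (scan r mv wr em dec).Path n (P + 1) (.ret b) (back p) (.ret b) (back 0) := by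
      intro p
      induction p with
      | zero => intro _; exact .refl _ _ (hhead 0 (by omega))
      | succ p ih =>
        intro hp
        refine .cons _ (ScanState.ret b) _ _ _ (.stay,
          fun i => ((back (p + 1)).work i ((back (p + 1)).head i),
            if mv i then .left else .stay), none) (hhead _ (by omega)) ?_ ?_
        · simp only [stepMem, scan]
          rw [if_neg]
          simp [back, hr, show p ≤ P by omega]
        · have : Mem.act n (.stay,
            fun i => ((back (p + 1)).work i ((back (p + 1)).head i),
              if mv i then .left else .stay), none) (back (p + 1)) = back p := by
            ext1
            · simp [Mem.act, Move.act, hh, back]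
            · funext i q
              simp [Mem.act]
              rfl
            · funext i
              simp only [Mem.act, back]
              cases mv i <;> rfl
            · simp [Mem.act, back]
          rw [this]
          exact ih (by omega)
    have h4 : (scan r mv wr em dec).Path n (P + 1) (.ret b) (back 0) (.fin b)
        (regMem h e' (o ++ (List.range (P + 1 + 1)).flatMap
          fun p => (em (view mv e p)).toList)) := by
      refine .cons _ (ScanState.fin b) _ _ _ (.stay, fun i => (if i = r then
          (((back 0).work i ((back 0).head i)).1, false)
          else (back 0).work i ((back 0).head i), .stay), none) (hhead _ (by omega)) ?_ ?_
      · simp only [stepMem, scan]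
        rw [if_pos]
        simp [back]
      · rw [(hend (Mem.act n _ _)).2]
        · exact .refl _ _ fun _ => Nat.zero_le _
        · refine ⟨by simp [Mem.act, Move.act, back, hh], fun i => by simp [Mem.act, back, Move.act],
            by simp [Mem.act, back], fun i p => ?_⟩
          simp only [Mem.act, back, Function.update_apply]
          by_cases hi : i = r
          · rcases p with _ | p <;> simp [hi]
          · rcases p with _ | p <;> simp [hi]
    exact ⟨.fin b, (((h0.trans (h1 P le_rfl)).trans h2).trans (h3 P le_rfl)).trans h4, rfl⟩

end Frag
end QuantumFanOut

namespace QuantumFanOut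

/-! ### Operations on binary registers -/

namespace Frag

variable {R : ℕ} {β : Type}

/-- The fragment transforms the registers `e` to `e'` with result `b` and output `w`. -/
def Does (F : Frag R β) (n H : ℕ) (e : ℕ → ℕ) (b : β) (e' : ℕ → ℕ) (w : List Letter) : Prop :=
  ∀ h ≤ n + 1, ∀ o, F.Runs n H (regMem h e o) b (regMem h e' (o ++ w))

theorem Does.mono {F : Frag R β} {n H H' : ℕ} {e e' : ℕ → ℕ} {b : β} {w : List Letter}
    (h : F.Does n H e b e' w) (hH : H ≤ H') : F.Does n H' e b e' w :=
  fun i hi o => (h i hi o).mono hH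

theorem Does.seq {F : Frag R Unit} {G : Frag R β} {n H : ℕ} {e e' e'' : ℕ → ℕ} {b : β}
    {w w' : List Letter} (hF : F.Does n H e () e' w) (hG : G.Does n H e' b e'' w') :
    (F.seq G).Does n H e b e'' (w ++ w') := by
  intro h hh o
  have := (hF h hh o).seq (hG h hh (o ++ w)) hh
  rwa [List.append_assoc] at this

theorem flatMap_const_nil {α γ : Type*} (l : List α) : (l.flatMap fun _ => ([] : List γ)) = [] := by
  induction l <;> simp_all

/-- Adding one clears the initial run of ones, whose length is `P`, and sets the next digit. That
digit may be absent, when `v` consists of ones only; therefore `≠ some true` rather than `= some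
false`. -/
theorem exists_carry (v : ℕ) : ∃ P ≤ v.size, (∀ p < P, v.bits[p]? = some true) ∧
    v.bits[P]? ≠ some true ∧
    ∀ p, (v + 1).bits[p]? = if p < P then some false else if p = P then some true
      else v.bits[p]? := by
  induction v using Nat.binaryRec' with
  | zero => exact ⟨0, by simp, by simp, by simp, fun p => by rcases p with _ | p <;> simp⟩
  | bit b v hb ih =>
    obtain ⟨P, h0, h1, h2, h3⟩ := ih
    have hbits : (Nat.bit b v).bits = b :: v.bits := Nat.bits_append_bit v b hb
    have hsize : (Nat.bit b v).size = v.size + 1 := by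
      rw [← Nat.size_eq_bits_len, hbits, List.length_cons, Nat.size_eq_bits_len]
    cases b with
    | false =>
      refine ⟨0, Nat.zero_le _, by simp, by rw [hbits]; simp, fun p => ?_⟩
      have : (Nat.bit false v + 1).bits = true :: v.bits := by
        rw [Nat.bit_false, Nat.bit1_bits]
      rw [this, hbits]
      rcases p with _ | p <;> simp
    | true =>
      refine ⟨P + 1, by omega, fun p hp => ?_, by simpa [hbits] using h2, fun p => ?_⟩
      · rw [hbits]
        rcases p with _ | p
        · simp
        · simpa using h1 p (by omega)
      · have : (Nat.bit true v + 1).bits = false :: (v + 1).bits := by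
          rw [Nat.bit_true, show 2 * v + 1 + 1 = 2 * (v + 1) by ring,
            Nat.bit0_bits _ (by omega)]
        rw [this, hbits]
        rcases p with _ | p
        · simp
        · simp [h3 p]

/-- Increment a register. -/
def inc (r : Fin R) : Frag R Unit :=
  scan r (fun i => decide (i = r))
    (fun v => if v r = some true then some false else some true) (fun _ => none)
    (fun v => if v r = some true then none else some ())

theorem inc_does (r : Fin R) (n : ℕ) (e : ℕ → ℕ) :
    (inc r).Does n (e r).size e () (Function.update e r (e r + 1)) [] := by
  obtain ⟨P, h0, h1, h2, h3⟩ := exists_carry (e r)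
  intro h hh o
  have hv : ∀ p, view (fun i => decide (i = r)) e p r = (e r).bits[p]? := fun p => by
    simp [view]
  have := scan_runs (r := r) (mv := fun i => decide (i = r))
    (wr := fun v => if v r = some true then some false else some true) (em := fun _ => none)
    (dec := fun v => if v r = some true then none else some ()) (by simp) hh
    (e := e) (e' := Function.update e r (e r + 1)) (o := o) (P := P) (b := ())
    (fun p hp => by simp [hv, h1 p hp]) (by simp [hv, h2])
    (fun i hi => by
      rw [Function.update_of_ne]
      exact fun h => hi (Fin.ext h))
    (fun p => by
      rw [Function.update_self, h3 p]
      simp only [hv]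
      rcases lt_trichotomy p P with hp | hp | hp
      · simp [hp, hp.le, h1 p hp]
      · simp [hp, h2]
      · simp [hp.ne', hp.not_ge, hp.not_gt])
  refine Runs.mono h0 ?_
  simpa [inc, flatMap_const_nil] using this

/-- Set a register to zero. -/
def clear (r : Fin R) : Frag R Unit :=
  scan r (fun i => decide (i = r)) (fun _ => none) (fun _ => none)
    (fun v => if v r = none then some () else none)

theorem clear_does (r : Fin R) (n : ℕ) (e : ℕ → ℕ) :
    (clear r).Does n (e r).size e () (Function.update e r 0) [] := by
  intro h hh o
  have hv : ∀ p, view (fun i => decide (i = r)) e p r = (e r).bits[p]? := fun p => by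
    simp [view]
  have := scan_runs (r := r) (mv := fun i => decide (i = r))
    (wr := fun v => none) (em := fun _ => none)
    (dec := fun v => if v r = none then some () else none) (by simp) hh
    (e := e) (e' := Function.update e r 0) (o := o) (P := (e r).size) (b := ())
    (fun p hp => by simp [hv, Nat.size_eq_bits_len, hp]) (by simp [hv, Nat.size_eq_bits_len])
    (fun i hi => by
      rw [Function.update_of_ne]
      exact fun h => hi (Fin.ext h))
    (fun p => by
      rw [Function.update_self]
      split_ifs with hp
      · simp
      · rw [List.getElem?_eq_none (l := (e r).bits)]
        · simp
        · rw [Nat.size_eq_bits_len]; omega)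
  simpa [clear, flatMap_const_nil] using this

/-- Append the binary numeral of a register to the output. -/
def emitNumeral (r : Fin R) : Frag R Unit :=
  scan r (fun i => decide (i = r)) (fun v => v r)
    (fun v => some ((v r).elim Letter.comma Letter.bit))
    (fun v => if v r = none then some () else none)

theorem emitNumeral_does (r : Fin R) (n : ℕ) (e : ℕ → ℕ) :
    (emitNumeral r).Does n (e r).size e () e (numeral (e r)) := by
  intro h hh o
  have hv : ∀ p, view (fun i => decide (i = r)) e p r = (e r).bits[p]? := fun p => by
    simp [view]
  have := scan_runs (r := r) (mv := fun i => decide (i = r))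
    (wr := fun v => v r) (em := fun v => some ((v r).elim Letter.comma Letter.bit))
    (dec := fun v => if v r = none then some () else none) (by simp) hh
    (e := e) (e' := e) (o := o) (P := (e r).size) (b := ())
    (fun p hp => by simp [hv, Nat.size_eq_bits_len, hp]) (by simp [hv, Nat.size_eq_bits_len])
    (fun i hi => rfl) (fun p => by simp [hv])
  have hout : (List.range ((e r).size + 1)).flatMap (fun p => (some
      ((view (fun i => decide (i = r)) e p r).elim Letter.comma Letter.bit)).toList)
      = numeral (e r) := by
    simp only [hv, Option.toList_some]
    rw [List.range_succ, List.flatMap_append, numeral]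
    congr 1
    · rw [← List.map_eq_flatMap, ← Nat.size_eq_bits_len]
      apply List.ext_getElem
      · simp
      · intro i h1 h2
        simp at h1
        simp [h1]
    · simp [Nat.size_eq_bits_len]
  rw [hout] at this
  exact this

/-- Test whether two registers differ. -/
def differ (r s : Fin R) : Frag R Bool :=
  scan r (fun i => decide (i = r) || decide (i = s)) (fun v => v r) (fun _ => none)
    (fun v => if v r = v s then (if v r = none then some false else none) else some true)

theorem differ_does (r s : Fin R) (n : ℕ) (e : ℕ → ℕ) :
    (differ r s).Does n (e r).size e (decide (e r ≠ e s)) e [] := by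
  intro h hh o
  have hv : ∀ p, view (fun i => decide (i = r) || decide (i = s)) e p r = (e r).bits[p]? :=
    fun p => by simp [view]
  have hv' : ∀ p, view (fun i => decide (i = r) || decide (i = s)) e p s = (e s).bits[p]? :=
    fun p => by simp [view]
  have hlen : ∀ p, (e r).size ≤ p ↔ (e r).bits[p]? = none := fun p => by
    simp [Nat.size_eq_bits_len]
  suffices H : ∃ P ≤ (e r).size, (∀ p < P, (e r).bits[p]? = (e s).bits[p]? ∧
      (e r).bits[p]? ≠ none) ∧ (if (e r).bits[P]? = (e s).bits[P]? then
        (if (e r).bits[P]? = none then some false else none) else some true) =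
        some (decide (e r ≠ e s)) by
    obtain ⟨P, h0, h1, h2⟩ := H
    have := scan_runs (r := r) (mv := fun i => decide (i = r) || decide (i = s))
      (wr := fun v => v r) (em := fun _ => none)
      (dec := fun v => if v r = v s then (if v r = none then some false else none)
        else some true) (by simp) hh
      (e := e) (e' := e) (o := o) (P := P) (b := decide (e r ≠ e s))
      (fun p hp => by
        simp only [hv, hv']
        rw [if_pos (h1 p hp).1, if_neg (h1 p hp).2])
      (by simp only [hv, hv']; exact h2)
      (fun i hi => rfl) (fun p => by simp [hv])
    refine Runs.mono h0 ?_
    simpa [differ, flatMap_const_nil] using this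
  by_cases heq : e r = e s
  · refine ⟨(e r).size, le_rfl, fun p hp => ⟨by rw [heq], fun hn => ?_⟩, ?_⟩
    · have := (hlen p).2 hn
      omega
    · simp [← heq, (hlen _).1 le_rfl]
  · have hex : ∃ p : ℕ, (e r).bits[p]? ≠ (e s).bits[p]? := by
      by_contra! hall
      refine heq ?_
      have : (e r).bits = (e s).bits := List.ext_getElem? hall
      rw [← Nat.digits_inj_iff (b := 2), Nat.digits_two_eq_bits, Nat.digits_two_eq_bits, this]
    classical
    have hspec := Nat.find_spec hex
    have hmin := fun p (hp : p < Nat.find hex) => not_not.1 (Nat.find_min hex hp)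
    -- Before the first difference neither word has ended: after a common end both would read `none`
    -- forever.
    have hnn : ∀ p < Nat.find hex, (e r).bits[p]? ≠ none := by
      intro p hp hn
      apply hspec
      have h1 := hn
      have h2 := (hmin p hp).symm.trans hn
      rw [List.getElem?_eq_none_iff] at h1 h2
      rw [List.getElem?_eq_none (by omega), List.getElem?_eq_none (by omega)]
    refine ⟨Nat.find hex, ?_, fun p hp => ⟨hmin p hp, hnn p hp⟩, ?_⟩
    · by_contra hlt
      exact hnn _ (not_le.1 hlt) ((hlen _).1 le_rfl)
    · rw [if_neg hspec]
      simp [heq]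

/-- Append a letter to the output. -/
def emitLetter (l : Letter) : Frag R Unit where
  St := Bool
  fin := inferInstance
  start := false
  step
    | false, _, ρ => .inr (true, .stay, fun i => (ρ i, .stay), some l)
    | true, _, _ => .inl ()

theorem emitLetter_does (l : Letter) (n : ℕ) (e : ℕ → ℕ) :
    (emitLetter (R := R) l).Does n 0 e () e [l] := by
  intro h hh o
  refine ⟨true, .cons _ true _ _ _ (.stay, fun i => (((e i).bits[0]?, false), .stay), some l)
    (fun _ => le_rfl) rfl ?_, rfl⟩
  have : Mem.act n (.stay, fun i => (((e i).bits[0]?, false), .stay), some l)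
      (regMem (R := R) h e o) = regMem h e (o ++ [l]) := by
    ext1
    · simp [Mem.act, regMem, Move.act, hh]
    · funext i
      simp [Mem.act, regMem]
    · rfl
    · rfl
  rw [this]
  exact .refl _ _ fun _ => le_rfl

/-- Do nothing. -/
def skip : Frag R Unit where
  St := Unit
  fin := inferInstance
  start := ()
  step _ _ _ := .inl ()

theorem skip_does (n : ℕ) (e : ℕ → ℕ) : (skip (R := R)).Does n 0 e () e [] := by
  intro h hh o
  rw [List.append_nil]
  exact ⟨(), .refl _ _ fun _ => le_rfl, rfl⟩

/-- For each value of register `b` below that of register `a`, run `F`. -/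
def forLoop (a b : Fin R) (F : Frag R Unit) : Frag R Unit :=
  (differ b a).loop (F.seq (inc b))

/-- `E i` are the registers before round `i`, and `E' i` those after its body, with the counter not
yet increased. The induction runs over the number `j` of rounds still to come, since
`Runs.loop_again` prepends a round. -/
theorem forLoop_does {a b : Fin R} {F : Frag R Unit} {n H k : ℕ} (E E' : ℕ → ℕ → ℕ)
    (w : ℕ → List Letter) (ha : ∀ i ≤ k, E i a = k) (hb : ∀ i ≤ k, E i b = i)
    (hF : ∀ i < k, F.Does n H (E i) () (E' i) (w i)) (hb' : ∀ i < k, E' i b = i)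
    (hE : ∀ i < k, Function.update (E' i) b (i + 1) = E (i + 1)) (hH : k.size ≤ H) :
    (forLoop a b F).Does n H (E 0) () (E k) ((List.range k).flatMap w) := by
  suffices h : ∀ j ≤ k, (forLoop a b F).Does n H (E (k - j)) () (E k)
      ((List.range' (k - j) j).flatMap w) by
    have := h k le_rfl
    rwa [Nat.sub_self, ← List.range_eq_range'] at this
  have hsz : ∀ i ≤ k, i.size ≤ H := fun i hi => (Nat.size_le_size hi).trans hH
  intro j
  induction j with
  | zero =>
    intro _ h hh o
    have := (differ_does b a n (E k) h hh o).mono (H' := H) (by rw [hb k le_rfl]; exact hH)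
    rw [ha k le_rfl, hb k le_rfl] at this
    simp only [Nat.sub_zero, List.range'_zero, List.flatMap_nil, ne_eq, not_true, decide_false]
      at this ⊢
    exact this.loop_done
  | succ j ih =>
    intro hj h hh o
    have hlt : k - (j + 1) < k := by omega
    have h1 := (differ_does b a n (E (k - (j + 1))) h hh o).mono (H' := H)
      (by rw [hb _ hlt.le]; exact hsz _ hlt.le)
    rw [ha _ hlt.le, hb _ hlt.le, decide_eq_true hlt.ne, List.append_nil] at h1
    have h2 := ((hF _ hlt).seq ((inc_does b n (E' (k - (j + 1)))).mono
      (H' := H) (by rw [hb' _ hlt]; exact hsz _ hlt.le))) h hh o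
    rw [hb' _ hlt, hE _ hlt, show k - (j + 1) + 1 = k - j by omega] at h2
    have h3 := ih (by omega) h hh (o ++ (w (k - (j + 1)) ++ []))
    have := Runs.loop_again h1 h2 h3 hh
    rw [List.range'_succ, List.flatMap_cons, show k - (j + 1) + 1 = k - j by omega]
    simpa [List.append_assoc, forLoop] using this

end Frag
end QuantumFanOut

/-! ### Logarithmic-space computability and its closure properties -/

namespace QuantumFanOut

/-! ### Polynomial bounds and logarithmic space -/

/-- The values `v` are bounded by a power of the sizes `M`. -/
def PolyLe {ι : Type} (M v : ι → ℕ) : Prop := ∃ c, ∀ x, v x ≤ M x ^ c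

namespace PolyLe

variable {ι : Type} {M v w : ι → ℕ}

theorem mono (hw : PolyLe M w) (h : ∀ x, v x ≤ w x) : PolyLe M v := by
  obtain ⟨c, hc⟩ := hw
  exact ⟨c, fun x => (h x).trans (hc x)⟩

theorem const (hM : ∀ x, 2 ≤ M x) (k : ℕ) : PolyLe M fun _ => k :=
  ⟨k, fun x => Nat.lt_two_pow_self.le.trans (Nat.pow_le_pow_left (hM x) k)⟩

theorem self : PolyLe M M := ⟨1, fun x => by simp⟩

theorem mul (hv : PolyLe M v) (hw : PolyLe M w) : PolyLe M fun x => v x * w x := by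
  obtain ⟨c, hc⟩ := hv
  obtain ⟨d, hd⟩ := hw
  exact ⟨c + d, fun x => by rw [pow_add]; exact Nat.mul_le_mul (hc x) (hd x)⟩

theorem pow (hv : PolyLe M v) (k : ℕ) : PolyLe M fun x => v x ^ k := by
  obtain ⟨c, hc⟩ := hv
  exact ⟨c * k, fun x => by rw [pow_mul]; exact Nat.pow_le_pow_left (hc x) k⟩

theorem add (hM : ∀ x, 2 ≤ M x) (hv : PolyLe M v) (hw : PolyLe M w) :
    PolyLe M fun x => v x + w x := by
  obtain ⟨c, hc⟩ := hv
  obtain ⟨d, hd⟩ := hw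
  refine ⟨c + d + 1, fun x => ?_⟩
  have h1 : M x ^ c ≤ M x ^ (c + d) := Nat.pow_le_pow_right (by have := hM x; omega) (by omega)
  have h2 : M x ^ d ≤ M x ^ (c + d) := Nat.pow_le_pow_right (by have := hM x; omega) (by omega)
  have h3 := hM x
  have h4 := hc x
  have h5 := hd x
  rw [pow_succ]
  nlinarith [Nat.zero_le (M x ^ (c + d))]

theorem comp {κ : Type} {N : κ → ℕ} {k : κ → ι} (hv : PolyLe M v)
    (h : PolyLe N fun y => M (k y)) : PolyLe N fun y => v (k y) := by
  obtain ⟨c, hc⟩ := hv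
  exact (h.pow c).mono fun y => hc (k y)

/-- Polynomial bounds become logarithmic space here. As `M x ≥ 2`, its logarithm is at least `1` and
absorbs the additive constants. -/
theorem size_le (hM : ∀ x, 2 ≤ M x) (hv : PolyLe M v) :
    ∃ c, ∀ x, (v x).size ≤ c * Nat.log 2 (M x) := by
  obtain ⟨c, hc⟩ := hv
  refine ⟨2 * c + 1, fun x => Nat.size_le.2 ?_⟩
  have h1 : M x < 2 ^ (Nat.log 2 (M x) + 1) := Nat.lt_pow_succ_log_self (by norm_num) _
  have h2 : 1 ≤ Nat.log 2 (M x) := Nat.log_pos (by norm_num) (hM x)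
  calc v x ≤ M x ^ c := hc x
    _ ≤ (2 ^ (Nat.log 2 (M x) + 1)) ^ c := Nat.pow_le_pow_left h1.le c
    _ = 2 ^ ((Nat.log 2 (M x) + 1) * c) := (pow_mul _ _ _).symm
    _ < 2 ^ ((2 * c + 1) * Nat.log 2 (M x)) := by
      refine Nat.pow_lt_pow_right (by norm_num) ?_
      nlinarith

theorem log_le (hM : ∀ x, 2 ≤ M x) (hv : PolyLe M v) :
    ∃ c, ∀ x, Nat.log 2 (v x) ≤ c * Nat.log 2 (M x) := by
  obtain ⟨c, hc⟩ := hv.size_le hM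
  refine ⟨c, fun x => le_trans ?_ (hc x)⟩
  rcases Nat.eq_zero_or_pos (v x) with h | h
  · simp [h]
  · exact (Nat.lt_size.2 (Nat.pow_log_le_self 2 h.ne')).le

end PolyLe

/-! ### Families of register transformations in logarithmic space -/

/-- A machine fragment transforms the registers `g x` to `g' x` with output `w x`, in space
logarithmic in `M x`. -/
def Tr (R : ℕ) {ι : Type} (M : ι → ℕ) (g g' : ι → ℕ → ℕ) (w : ι → List Letter) : Prop :=
  ∃ (F : Frag R Unit) (c : ℕ), ∀ n x, F.Does n (c * Nat.log 2 (M x)) (g x) () (g' x) (w x)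

namespace Tr

variable {R : ℕ} {ι : Type} {M : ι → ℕ} {g g' g'' : ι → ℕ → ℕ} {w w' : ι → List Letter}

theorem seq (h : Tr R M g g' w) (h' : Tr R M g' g'' w') :
    Tr R M g g'' (fun x => w x ++ w' x) := by
  obtain ⟨F, c, hF⟩ := h
  obtain ⟨G, d, hG⟩ := h'
  refine ⟨F.seq G, c + d, fun n x => ?_⟩
  exact ((hF n x).mono (Nat.mul_le_mul_right _ (by omega))).seq
    ((hG n x).mono (Nat.mul_le_mul_right _ (by omega)))

theorem seq_silent (h : Tr R M g g' w) (h' : Tr R M g' g'' fun _ => []) : Tr R M g g'' w := by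
  simpa using h.seq h'

theorem silent_seq (h : Tr R M g g' fun _ => []) (h' : Tr R M g' g'' w) : Tr R M g g'' w := by
  simpa using h.seq h'

theorem congr {h h' : ι → ℕ → ℕ} {v : ι → List Letter} (H : Tr R M g g' w)
    (hg : ∀ x, g x = h x) (hg' : ∀ x, g' x = h' x) (hw : ∀ x, w x = v x) : Tr R M h h' v := by
  obtain rfl : g = h := funext hg
  obtain rfl : g' = h' := funext hg'
  obtain rfl : w = v := funext hw
  exact H

/-- The logarithm of a polynomial quantity is a constant multiple of a logarithm, so reparametrised
families stay in logarithmic space. -/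
theorem comp {κ : Type} {N : κ → ℕ} (hN : ∀ y, 2 ≤ N y) (H : Tr R M g g' w) (k : κ → ι)
    (hk : PolyLe N fun y => M (k y)) :
    Tr R N (fun y => g (k y)) (fun y => g' (k y)) (fun y => w (k y)) := by
  obtain ⟨F, c, hF⟩ := H
  obtain ⟨d, hd⟩ := hk.log_le hN
  refine ⟨F, c * d, fun n y => (hF n (k y)).mono ?_⟩
  rw [mul_assoc]
  exact Nat.mul_le_mul_left _ (hd y)

theorem skip : Tr R M g g (fun _ => []) :=
  ⟨Frag.skip, 0, fun n x => (Frag.skip_does n (g x)).mono (Nat.zero_le _)⟩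

theorem letter (l : Letter) : Tr R M g g (fun _ => [l]) :=
  ⟨Frag.emitLetter l, 0, fun n x => (Frag.emitLetter_does l n (g x)).mono (Nat.zero_le _)⟩

theorem inc (hM : ∀ x, 2 ≤ M x) {r : ℕ} (hr : r < R) (hv : PolyLe M fun x => g x r) :
    Tr R M g (fun x => Function.update (g x) r (g x r + 1)) (fun _ => []) := by
  obtain ⟨c, hc⟩ := hv.size_le hM
  exact ⟨Frag.inc ⟨r, hr⟩, c, fun n x => (Frag.inc_does ⟨r, hr⟩ n (g x)).mono (hc x)⟩

theorem clear (hM : ∀ x, 2 ≤ M x) {r : ℕ} (hr : r < R) (hv : PolyLe M fun x => g x r) :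
    Tr R M g (fun x => Function.update (g x) r 0) (fun _ => []) := by
  obtain ⟨c, hc⟩ := hv.size_le hM
  exact ⟨Frag.clear ⟨r, hr⟩, c, fun n x => (Frag.clear_does ⟨r, hr⟩ n (g x)).mono (hc x)⟩

theorem num (hM : ∀ x, 2 ≤ M x) {r : ℕ} (hr : r < R) (hv : PolyLe M fun x => g x r) :
    Tr R M g g (fun x => numeral (g x r)) := by
  obtain ⟨c, hc⟩ := hv.size_le hM
  exact ⟨Frag.emitNumeral ⟨r, hr⟩, c,
    fun n x => (Frag.emitNumeral_does ⟨r, hr⟩ n (g x)).mono (hc x)⟩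

/-- One fragment has to serve all rounds, so the body is a family over pairs of an instance and a
round. Its space is measured by the instance alone. -/
theorem forLoop (hM : ∀ x, 2 ≤ M x) {a b : ℕ} (ha : a < R) (hb : b < R) {k : ι → ℕ}
    (hk : PolyLe M k) {E E' : ι → ℕ → ℕ → ℕ} {w : ι → ℕ → List Letter}
    (hbody : Tr R (ι := {p : ι × ℕ // p.2 < k p.1}) (fun p => M p.1.1)
      (fun p => E p.1.1 p.1.2) (fun p => E' p.1.1 p.1.2) (fun p => w p.1.1 p.1.2))
    (hEa : ∀ x, ∀ i ≤ k x, E x i a = k x) (hEb : ∀ x, ∀ i ≤ k x, E x i b = i)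
    (hEb' : ∀ x, ∀ i < k x, E' x i b = i)
    (hE : ∀ x, ∀ i < k x, Function.update (E' x i) b (i + 1) = E x (i + 1)) :
    Tr R M (fun x => E x 0) (fun x => E x (k x))
      (fun x => (List.range (k x)).flatMap (w x)) := by
  obtain ⟨F, c, hF⟩ := hbody
  obtain ⟨d, hd⟩ := hk.size_le hM
  refine ⟨Frag.forLoop ⟨a, ha⟩ ⟨b, hb⟩ F, c + d, fun n x => ?_⟩
  exact Frag.forLoop_does (E x) (E' x) (w x) (hEa x) (hEb x)
    (fun i hi => (hF n ⟨(x, i), hi⟩).mono (Nat.mul_le_mul_right _ (by omega))) (hEb' x) (hE x)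
    ((hd x).trans (Nat.mul_le_mul_right _ (by omega)))

/-- Register `b` is counted up, by a loop with empty body, until it agrees with `a`; this is why it
must start at zero. -/
theorem copy (hM : ∀ x, 2 ≤ M x) {a b : ℕ} (ha : a < R) (hb : b < R) (hab : a ≠ b)
    (hv : PolyLe M fun x => g x a) (h0 : ∀ x, g x b = 0) :
    Tr R M g (fun x => Function.update (g x) b (g x a)) (fun _ => []) := by
  have := forLoop hM ha hb hv (E := fun x i => Function.update (g x) b i)
    (E' := fun x i => Function.update (g x) b i) (w := fun _ _ => []) Tr.skip
    (fun x i _ => by simp [hab]) (fun x i _ => by simp) (fun x i _ => by simp)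
    (fun x i _ => by simp)
  refine this.congr (fun x => ?_) (fun x => rfl) fun x => Frag.flatMap_const_nil _
  rw [← h0 x, Function.update_eq_self]

theorem move (hM : ∀ x, 2 ≤ M x) {a b : ℕ} (ha : a < R) (hb : b < R) (hab : a ≠ b)
    (hv : PolyLe M fun x => g x a) (hw : PolyLe M fun x => g x b) :
    Tr R M g (fun x => Function.update (Function.update (g x) b (g x a)) a 0) (fun _ => []) := by
  have h1 := clear (g := g) hM hb hw
  have h2 := copy (g := fun x => Function.update (g x) b 0) hM ha hb hab (by simpa [hab] using hv)
    (by simp)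
  have h3 := h1.seq_silent h2
  have h4 := clear (g := fun x => Function.update (g x) b (g x a)) hM ha (by simpa [hab] using hv)
  refine (h3.congr (fun x => rfl) (fun x => ?_) fun x => rfl).seq_silent h4
  simp [hab]

end Tr

/-! ### Functions and words computable in logarithmic space -/

/-- The size of the registers below `d`. -/
def mass (d : ℕ) (e : ℕ → ℕ) : ℕ := 2 + ∑ i ∈ Finset.range d, e i

theorem two_le_mass (d : ℕ) (e : ℕ → ℕ) : 2 ≤ mass d e := Nat.le_add_right _ _

theorem le_mass {d i : ℕ} (hi : i < d) (e : ℕ → ℕ) : e i ≤ mass d e :=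
  (Finset.single_le_sum (f := e) (fun _ _ => Nat.zero_le _) (Finset.mem_range.2 hi)).trans
    (Nat.le_add_left _ _)

theorem polyLe_mass {ι : Type} {M : ι → ℕ} (hM : ∀ x, 2 ≤ M x) (g : ι → ℕ → ℕ) (d : ℕ)
    (h : ∀ i < d, PolyLe M fun x => g x i) : PolyLe M fun x => mass d (g x) := by
  induction d with
  | zero => exact (PolyLe.const hM 2).mono fun x => by simp [mass]
  | succ d ih =>
    refine ((ih fun i hi => h i (by omega)).add hM (h d (by omega))).mono fun x => ?_
    simp [mass, Finset.sum_range_succ, add_assoc]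

/-- Registers of which only those below `d` are in use. -/
abbrev Regs (d : ℕ) : Type := {e : ℕ → ℕ // ∀ i, d ≤ i → e i = 0}

/-- The size of registers in use. -/
abbrev Regs.mass {d : ℕ} (e : Regs d) : ℕ := QuantumFanOut.mass d e.1

theorem Regs.two_le {d : ℕ} (e : Regs d) : 2 ≤ e.mass := two_le_mass _ _

/-- Put a value on top of the registers in use. -/
def Regs.push {d : ℕ} (e : Regs d) (v : ℕ) : Regs (d + 1) :=
  ⟨Function.update e.1 d v, fun i hi => by
    rw [Function.update_of_ne (by omega)]; exact e.2 i (by omega)⟩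

theorem Regs.push_val {d : ℕ} (e : Regs d) (v : ℕ) : (e.push v).1 = Function.update e.1 d v := rfl

theorem Regs.update_zero {d : ℕ} (e : Regs d) : Function.update e.1 d 0 = e.1 := by
  funext i
  rcases eq_or_ne i d with rfl | hi
  · rw [Function.update_self, e.2 _ le_rfl]
  · rw [Function.update_of_ne hi]

theorem Regs.mass_push {d : ℕ} (e : Regs d) (v : ℕ) : (e.push v).mass = e.mass + v := by
  simp only [Regs.mass, QuantumFanOut.mass, Finset.sum_range_succ, Regs.push, Function.update_self]
  rw [Finset.sum_congr rfl fun i hi => Function.update_of_ne (Finset.mem_range.1 hi).ne _ _]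
  ring

/-- The function `f` of the registers below `d` is polynomially bounded and can be computed in
logarithmic space. The registers are passed by reference, the value is put on top of the
registers in use. -/
structure Comp (d : ℕ) (f : (ℕ → ℕ) → ℕ) : Prop where
  congr : ∀ e e' : ℕ → ℕ, (∀ i < d, e i = e' i) → f e = f e'
  bound : PolyLe (mass d) f
  -- The map `ρ` locates the arguments and `t` is the first free register. Registers from `t` on are
  -- zero at the start and, apart from the value in `t`, again at the end. Admitting all `R ≥ R₀`
  -- lets fragments with different demands run on the same tapes.
  frag : ∀ (ρ : ℕ → ℕ) (t : ℕ), (∀ i < d, ρ i < t) → ∃ R₀, ∀ R ≥ R₀,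
    Tr R (ι := Regs t) Regs.mass (fun e => e.1)
      (fun e => (e.push (f fun i => e.1 (ρ i))).1) (fun _ => [])

/-- The word `w`, which depends on the registers below `d`, can be printed in logarithmic
space. -/
structure Word (d : ℕ) (w : (ℕ → ℕ) → List Letter) : Prop where
  congr : ∀ e e' : ℕ → ℕ, (∀ i < d, e i = e' i) → w e = w e'
  frag : ∀ (ρ : ℕ → ℕ) (t : ℕ), (∀ i < d, ρ i < t) → ∃ R₀, ∀ R ≥ R₀,
    Tr R (ι := Regs t) Regs.mass (fun e => e.1) (fun e => e.1) (fun e => w fun i => e.1 (ρ i))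

namespace Comp

variable {d : ℕ} {f : (ℕ → ℕ) → ℕ}

theorem polyLe {ι : Type} {M : ι → ℕ} (hM : ∀ x, 2 ≤ M x) (hf : Comp d f) (g : ι → ℕ → ℕ)
    (hg : ∀ i < d, PolyLe M fun x => g x i) : PolyLe M fun x => f (g x) :=
  hf.bound.comp (polyLe_mass hM g d hg)

theorem polyLe_ref (hf : Comp d f) {ρ : ℕ → ℕ} {t : ℕ} (hρ : ∀ i < d, ρ i < t) :
    PolyLe (ι := Regs t) Regs.mass fun e => f fun i => e.1 (ρ i) :=
  hf.polyLe Regs.two_le (fun (e : Regs t) i => e.1 (ρ i))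
    fun i hi => PolyLe.self.mono fun e => le_mass (hρ i hi) e.1

theorem rename {k : ℕ} (hf : Comp k f) (σ : ℕ → ℕ) (hσ : ∀ i < k, σ i < d) :
    Comp d fun e => f fun i => e (σ i) where
  congr _ _ h := hf.congr _ _ fun i hi => h _ (hσ i hi)
  bound := hf.polyLe (two_le_mass d) (fun e i => e (σ i))
    fun i hi => PolyLe.self.mono fun e => le_mass (hσ i hi) e
  frag ρ t hρ := hf.frag (fun i => ρ (σ i)) t fun i hi => hρ _ (hσ i hi)

theorem weaken {k : ℕ} (hf : Comp k f) (hk : k ≤ d) : Comp d f :=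
  hf.rename (fun i => i) fun _ hi => hi.trans_le hk

theorem var {i : ℕ} (hi : i < d) : Comp d fun e => e i where
  congr _ _ h := h i hi
  bound := PolyLe.self.mono fun e => le_mass hi e
  frag ρ t hρ := ⟨t + 1, fun R hR =>
    Tr.copy Regs.two_le (by have := hρ i hi; omega) (by omega) (hρ i hi).ne
      (PolyLe.self.mono fun e => le_mass (hρ i hi) e.1) fun e => e.2 t le_rfl⟩

theorem zero : Comp d fun _ => 0 where
  congr _ _ _ := rfl
  bound := PolyLe.const (two_le_mass d) 0
  frag ρ t _ := ⟨0, fun R _ => Tr.skip.congr (fun e => rfl)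
    (fun e => by rw [Regs.push_val, e.update_zero]) fun e => rfl⟩

theorem succ (hf : Comp d f) : Comp d fun e => f e + 1 where
  congr _ _ h := by rw [hf.congr _ _ h]
  bound := hf.bound.add (two_le_mass d) (PolyLe.const (two_le_mass d) 1)
  frag ρ t hρ := by
    obtain ⟨R₀, h⟩ := hf.frag ρ t hρ
    refine ⟨R₀ + (t + 1), fun R hR => ?_⟩
    refine (h R (by omega)).seq_silent ((Tr.inc (r := t) Regs.two_le (by omega) ?_).congr
      (fun e => rfl) (fun e => ?_) fun e => rfl)
    · simpa [Regs.push_val] using hf.polyLe_ref hρ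
    · simp [Regs.push_val]

theorem const (k : ℕ) : Comp d fun _ => k := by
  induction k with
  | zero => exact zero
  | succ k ih => exact ih.succ

theorem polyLe_push {t : ℕ} {v : Regs t → ℕ} (hv : PolyLe Regs.mass v) :
    PolyLe (ι := Regs t) Regs.mass fun e => (e.push (v e)).mass := by
  simp only [Regs.mass_push]
  exact PolyLe.self.add Regs.two_le hv

/-- Substitution of a computed value for the last variable. -/
theorem subst {g : (ℕ → ℕ) → ℕ} (hg : Comp d g) (hf : Comp (d + 1) f) :
    Comp d fun e => f (Function.update e d (g e)) where
  congr e e' h := by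
    rw [hg.congr e e' h]
    refine hf.congr _ _ fun i hi => ?_
    rcases Nat.lt_succ_iff_lt_or_eq.1 hi with hi | rfl
    · rw [Function.update_of_ne hi.ne, Function.update_of_ne hi.ne, h i hi]
    · simp
  bound := by
    refine hf.polyLe (two_le_mass d) (fun e => Function.update e d (g e)) fun i hi => ?_
    rcases Nat.lt_succ_iff_lt_or_eq.1 hi with hi | rfl
    · simpa [hi.ne] using PolyLe.self.mono fun e => le_mass hi e
    · simpa using hg.bound
  frag ρ t hρ := by
    have hρ' : ∀ i < d + 1, Function.update ρ d t i < t + 1 := fun i hi => by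
      rcases Nat.lt_succ_iff_lt_or_eq.1 hi with hi | rfl
      · rw [Function.update_of_ne hi.ne]; exact (hρ i hi).trans (Nat.lt_succ_self t)
      · simp
    obtain ⟨R₁, h₁⟩ := hg.frag ρ t hρ
    obtain ⟨R₂, h₂⟩ := hf.frag (Function.update ρ d t) (t + 1) hρ'
    have hgb := hg.polyLe_ref hρ
    have hfb := (hf.polyLe_ref hρ').comp (polyLe_push hgb)
    have key : ∀ e : Regs t, (f fun i => (e.push (g fun i => e.1 (ρ i))).1
        (Function.update ρ d t i)) =
        f (Function.update (fun i => e.1 (ρ i)) d (g fun i => e.1 (ρ i))) := fun e => by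
      refine hf.congr _ _ fun i hi => ?_
      rcases Nat.lt_succ_iff_lt_or_eq.1 hi with hi | rfl
      · have := hρ i hi
        simp [hi.ne, Regs.push_val, this.ne]
      · simp [Regs.push_val]
    simp only [key] at hfb
    -- The value of `g` occupies register `t` and that of `f` register `t + 1`; the latter is then
    -- moved down onto the former.
    refine ⟨R₁ + R₂ + (t + 2), fun R hR => ?_⟩
    refine (h₁ R (by omega)).seq_silent (((h₂ R (by omega)).comp Regs.two_le _
      (polyLe_push hgb)).seq_silent ((Tr.move (a := t + 1) (b := t) Regs.two_le (by omega)
        (by omega) (by omega) ?_ ?_).congr (fun e => rfl) (fun e => ?_) fun e => rfl))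
    · simp only [key]
      simpa [Regs.push_val] using hfb
    · simpa [Regs.push_val] using hgb
    · rw [key, Regs.push_val, Regs.push_val, Regs.push_val]
      funext i
      have := e.2 (t + 1) (by omega)
      simp only [Function.update_apply]
      split_ifs <;> simp_all

set_option maxHeartbeats 1000000 in
/-- Bounded primitive recursion. -/
theorem recursion {b c s : (ℕ → ℕ) → ℕ} (hb : Comp d b) (hc : Comp d c) (hs : Comp (d + 2) s)
    {v : (ℕ → ℕ) → ℕ → ℕ} (hv0 : ∀ e, v e 0 = b e)
    (hv : ∀ e i, v e (i + 1) = s (Function.update (Function.update e d i) (d + 1) (v e i)))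
    {B : (ℕ → ℕ) → ℕ} (hB : PolyLe (mass d) B) (hvB : ∀ e, ∀ i ≤ c e, v e i ≤ B e) :
    Comp d fun e => v e (c e) := by
  have hcongr : ∀ e e' : ℕ → ℕ, (∀ i < d, e i = e' i) → ∀ i, v e i = v e' i := by
    intro e e' h i
    induction i with
    | zero => rw [hv0, hv0, hb.congr e e' h]
    | succ i ih =>
      rw [hv, hv]
      refine hs.congr _ _ fun j hj => ?_
      simp only [Function.update_apply, ih]
      split_ifs
      · rfl
      · rfl
      · exact h j (by omega)
  refine ⟨fun e e' h => by rw [hcongr e e' h, hc.congr e e' h],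
    hB.mono fun e => hvB e _ le_rfl, fun ρ t hρ => ?_⟩
  have hρ' : ∀ i < d, ρ i < t + 1 := fun i hi => (hρ i hi).trans (Nat.lt_succ_self t)
  -- The recursion step reads its last two arguments from the loop counter `t + 2` and the
  -- accumulator `t`.
  have hρ'' : ∀ i < d + 2, Function.update (Function.update ρ d (t + 2)) (d + 1) t i < t + 3 :=
    fun i hi => by
      simp only [Function.update_apply]
      split_ifs
      · omega
      · omega
      · have := hρ i (by omega); omega
  obtain ⟨R₁, h₁⟩ := hb.frag ρ t hρ
  obtain ⟨R₂, h₂⟩ := hc.frag ρ (t + 1) hρ'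
  obtain ⟨R₃, h₃⟩ := hs.frag _ (t + 3) hρ''
  have hbb := hb.polyLe_ref hρ
  have hcb := hc.polyLe_ref hρ
  -- All intermediate values have to be bounded, not only the last one: each of them is held in the
  -- accumulator.
  have hBb : PolyLe (ι := Regs t) Regs.mass fun e => B fun i => e.1 (ρ i) :=
    hB.comp (polyLe_mass Regs.two_le (fun (e : Regs t) i => e.1 (ρ i)) d
      fun i hi => PolyLe.self.mono fun e => le_mass (hρ i hi) e.1)
  have key : ∀ (e : Regs t) a, (fun i => (e.push a).1 (ρ i)) =
      fun i => if ρ i = t then a else e.1 (ρ i) := by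
    intro e a
    funext i
    simp [Regs.push_val, Function.update_apply]
  have hck : ∀ (e : Regs t) a, (c fun i => (e.push a).1 (ρ i)) = c fun i => e.1 (ρ i) := by
    intro e a
    refine hc.congr _ _ fun i hi => ?_
    simp [Regs.push_val, (hρ i hi).ne]
  refine ⟨R₁ + R₂ + R₃ + (t + 4), fun R hR => ?_⟩
  -- Before round `j`, register `t` holds the accumulator, `t + 1` the number of rounds and `t + 2`
  -- the counter.
  let E : Regs t → ℕ → Regs (t + 3) := fun e j =>
    ((e.push (v (fun i => e.1 (ρ i)) j)).push (c fun i => e.1 (ρ i))).push j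
  have htt : t ≠ t + 1 + 1 := by omega
  have hsk : ∀ (e : Regs t) j, (s fun i => (E e j).1
      (Function.update (Function.update ρ d (t + 2)) (d + 1) t i)) =
      v (fun i => e.1 (ρ i)) (j + 1) := by
    intro e j
    rw [hv]
    refine hs.congr _ _ fun i hi => ?_
    rcases (by omega : i < d ∨ i = d ∨ i = d + 1) with hi | rfl | rfl
    · have := hρ i hi
      have h1 : ρ i ≠ t := by omega
      have h2 : ρ i ≠ t + 1 := by omega
      have h3 : ρ i ≠ t + 2 := by omega
      have h4 : i ≠ d + 1 := by omega
      simp [E, Regs.push_val, hi.ne, h1, h2, h3, h4]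
    · simp [E, Regs.push_val]
    · simp [E, Regs.push_val, htt]
  have hE0 : Tr R (ι := Regs t) Regs.mass (fun e => e.1) (fun e => (E e 0).1) fun _ => [] := by
    refine (h₁ R (by omega)).seq_silent (((h₂ R (by omega)).comp Regs.two_le _
      (polyLe_push hbb)).congr (fun e => rfl) (fun e => ?_) fun e => rfl)
    simp only [E, hck, hv0]
    rw [Regs.push_val _ 0, Regs.update_zero]
  let ι' := {p : Regs t × ℕ // p.2 < c fun i => p.1.1 (ρ i)}
  have hM' : ∀ p : ι', 2 ≤ p.1.1.mass := fun p => p.1.1.two_le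
  have hpm : PolyLe (ι := ι') (fun p => p.1.1.mass) fun p => p.1.1.mass := PolyLe.self
  have hpc : PolyLe (ι := ι') (fun p => p.1.1.mass) fun p => c fun i => p.1.1.1 (ρ i) :=
    hcb.comp hpm
  have hpB : PolyLe (ι := ι') (fun p => p.1.1.mass) fun p => B fun i => p.1.1.1 (ρ i) :=
    hBb.comp hpm
  have hpv : PolyLe (ι := ι') (fun p => p.1.1.mass)
      fun p => v (fun i => p.1.1.1 (ρ i)) p.1.2 := hpB.mono fun p => hvB _ _ p.2.le
  have hpv' : PolyLe (ι := ι') (fun p => p.1.1.mass)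
      fun p => v (fun i => p.1.1.1 (ρ i)) (p.1.2 + 1) := hpB.mono fun p => hvB _ _ p.2
  have hpE : PolyLe (ι := ι') (fun p => p.1.1.mass) fun p => (E p.1.1 p.1.2).mass := by
    simp only [E, Regs.mass_push]
    exact ((hpm.add hM' hpv).add hM' hpc).add hM' (hpc.mono fun p => p.2.le)
  have hbody : Tr R (ι := ι') (fun p => p.1.1.mass) (fun p => (E p.1.1 p.1.2).1)
      (fun p => Function.update (E p.1.1 p.1.2).1 t (v (fun i => p.1.1.1 (ρ i)) (p.1.2 + 1)))
      fun _ => [] := by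
    have := (h₃ R (by omega)).comp hM' (fun p : ι' => E p.1.1 p.1.2) hpE
    simp only [hsk] at this
    refine this.seq_silent ((Tr.move (a := t + 3) (b := t) hM' (by omega) (by omega)
      (by omega) ?_ ?_).congr (fun p => rfl) (fun p => ?_) fun p => rfl)
    · simpa [Regs.push_val] using hpv'
    · simpa [Regs.push_val, E, htt] using hpv
    · have := (E p.1.1 p.1.2).2 (t + 3) (by omega)
      rw [Regs.push_val]
      funext i
      simp only [Function.update_apply]
      split_ifs <;> simp_all
  have hloop := Tr.forLoop Regs.two_le (a := t + 1) (b := t + 2) (by omega) (by omega) hcb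
    (E := fun e j => (E e j).1) (E' := fun e j => Function.update (E e j).1 t
      (v (fun i => e.1 (ρ i)) (j + 1))) (w := fun _ _ => []) hbody
    (fun e j _ => by simp [E, Regs.push_val]) (fun e j _ => by simp [E, Regs.push_val])
    (fun e j _ => by simp [E, Regs.push_val])
    (fun e j _ => by
      funext i
      simp only [E, Regs.push_val, Function.update_apply]
      split_ifs <;> simp_all)
  have hall := hE0.seq hloop
  have hfin := Tr.clear Regs.two_le (r := t + 1) (R := R)
    (g := fun e : Regs t => (E e (c fun i => e.1 (ρ i))).1) (by omega)
    (by simpa [E, Regs.push_val] using hcb)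
  have hfin' := Tr.clear Regs.two_le (r := t + 2) (R := R)
    (g := fun e : Regs t => Function.update (E e (c fun i => e.1 (ρ i))).1 (t + 1) 0) (by omega)
    (by simpa [E, Regs.push_val] using hcb)
  refine (hall.seq_silent (hfin.seq_silent hfin')).congr (fun e => rfl) (fun e => ?_)
    fun e => by simp [Frag.flatMap_const_nil]
  have h1 := e.2 (t + 1) (by omega)
  have h2 := e.2 (t + 2) (by omega)
  funext i
  simp only [E, Regs.push_val, Function.update_apply]
  split_ifs <;> simp_all

end Comp

namespace Word

variable {d : ℕ} {w w' : (ℕ → ℕ) → List Letter}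

theorem nil : Word d fun _ => [] where
  congr _ _ _ := rfl
  frag _ _ _ := ⟨0, fun _ _ => Tr.skip⟩

theorem letter (l : Letter) : Word d fun _ => [l] where
  congr _ _ _ := rfl
  frag _ _ _ := ⟨0, fun _ _ => Tr.letter l⟩

theorem append (hw : Word d w) (hw' : Word d w') : Word d fun e => w e ++ w' e where
  congr _ _ h := by rw [hw.congr _ _ h, hw'.congr _ _ h]
  frag ρ t hρ := by
    obtain ⟨R₁, h₁⟩ := hw.frag ρ t hρ
    obtain ⟨R₂, h₂⟩ := hw'.frag ρ t hρ
    exact ⟨R₁ + R₂, fun R hR => (h₁ R (by omega)).seq (h₂ R (by omega))⟩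

theorem num {f : (ℕ → ℕ) → ℕ} (hf : Comp d f) : Word d fun e => numeral (f e) where
  congr _ _ h := by rw [hf.congr _ _ h]
  frag ρ t hρ := by
    obtain ⟨R₁, h₁⟩ := hf.frag ρ t hρ
    have hfb := hf.polyLe_ref hρ
    refine ⟨R₁ + (t + 1), fun R hR => ?_⟩
    refine (((h₁ R (by omega)).silent_seq (Tr.num (r := t) Regs.two_le (by omega)
      ?_)).seq_silent (Tr.clear (r := t) Regs.two_le (by omega) ?_)).congr (fun e => rfl)
      (fun e => ?_) fun e => ?_
    · simpa [Regs.push_val] using hfb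
    · simpa [Regs.push_val] using hfb
    · rw [Regs.push_val, Function.update_idem, e.update_zero]
    · simp [Regs.push_val]

theorem rename {k : ℕ} (hw : Word k w) (σ : ℕ → ℕ) (hσ : ∀ i < k, σ i < d) :
    Word d fun e => w fun i => e (σ i) where
  congr _ _ h := hw.congr _ _ fun i hi => h _ (hσ i hi)
  frag ρ t hρ := hw.frag (fun i => ρ (σ i)) t fun i hi => hρ _ (hσ i hi)

theorem subst {g : (ℕ → ℕ) → ℕ} (hg : Comp d g) (hw : Word (d + 1) w) :
    Word d fun e => w (Function.update e d (g e)) where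
  congr e e' h := by
    rw [hg.congr e e' h]
    refine hw.congr _ _ fun i hi => ?_
    simp only [Function.update_apply]
    split_ifs
    · rfl
    · exact h i (by omega)
  frag ρ t hρ := by
    have hρ' : ∀ i < d + 1, Function.update ρ d t i < t + 1 := fun i hi => by
      simp only [Function.update_apply]
      split_ifs
      · omega
      · have := hρ i (by omega); omega
    obtain ⟨R₁, h₁⟩ := hg.frag ρ t hρ
    obtain ⟨R₂, h₂⟩ := hw.frag (Function.update ρ d t) (t + 1) hρ'
    have hgb := hg.polyLe_ref hρ
    refine ⟨R₁ + R₂ + (t + 1), fun R hR => ?_⟩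
    refine (((h₁ R (by omega)).silent_seq ((h₂ R (by omega)).comp Regs.two_le _
      (Comp.polyLe_push hgb))).seq_silent (Tr.clear (r := t) Regs.two_le (by omega) ?_)).congr
      (fun e => rfl) (fun e => ?_) fun e => ?_
    · simpa [Regs.push_val] using hgb
    · rw [Regs.push_val, Function.update_idem, e.update_zero]
    · refine hw.congr _ _ fun i hi => ?_
      rcases (by omega : i < d ∨ i = d) with hi | rfl
      · simp [Regs.push_val, hi.ne, (hρ i hi).ne]
      · simp [Regs.push_val]

/-- Concatenation of the words for all values of the last variable below a bound. -/
theorem flatMap {c : (ℕ → ℕ) → ℕ} (hc : Comp d c) (hw : Word (d + 1) w) :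
    Word d fun e => (List.range (c e)).flatMap fun i => w (Function.update e d i) where
  congr e e' h := by
    rw [hc.congr e e' h]
    congr 1
    funext j
    refine hw.congr _ _ fun i hi => ?_
    simp only [Function.update_apply]
    split_ifs
    · rfl
    · exact h i (by omega)
  frag ρ t hρ := by
    have hρ' : ∀ i < d + 1, Function.update ρ d (t + 1) i < t + 2 := fun i hi => by
      simp only [Function.update_apply]
      split_ifs
      · omega
      · have := hρ i (by omega); omega
    obtain ⟨R₁, h₁⟩ := hc.frag ρ t hρ
    obtain ⟨R₂, h₂⟩ := hw.frag (Function.update ρ d (t + 1)) (t + 2) hρ'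
    have hcb := hc.polyLe_ref hρ
    -- Register `t` holds the number of rounds, and `t + 1` the counter, which serves as the last
    -- variable of the word.
    let E : Regs t → ℕ → Regs (t + 2) := fun e j => (e.push (c fun i => e.1 (ρ i))).push j
    refine ⟨R₁ + R₂ + (t + 2), fun R hR => ?_⟩
    let ι' := {p : Regs t × ℕ // p.2 < c fun i => p.1.1 (ρ i)}
    have hM' : ∀ p : ι', 2 ≤ p.1.1.mass := fun p => p.1.1.two_le
    have hpm : PolyLe (ι := ι') (fun p => p.1.1.mass) fun p => p.1.1.mass := PolyLe.self
    have hpc : PolyLe (ι := ι') (fun p => p.1.1.mass) fun p => c fun i => p.1.1.1 (ρ i) :=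
      hcb.comp hpm
    have hpE : PolyLe (ι := ι') (fun p => p.1.1.mass) fun p => (E p.1.1 p.1.2).mass := by
      simp only [E, Regs.mass_push]
      exact (hpm.add hM' hpc).add hM' (hpc.mono fun p => p.2.le)
    have hbody := (h₂ R (by omega)).comp hM' (fun p : ι' => E p.1.1 p.1.2) hpE
    have hloop := Tr.forLoop Regs.two_le (a := t) (b := t + 1) (by omega) (by omega) hcb
      (E := fun e j => (E e j).1) (E' := fun e j => (E e j).1) (w := fun e j => w fun i =>
        (E e j).1 (Function.update ρ d (t + 1) i)) hbody
      (fun e j _ => by simp [E, Regs.push_val]) (fun e j _ => by simp [E, Regs.push_val])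
      (fun e j _ => by simp [E, Regs.push_val]) (fun e j _ => by simp [E, Regs.push_val])
    have hfin := Tr.clear Regs.two_le (r := t) (R := R)
      (g := fun e : Regs t => (E e (c fun i => e.1 (ρ i))).1) (by omega)
      (by simpa [E, Regs.push_val] using hcb)
    have hfin' := Tr.clear Regs.two_le (r := t + 1) (R := R)
      (g := fun e : Regs t => Function.update (E e (c fun i => e.1 (ρ i))).1 t 0) (by omega)
      (by simpa [E, Regs.push_val] using hcb)
    refine (((h₁ R (by omega)).congr (fun e => rfl) (fun e => ?_) fun e => rfl).silent_seq
      (hloop.seq_silent (hfin.seq_silent hfin'))).congr (fun e => rfl) (fun e => ?_) fun e => ?_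
    · simp only [E]
      rw [Regs.push_val _ 0, Regs.update_zero]
    · have h1 := e.2 (t + 1) (by omega)
      have h2 := e.2 t (by omega)
      funext i
      simp only [E, Regs.push_val, Function.update_apply]
      split_ifs <;> simp_all
    · congr 1
      funext j
      refine hw.congr _ _ fun i hi => ?_
      rcases (by omega : i < d ∨ i = d) with hi | rfl
      · have := hρ i hi
        have h1 : ρ i ≠ t + 1 := by omega
        simp [E, Regs.push_val, hi.ne, this.ne, h1]
      · simp [E, Regs.push_val]

end Word

end QuantumFanOut

namespace QuantumFanOut

/-! ### From fragments to machines -/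

namespace Frag

variable {R : ℕ} {β : Type}

/-- A fragment as a machine. -/
def toMachine (F : Frag R β) : Machine where
  State := F.St
  finiteState := F.fin
  Alphabet := Cell
  finiteAlphabet := inferInstance
  blank := (none, false)
  tapes := R
  start := F.start
  step s c ρ := match F.step s c ρ with
    | .inl _ => none
    | .inr x => some x

/-- The machine configuration with a given state and memory. -/
def config (F : Frag R β) (s : F.St) (m : Mem R) : F.toMachine.Config :=
  ⟨s, m.inp, m.work, m.head, m.out⟩

theorem next_config_halt {F : Frag R β} {n : ℕ} {s : F.St} {m : Mem R} {b : β}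
    (h : F.stepMem n s m = .inl b) : F.toMachine.next n (F.config s m) = none := by
  simp only [stepMem] at h
  simp [Machine.next, toMachine, config, h]

theorem next_config {F : Frag R β} {n : ℕ} {s s' : F.St} {m : Mem R} {a : Act R}
    (h : F.stepMem n s m = .inr (s', a)) :
    F.toMachine.next n (F.config s m) = some (F.config s' (m.act n a)) := by
  simp only [stepMem] at h
  simp [Machine.next, toMachine, config, h, Mem.act]

theorem Path.reaches {F : Frag R β} {n H : ℕ} {s t : F.St} {m m' : Mem R}
    (h : F.Path n H s m t m') :
    StateTransition.Reaches (F.toMachine.next n) (F.config s m) (F.config t m') := by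
  induction h with
  | refl => exact Relation.ReflTransGen.refl
  | cons s s' t m m' a h hs _ ih =>
    exact Relation.ReflTransGen.head (next_config hs) ih

/-- The machine is deterministic, so every reachable configuration lies on the given halting path.
This yields the space bound for all reachable configurations. -/
theorem Path.head_le_of_reaches {F : Frag R β} {n H : ℕ} {s t : F.St} {m m' : Mem R} {b : β}
    (h : F.Path n H s m t m') (ht : F.stepMem n t m' = .inl b) {c : F.toMachine.Config}
    (hc : StateTransition.Reaches (F.toMachine.next n) (F.config s m) c) (i : Fin R) :
    c.head i ≤ H := by
  induction h with
  | refl s m h =>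
    rcases Relation.ReflTransGen.cases_head hc with rfl | ⟨c', h1, _⟩
    · exact h i
    · rw [next_config_halt ht] at h1
      simp at h1
  | cons s s' t m m' a h hs _ ih =>
    rcases Relation.ReflTransGen.cases_head hc with rfl | ⟨c', h1, h2⟩
    · exact h i
    · rw [next_config hs] at h1
      obtain rfl : F.config s' (Mem.act n a m) = c' := by simpa using h1
      exact ih ht h2

theorem config_regMem (F : Frag R β) :
    F.config F.start (regMem 0 (fun _ => 0) []) = F.toMachine.init := by
  simp [config, Machine.init, regMem, toMachine]

/-- Move the input head to the right. -/
def advance : Frag R Unit where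
  St := Bool
  fin := inferInstance
  start := false
  step
    | false, _, ρ => .inr (true, .right, fun i => (ρ i, .stay), none)
    | true, _, _ => .inl ()

theorem advance_runs (n h : ℕ) (hh : h ≤ n) (e : ℕ → ℕ) (o : List Letter) :
    (advance (R := R)).Runs n 0 (regMem h e o) () (regMem (h + 1) e o) := by
  refine ⟨true, .cons _ true _ _ _ (.right, fun i => (((e i).bits[0]?, false), .stay), none)
    (fun _ => le_rfl) rfl ?_, rfl⟩
  have : Mem.act n (.right, fun i => (((e i).bits[0]?, false), .stay), none)
      (regMem (R := R) h e o) = regMem (h + 1) e o := by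
    ext1
    · simp [Mem.act, regMem, Move.act, hh]
    · funext i
      simp [Mem.act, regMem]
    · rfl
    · simp [Mem.act, regMem]
  rw [this]
  exact .refl _ _ fun _ => le_rfl

/-- Test whether the input head is on the input word. -/
def onInput : Frag R Bool where
  St := Unit
  fin := inferInstance
  start := ()
  step _ c _ := .inl (match c with
    | .one => true
    | _ => false)

theorem onInput_runs (n h : ℕ) (h0 : 0 < h) (e : ℕ → ℕ) (o : List Letter) :
    (onInput (R := R)).Runs n 0 (regMem h e o) (decide (h ≤ n)) (regMem h e o) := by
  refine ⟨(), .refl _ _ fun _ => le_rfl, ?_⟩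
  simp only [stepMem, onInput, regMem, inputCell, h0.ne', if_false]
  split_ifs with hn <;> simp [hn]

/-- Load the length of the input into a register. -/
def load (r : Fin R) : Frag R Unit := advance.seq (onInput.loop ((inc r).seq advance))

/-- The register grows by one for each input cell passed, so it contains `n - j` when the head
stands at `n - j + 1`; the induction is over the number `j` of ones not yet counted. -/
theorem load_runs (r : Fin R) (n : ℕ) :
    (load r).Runs n n.size (regMem 0 (fun _ => 0) []) ()
      (regMem (n + 1) (Function.update (fun _ => 0) r n) []) := by
  suffices h : ∀ j ≤ n, (onInput.loop ((inc r).seq advance)).Runs n n.size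
      (regMem (n - j + 1) (Function.update (fun _ => 0) r (n - j)) []) ()
      (regMem (n + 1) (Function.update (fun _ => 0) r n) []) by
    have h0 : regMem (R := R) 1 (fun _ => 0) [] =
        regMem (n - n + 1) (Function.update (fun _ => 0) r (n - n)) [] := by
      rw [Nat.sub_self]
      congr 1
      exact (Function.update_eq_self r.1 (fun _ : ℕ => 0)).symm
    refine ((advance_runs n 0 (Nat.zero_le _) _ _).mono (Nat.zero_le _)).seq ?_ (Nat.zero_le _)
    rw [zero_add, h0]
    exact h n le_rfl
  intro j
  induction j with
  | zero =>
    intro _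
    have := (onInput_runs (R := R) n (n + 1) (by omega) (Function.update (fun _ => 0) r n) []).mono
      (Nat.zero_le n.size)
    rw [decide_eq_false (by omega)] at this
    exact this.loop_done
  | succ j ih =>
    intro hj
    have h1 := (onInput_runs (R := R) n (n - (j + 1) + 1) (by omega)
      (Function.update (fun _ => 0) r (n - (j + 1))) []).mono (Nat.zero_le n.size)
    rw [decide_eq_true (by omega)] at h1
    have h2 := (inc_does r n (Function.update (fun _ => 0) r (n - (j + 1)))
      (n - (j + 1) + 1) (by omega) []).mono (H' := n.size)
      (by rw [Function.update_self]; exact Nat.size_le_size (by omega))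
    rw [Function.update_self, Function.update_idem, List.append_nil] at h2
    have h3 := h2.seq ((advance_runs n (n - (j + 1) + 1) (by omega) _ _).mono
      (Nat.zero_le n.size)) (by simp only [regMem]; omega)
    refine h1.loop_again h3 ?_ (by simp only [regMem]; omega)
    have := ih (by omega)
    rwa [show n - j = n - (j + 1) + 1 by omega] at this

end Frag

/-- Words that can be printed in logarithmic space are printed by log-space machines. -/
theorem Word.exists_machine {w : (ℕ → ℕ) → List Letter} (hw : Word 1 w) :
    ∃ M : Machine, M.IsLogSpace ∧ ∀ n, M.Outputs n (w fun _ => n) := by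
  obtain ⟨R₀, h⟩ := hw.frag (fun i => i) 1 fun i hi => hi
  obtain ⟨F, c, hF⟩ := h (R₀ + 1) (by omega)
  have hlog : ∀ n, Nat.log 2 (2 + n) ≤ 2 * (Nat.log 2 n + 1) := fun n => by
    refine Nat.le_of_lt_succ (Nat.log_lt_of_lt_pow (by omega) ?_)
    have h1 : n < 2 ^ (Nat.log 2 n + 1) := Nat.lt_pow_succ_log_self (by norm_num) n
    have h2 : 1 ≤ Nat.log 2 n + 1 := by omega
    rw [show (2 * (Nat.log 2 n + 1)).succ = Nat.log 2 n + 1 + (Nat.log 2 n + 1) + 1 by omega,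
      pow_succ, pow_add]
    have h3 : 2 ≤ 2 ^ (Nat.log 2 n + 1) := by
      calc 2 = 2 ^ 1 := rfl
        _ ≤ _ := Nat.pow_le_pow_right (by norm_num) h2
    nlinarith
  have hsize : ∀ n : ℕ, n.size ≤ Nat.log 2 n + 1 := fun n =>
    Nat.size_le.2 (Nat.lt_pow_succ_log_self (by norm_num) n)
  let G : Frag (R₀ + 1) Unit := (Frag.load ⟨0, by omega⟩).seq F
  -- Printing needs `c * log (2 + n)`, which `hlog` bounds by `2 * c` units of `log n + 1`; one more
  -- unit suffices for loading `n`.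
  have hG : ∀ n, ∃ m, G.Runs n ((2 * c + 1) * (Nat.log 2 n + 1)) (regMem 0 (fun _ => 0) []) () m ∧
      m.out = w fun _ => n := by
    intro n
    have h1 := (Frag.load_runs (R := R₀ + 1) ⟨0, by omega⟩ n).mono
      (H' := (2 * c + 1) * (Nat.log 2 n + 1)) (by have := hsize n; nlinarith)
    let e : Regs 1 := ⟨Function.update (fun _ => 0) 0 n, fun i hi => by
      rw [Function.update_of_ne (by omega)]⟩
    have hm : e.mass = 2 + n := by simp [e, Regs.mass, mass]
    have h2 := (hF n e (n + 1) le_rfl []).mono (H' := (2 * c + 1) * (Nat.log 2 n + 1)) (by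
      rw [hm]
      have := hlog n
      nlinarith)
    refine ⟨_, h1.seq h2 (Nat.zero_le _), ?_⟩
    simp only [regMem, List.nil_append]
    exact hw.congr _ _ fun i hi => by obtain rfl : i = 0 := (by omega); simp [e]
  -- One further unit makes the inequality strict.
  refine ⟨G.toMachine, ⟨2 * c + 2, fun n cfg hc i => ?_⟩, fun n => ?_⟩
  · obtain ⟨m, ⟨t, h1, h2⟩, -⟩ := hG n
    rw [← Frag.config_regMem] at hc
    have := h1.head_le_of_reaches h2 hc i
    nlinarith
  · obtain ⟨m, ⟨t, h1, h2⟩, h3⟩ := hG n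
    refine ⟨G.config t m, ?_, Frag.next_config_halt h2, h3⟩
    rw [← Frag.config_regMem]
    exact h1.reaches

end QuantumFanOut

namespace QuantumFanOut

/-! ### Arithmetic in logarithmic space -/

/-- Composition with computable arguments. -/
theorem Word.comp {k d : ℕ} {w : (ℕ → ℕ) → List Letter} (hw : Word k w)
    (g : ℕ → (ℕ → ℕ) → ℕ) (hg : ∀ i < k, Comp d (g i)) :
    Word d fun e => w fun i => g i e := by
  -- Arguments are substituted one at a time, the last one first: those below `k - j` are still
  -- extra variables, placed after the `d` actual ones.
  suffices h : ∀ j ≤ k, Word (d + (k - j))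
      fun e => w fun i => if i < k - j then e (d + i) else g i e by
    simpa using h k le_rfl
  intro j
  induction j with
  | zero =>
    intro _
    refine cast (congrArg _ (funext fun e => ?_)) (hw.rename (d := d + (k - 0)) (fun i => d + i)
      fun i hi => by omega)
    exact hw.congr _ _ fun i hi => by simp [hi]
  | succ j ih =>
    intro hj
    have h1 := ih (by omega)
    rw [show d + (k - j) = d + (k - (j + 1)) + 1 by omega] at h1
    refine cast (congrArg _ (funext fun e => ?_))
      (Word.subst ((hg (k - (j + 1)) (by omega)).weaken (Nat.le_add_right d _)) h1)
    refine hw.congr _ _ fun i hi => ?_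
    rcases lt_trichotomy i (k - (j + 1)) with h | h | h
    · simp [h, h.ne, show i < k - j by omega]
    · simp [h, show k - (j + 1) < k - j by omega]
    · simp only [show ¬ i < k - (j + 1) by omega, show ¬ i < k - j by omega, if_false]
      exact (hg i hi).congr _ _ fun l hl => by rw [Function.update_of_ne (by omega)]

namespace Comp

theorem comp {k d : ℕ} {f : (ℕ → ℕ) → ℕ} (hf : Comp k f)
    (g : ℕ → (ℕ → ℕ) → ℕ) (hg : ∀ i < k, Comp d (g i)) :
    Comp d fun e => f fun i => g i e := by
  suffices h : ∀ j ≤ k, Comp (d + (k - j))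
      fun e => f fun i => if i < k - j then e (d + i) else g i e by
    simpa using h k le_rfl
  intro j
  induction j with
  | zero =>
    intro _
    refine cast (congrArg _ (funext fun e => ?_)) (hf.rename (d := d + (k - 0)) (fun i => d + i)
      fun i hi => by omega)
    exact hf.congr _ _ fun i hi => by simp [hi]
  | succ j ih =>
    intro hj
    have h1 := ih (by omega)
    rw [show d + (k - j) = d + (k - (j + 1)) + 1 by omega] at h1
    refine cast (congrArg _ (funext fun e => ?_))
      (Comp.subst ((hg (k - (j + 1)) (by omega)).weaken (Nat.le_add_right d _)) h1)
    refine hf.congr _ _ fun i hi => ?_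
    rcases lt_trichotomy i (k - (j + 1)) with h | h | h
    · simp [h, h.ne, show i < k - j by omega]
    · simp [h, show k - (j + 1) < k - j by omega]
    · simp only [show ¬ i < k - (j + 1) by omega, show ¬ i < k - j by omega, if_false]
      exact (hg i hi).congr _ _ fun l hl => by rw [Function.update_of_ne (by omega)]

variable {d : ℕ} {f g : (ℕ → ℕ) → ℕ}

theorem comp₁ {φ : ℕ → ℕ} (hφ : Comp 1 fun e => φ (e 0)) (hf : Comp d f) :
    Comp d fun e => φ (f e) :=
  hφ.comp (fun _ => f) fun _ _ => hf

theorem comp₂ {φ : ℕ → ℕ → ℕ} (hφ : Comp 2 fun e => φ (e 0) (e 1)) (hf : Comp d f)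
    (hg : Comp d g) : Comp d fun e => φ (f e) (g e) :=
  hφ.comp (fun i => if i = 0 then f else g) fun i _ => by
    split_ifs
    exacts [hf, hg]

theorem add (hf : Comp d f) (hg : Comp d g) : Comp d fun e => f e + g e := by
  refine comp₂ (φ := fun x y => x + y) ?_ hf hg
  have h0 : Comp 2 fun e => e 0 := var (by omega)
  have h1 : Comp 2 fun e => e 1 := var (by omega)
  exact recursion h0 h1 (s := fun e => e 3 + 1) (var (by omega)).succ
    (v := fun e i => e 0 + i) (fun e => rfl) (fun e i => by simp; ring)
    (h0.bound.add (two_le_mass 2) h1.bound) fun e i hi => by simpa using hi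

theorem pred (hf : Comp d f) : Comp d fun e => f e - 1 := by
  refine comp₁ (φ := fun x => x - 1) ?_ hf
  have h0 : Comp 1 fun e => e 0 := var (by omega)
  exact recursion zero h0 (s := fun e => e 1) (var (by omega)) (v := fun e i => i - 1)
    (fun e => rfl) (fun e i => by simp) h0.bound fun e i hi => by omega

theorem sub (hf : Comp d f) (hg : Comp d g) : Comp d fun e => f e - g e := by
  refine comp₂ (φ := fun x y => x - y) ?_ hf hg
  have h0 : Comp 2 fun e => e 0 := var (by omega)
  have h1 : Comp 2 fun e => e 1 := var (by omega)
  exact recursion h0 h1 (s := fun e => e 3 - 1) (pred (var (by omega)))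
    (v := fun e i => e 0 - i) (fun e => rfl) (fun e i => by simp; omega)
    h0.bound fun e i hi => by omega

theorem mul (hf : Comp d f) (hg : Comp d g) : Comp d fun e => f e * g e := by
  refine comp₂ (φ := fun x y => x * y) ?_ hf hg
  have h0 : Comp 2 fun e => e 0 := var (by omega)
  have h1 : Comp 2 fun e => e 1 := var (by omega)
  exact recursion zero h1 (s := fun e => e 3 + e 0) (add (var (by omega)) (var (by omega)))
    (v := fun e i => e 0 * i) (fun e => rfl) (fun e i => by simp; ring)
    (h0.bound.mul h1.bound) fun e i hi => Nat.mul_le_mul_left _ hi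

/-- In truncated subtraction, `min x y = x - (x - y)`. -/
theorem min (hf : Comp d f) (hg : Comp d g) : Comp d fun e => min (f e) (g e) :=
  cast (congrArg _ (funext fun e => by omega)) (hf.sub (hf.sub hg))

/-- The quotient `q` is counted up as long as `(q + 1) * y ≤ x`, a condition with indicator `1 - ((q
+ 1) * y - x)`. The factor `1 - (1 - y)` stops the count when `y = 0`, in accordance with `x / 0 =
0`. -/
theorem div (hf : Comp d f) (hg : Comp d g) : Comp d fun e => f e / g e := by
  refine comp₂ (φ := fun x y => x / y) ?_ hf hg
  have h0 : Comp 2 fun e => e 0 := var (by omega)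
  have h1 : Comp 2 fun e => e 1 := var (by omega)
  have key := recursion zero h0
    (s := fun e => e 3 + (1 - ((e 3 + 1) * e 1 - e 0)) * (1 - (1 - e 1)))
    (add (var (by omega)) (mul (sub (const 1) (sub (mul (add (var (by omega)) (const 1))
      (var (by omega))) (var (by omega)))) (sub (const 1) (sub (const 1) (var (by omega))))))
    (v := fun e i => Min.min i (e 0 / e 1)) (fun e => by simp) (fun e i => ?_) h0.bound
    fun e i hi => (min_le_left _ _).trans hi
  · refine cast (congrArg _ (funext fun e => ?_)) key
    exact min_eq_right (Nat.div_le_self _ _)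
  · simp only [Function.update_self, ne_eq, OfNat.zero_ne_ofNat, not_false_eq_true,
      Function.update_of_ne, OfNat.one_ne_ofNat, Nat.reduceAdd]
    rcases Nat.eq_zero_or_pos (e 1) with hy | hy
    · simp [hy]
    · have h3 : 1 - (1 - e 1) = 1 := by omega
      rw [h3, mul_one]
      rcases le_or_gt (e 0 / e 1) i with hle | hlt
      · rw [min_eq_right hle, min_eq_right (by omega)]
        have : e 0 < (e 0 / e 1 + 1) * e 1 := by
          rw [mul_comm]; exact Nat.lt_mul_div_succ _ hy
        omega
      · rw [min_eq_left hlt.le, min_eq_left (by omega)]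
        have : (i + 1) * e 1 ≤ e 0 := (Nat.le_div_iff_mul_le hy).1 hlt
        omega

theorem mod (hf : Comp d f) (hg : Comp d g) : Comp d fun e => f e % g e :=
  cast (congrArg _ (funext fun e => by
    have := Nat.div_add_mod (f e) (g e)
    omega)) (hf.sub (hg.mul (hf.div hg)))

/-- Division by a power of two. -/
theorem divPow (hf : Comp d f) (hg : Comp d g) : Comp d fun e => f e / 2 ^ g e := by
  refine comp₂ (φ := fun x y => x / 2 ^ y) ?_ hf hg
  have h0 : Comp 2 fun e => e 0 := var (by omega)
  have h1 : Comp 2 fun e => e 1 := var (by omega)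
  exact recursion h0 h1 (s := fun e => e 3 / 2) (div (var (by omega)) (const 2))
    (v := fun e i => e 0 / 2 ^ i) (fun e => by simp)
    (fun e i => by simp [pow_succ, Nat.div_div_eq_div_mul])
    h0.bound fun e i hi => Nat.div_le_self _ _

/-- Powers of two up to a bound. -/
theorem minPow (hf : Comp d f) (hg : Comp d g) : Comp d fun e => Min.min (2 ^ f e) (g e) := by
  refine comp₂ (φ := fun x y => Min.min (2 ^ x) y) ?_ hf hg
  have h0 : Comp 2 fun e => e 0 := var (by omega)
  have h1 : Comp 2 fun e => e 1 := var (by omega)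
  exact recursion (min (const 1) h1) h0 (s := fun e => Min.min (2 * e 3) (e 1))
    (min (mul (const 2) (var (by omega))) (var (by omega)))
    (v := fun e i => Min.min (2 ^ i) (e 1)) (fun e => by simp)
    (fun e i => by simp [pow_succ]; omega)
    h1.bound fun e i hi => min_le_right _ _

/-- The length `v` is counted up as long as `2 ^ v ≤ x`. Capping the power at `x + 1` keeps it
polynomially bounded without affecting the comparison. -/
theorem size (hf : Comp d f) : Comp d fun e => (f e).size := by
  refine comp₁ (φ := fun x => x.size) ?_ hf
  have h0 : Comp 1 fun e => e 0 := var (by omega)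
  have key := recursion zero h0 (s := fun e => e 2 + (1 - (Min.min (2 ^ e 2) (e 0 + 1) - e 0)))
    (add (var (by omega)) (sub (const 1) (sub (minPow (var (by omega)) (succ (var (by omega))))
      (var (by omega)))))
    (v := fun e i => Min.min i (e 0).size) (fun e => by simp) (fun e i => ?_) h0.bound
    fun e i hi => (min_le_left _ _).trans hi
  · refine cast (congrArg _ (funext fun e => ?_)) key
    exact min_eq_right (Nat.size_le.2 Nat.lt_two_pow_self)
  · simp only [Function.update_self, ne_eq, OfNat.zero_ne_ofNat, not_false_eq_true,
      Function.update_of_ne, zero_ne_one, Nat.reduceAdd]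
    rcases le_or_gt (e 0).size i with hle | hlt
    · rw [min_eq_right hle, min_eq_right (by omega)]
      have := Nat.lt_size_self (e 0)
      omega
    · rw [min_eq_left hlt.le, min_eq_left (by omega)]
      have := Nat.lt_size.1 hlt
      omega

end Comp

end QuantumFanOut

/-! ### Layout of the circuit and computability of its parameters -/

namespace QuantumFanOut

/-! ### The circuit -/

/-- Gates on qubits with natural numbers as indices. -/
inductive Sym : Type
  | had (q : ℕ)
  | rot (r s q : ℕ)
  | fan (c : ℕ) (l : List ℕ)

/-- The description of a gate. -/
def Sym.word : Sym → List Letter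
  | .had q => [Letter.had] ++ numeral q ++ [Letter.endGate]
  | .rot r s q => [Letter.rot] ++ numeral r ++ numeral s ++ numeral q ++ [Letter.endGate]
  | .fan c l => [Letter.fan] ++ numeral c ++ l.flatMap numeral ++ [Letter.endGate]

/-- The inverse gate. -/
def Sym.inv : Sym → Sym
  | .rot r s q => .rot (s - r) s q
  | g => g

/-- The description of a layer. -/
def layerWord (L : List Sym) : List Letter := L.flatMap Sym.word ++ [Letter.endLayer]

/-- The number of rows of a level of width `w`. -/
def rows (n k w : ℕ) : ℕ := min w.size (8 * n / 2 ^ k / w)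

/-- The length of the blocks of a level of width `w` with `m` rows, namely `2 ^ m - 1` as long as
this does not exceed the width. -/
def blockLen (w m : ℕ) : ℕ := min (2 ^ m) (2 * w + 2) - 1

/-- The number of output wires of a level. -/
def outs (w m : ℕ) : ℕ := ((w - 1) / blockLen w m + 1) * m

/-- The widths of the levels. -/
def width (n : ℕ) : ℕ → ℕ
  | 0 => n
  | k + 1 => outs (width n k) (rows n k (width n k))

/-- Search for a level of width at most two, in a given number of steps. -/
def heightAux (n : ℕ) : ℕ → ℕ
  | 0 => 0
  | i + 1 => heightAux n i + (1 - (3 - width n (heightAux n i)))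

/-- The number of levels. -/
def height (n : ℕ) : ℕ := heightAux n (8 * n + 8)

/-- The range of the coordinates of ancilla qubits. -/
def span (n : ℕ) : ℕ := 8 * n + 16

/-- The index of an ancilla qubit: a wire of level `k` if `t = 2`, and a copy of a wire (`t = 0`) or
a companion of such a copy (`t = 1`) otherwise. -/
def ix (n t k u : ℕ) : ℕ := n + 1 + ((t * span n + k) * span n + u)

/-- Denominators of rotation angles. -/
def den (w j : ℕ) : ℕ := min (2 ^ (j + 2)) (4 * w + 4)

/-- Hadamard gates on all output wires. -/
def hadLayer (n k w m : ℕ) : List Sym :=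
  (List.range (outs w m)).map fun o => .had (ix n 2 (k + 1) o)

/-- Copy each wire once per row. -/
def copyLayer (n k w m : ℕ) : List Sym :=
  (List.range w).map fun i =>
    .fan (ix n 2 k i) ((List.range m).map fun j => ix n 0 k (i * m + j))

/-- The targets of output wire `o`: the copies in its row of the wires in its block, and their
companions. -/
def targets (n k w m o : ℕ) : List ℕ :=
  (List.range (min (blockLen w m) (w - o / m * blockLen w m))).flatMap fun i =>
    [ix n 0 k ((o / m * blockLen w m + i) * m + o % m),
      ix n 1 k ((o / m * blockLen w m + i) * m + o % m)]

/-- Add each output wire to its targets. -/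
def fanLayer (n k w m : ℕ) : List Sym :=
  (List.range (outs w m)).map fun o => .fan (ix n 2 (k + 1) o) (targets n k w m o)

/-- Rotate the copies and, in the opposite direction, their companions. -/
def rotLayer (n k w m : ℕ) : List Sym :=
  ((List.range (w * m)).map fun u => .rot 1 (den w (u % m)) (ix n 0 k u)) ++
    (List.range (w * m)).map fun u => .rot (den w (u % m) - 1) (den w (u % m)) (ix n 1 k u)

/-- One level of the circuit. -/
def level (n k w m : ℕ) : List (List Sym) :=
  [hadLayer n k w m, copyLayer n k w m, fanLayer n k w m, rotLayer n k w m,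
    fanLayer n k w m, copyLayer n k w m, hadLayer n k w m]

/-- Copy the input. -/
def inputLayer (n : ℕ) : List Sym := (List.range n).map fun i => .fan i [ix n 2 0 i]

/-- The first half of the circuit computes the Or of the input on a wire. -/
def forward (n : ℕ) : List (List Sym) :=
  [inputLayer n] ++
    (List.range (height n)).flatMap (fun k => level n k (width n k) (rows n k (width n k))) ++
    [[.fan (ix n 2 (height n) 0) [ix n 2 (height n) 2]],
      [.fan (ix n 2 (height n) 1) [ix n 2 (height n) 2]]] ++
    level n (height n) 3 2

/-- The inverse of a sequence of layers. -/
def invLayers (U : List (List Sym)) : List (List Sym) := U.reverse.map (List.map Sym.inv)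

/-- The layers of the circuit. -/
def orLayers (n : ℕ) : List (List Sym) :=
  forward n ++ [[.fan (ix n 2 (height n + 1) 1) [n]]] ++ invLayers (forward n)

/-! ### The description of the circuit in logarithmic space -/

theorem outs_le {w m : ℕ} (hw : 0 < w) : outs w m ≤ w * m := by
  refine Nat.mul_le_mul_right _ ?_
  have := Nat.div_le_self (w - 1) (blockLen w m)
  omega

/-- The number of copies on a level obeys a budget that halves from level to level; this underlies
the linear size. -/
theorem mul_rows_le (n k w : ℕ) : w * rows n k w * 2 ^ k ≤ 8 * n := by
  have h1 : w * rows n k w ≤ w * (8 * n / 2 ^ k / w) := Nat.mul_le_mul_left _ (min_le_right _ _)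
  have h2 : w * (8 * n / 2 ^ k / w) ≤ 8 * n / 2 ^ k := Nat.mul_div_le _ _
  exact (Nat.mul_le_mul_right _ (h1.trans h2)).trans (Nat.div_mul_le_self _ _)

/-- Besides placing the wires, this bounds the recursion that computes the widths in logarithmic
space. -/
theorem width_le (n k : ℕ) : width n k ≤ 8 * n := by
  rcases k with _ | k
  · simp only [width]; omega
  · simp only [width]
    rcases Nat.eq_zero_or_pos (width n k) with h | h
    · simp [h, outs, rows]
    · refine (outs_le h).trans (le_trans ?_ (mul_rows_le n k (width n k)))
      exact Nat.le_mul_of_pos_right _ (by positivity)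

theorem heightAux_le (n i : ℕ) : heightAux n i ≤ i := by
  induction i with
  | zero => simp [heightAux]
  | succ i ih => simp only [heightAux]; omega

namespace Comp

variable {d : ℕ} {f g h f' : (ℕ → ℕ) → ℕ}

theorem rows (hf : Comp d f) (hg : Comp d g) (hh : Comp d h) :
    Comp d fun e => rows (f e) (g e) (h e) :=
  hh.size.min ((((const 8).mul hf).divPow hg).div hh)

theorem blockLen (hf : Comp d f) (hg : Comp d g) : Comp d fun e => blockLen (f e) (g e) :=
  (minPow hg (((const 2).mul hf).add (const 2))).pred

theorem outs (hf : Comp d f) (hg : Comp d g) : Comp d fun e => outs (f e) (g e) :=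
  ((hf.pred.div (hf.blockLen hg)).succ).mul hg

theorem width (hf : Comp d f) (hg : Comp d g) : Comp d fun e => width (f e) (g e) := by
  refine comp₂ (φ := QuantumFanOut.width) ?_ hf hg
  have h0 : Comp 2 fun e => e 0 := var (by omega)
  have h1 : Comp 2 fun e => e 1 := var (by omega)
  have h0' : Comp 4 fun e => e 0 := var (by omega)
  have h2' : Comp 4 fun e => e 2 := var (by omega)
  have h3' : Comp 4 fun e => e 3 := var (by omega)
  exact recursion h0 h1 (h3'.outs (rows h0' h2' h3'))
    (v := fun e i => QuantumFanOut.width (e 0) i) (fun e => rfl) (fun e i => by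
      simp [QuantumFanOut.width])
    ((const 8).mul h0).bound fun e i hi => width_le _ _

theorem height (hf : Comp d f) : Comp d fun e => height (f e) := by
  refine comp₁ (φ := QuantumFanOut.height) ?_ hf
  have h0 : Comp 1 fun e => e 0 := var (by omega)
  have h0' : Comp 3 fun e => e 0 := var (by omega)
  have h2' : Comp 3 fun e => e 2 := var (by omega)
  have hc : Comp 1 fun e => 8 * e 0 + 8 := ((const 8).mul h0).add (const 8)
  exact recursion zero hc (h2'.add ((const 1).sub ((const 3).sub (h0'.width h2'))))
    (v := fun e i => heightAux (e 0) i) (fun e => rfl) (fun e i => by simp [heightAux])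
    hc.bound fun e i hi => (heightAux_le _ _).trans hi

theorem span (hf : Comp d f) : Comp d fun e => span (f e) :=
  ((const 8).mul hf).add (const 16)

theorem ix (hf : Comp d f) (t : ℕ) (hg : Comp d g) (hh : Comp d h) :
    Comp d fun e => ix (f e) t (g e) (h e) :=
  hf.succ.add (((((const t).mul hf.span).add hg).mul hf.span).add hh)

theorem den (hf : Comp d f) (hg : Comp d g) : Comp d fun e => den (f e) (g e) :=
  minPow (hg.add (const 2)) (((const 4).mul hf).add (const 4))

end Comp

namespace Word

variable {d : ℕ}

theorem flatMap_range {c : (ℕ → ℕ) → ℕ} {w : (ℕ → ℕ) → ℕ → List Letter} (hc : Comp d c)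
    (hw : Word (d + 1) fun e => w e (e d))
    (h : ∀ e v i, w (Function.update e d v) i = w e i) :
    Word d fun e => (List.range (c e)).flatMap (w e) := by
  have := Word.flatMap hc hw
  simpa [h] using this

end Word

end QuantumFanOut

/-! ### Printing layers, levels and the whole circuit -/

namespace QuantumFanOut

namespace Word

variable {d : ℕ}

theorem had {q : (ℕ → ℕ) → ℕ} (hq : Comp d q) : Word d fun e => (Sym.had (q e)).word :=
  ((letter _).append (num hq)).append (letter _)

theorem rot {r s q : (ℕ → ℕ) → ℕ} (hr : Comp d r) (hs : Comp d s) (hq : Comp d q) :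
    Word d fun e => (Sym.rot (r e) (s e) (q e)).word :=
  ((((letter _).append (num hr)).append (num hs)).append (num hq)).append (letter _)

theorem fan {c : (ℕ → ℕ) → ℕ} {l : (ℕ → ℕ) → List ℕ} (hc : Comp d c)
    (hl : Word d fun e => (l e).flatMap numeral) : Word d fun e => (Sym.fan (c e) (l e)).word :=
  (((letter _).append (num hc)).append hl).append (letter _)

theorem gates {c : (ℕ → ℕ) → ℕ} {g : (ℕ → ℕ) → ℕ → Sym} (hc : Comp d c)
    (hg : Word (d + 1) fun e => (g e (e d)).word)
    (h : ∀ e v i, g (Function.update e d v) i = g e i) :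
    Word d fun e => ((List.range (c e)).map (g e)).flatMap Sym.word := by
  simp only [List.flatMap_map]
  exact flatMap_range hc hg fun e v i => by rw [h]

theorem layer {L : (ℕ → ℕ) → List Sym} (hL : Word d fun e => (L e).flatMap Sym.word) :
    Word d fun e => layerWord (L e) :=
  hL.append (letter _)

theorem cons_layers {L : (ℕ → ℕ) → List Sym} {U : (ℕ → ℕ) → List (List Sym)}
    (hL : Word d fun e => layerWord (L e)) (hU : Word d fun e => (U e).flatMap layerWord) :
    Word d fun e => (L e :: U e).flatMap layerWord := by
  simp only [List.flatMap_cons]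
  exact hL.append hU

theorem append_layers {U V : (ℕ → ℕ) → List (List Sym)}
    (hU : Word d fun e => (U e).flatMap layerWord) (hV : Word d fun e => (V e).flatMap layerWord) :
    Word d fun e => (U e ++ V e).flatMap layerWord := by
  simp only [List.flatMap_append]
  exact hU.append hV

theorem hadLayer : Word 4 fun e => layerWord (hadLayer (e 0) (e 1) (e 2) (e 3)) :=
  layer (gates ((Comp.var (by omega)).outs (Comp.var (by omega)))
    (had ((Comp.var (by omega)).ix 2 (Comp.var (by omega)).succ (Comp.var (by omega))))
    fun _ _ _ => rfl)

theorem copyLayer : Word 4 fun e => layerWord (copyLayer (e 0) (e 1) (e 2) (e 3)) := by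
  refine layer (gates (Comp.var (by omega)) (fan ((Comp.var (by omega)).ix 2
    (Comp.var (by omega)) (Comp.var (by omega))) ?_) fun _ _ _ => rfl)
  simp only [List.flatMap_map]
  exact flatMap_range (Comp.var (by omega)) (num ((Comp.var (by omega)).ix 0
    (Comp.var (by omega)) (((Comp.var (by omega)).mul (Comp.var (by omega))).add
      (Comp.var (by omega))))) fun _ _ _ => rfl

theorem fanLayer : Word 4 fun e => layerWord (fanLayer (e 0) (e 1) (e 2) (e 3)) := by
  have v0 : ∀ {d}, 0 < d → Comp d fun e => e 0 := fun h => Comp.var h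
  have v1 : ∀ {d}, 1 < d → Comp d fun e => e 1 := fun h => Comp.var h
  have v2 : ∀ {d}, 2 < d → Comp d fun e => e 2 := fun h => Comp.var h
  have v3 : ∀ {d}, 3 < d → Comp d fun e => e 3 := fun h => Comp.var h
  have v4 : ∀ {d}, 4 < d → Comp d fun e => e 4 := fun h => Comp.var h
  have v5 : ∀ {d}, 5 < d → Comp d fun e => e 5 := fun h => Comp.var h
  refine layer (gates ((v2 (by omega)).outs (v3 (by omega))) (fan ((v0 (by omega)).ix 2
    (v1 (by omega)).succ (v4 (by omega))) ?_) fun _ _ _ => rfl)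
  simp only [targets, List.flatMap_assoc]
  have hb : ∀ {d}, 4 < d → Comp d fun e => QuantumFanOut.blockLen (e 2) (e 3) :=
    fun h => (v2 (by omega)).blockLen (v3 (by omega))
  have hq : ∀ {d}, 4 < d → Comp d fun e => e 4 / e 3 * QuantumFanOut.blockLen (e 2) (e 3) :=
    fun h => ((v4 (by omega)).div (v3 (by omega))).mul (hb h)
  have hu : Comp 6 fun e => (e 4 / e 3 * QuantumFanOut.blockLen (e 2) (e 3) + e 5) * e 3
      + e 4 % e 3 :=
    (((hq (by omega)).add (v5 (by omega))).mul (v3 (by omega))).add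
      ((v4 (by omega)).mod (v3 (by omega)))
  refine flatMap_range ((hb (by omega)).min ((v2 (by omega)).sub (hq (by omega)))) ?_
    fun _ _ _ => rfl
  simp only [List.flatMap_cons, List.flatMap_nil, List.append_nil]
  exact (num ((v0 (by omega)).ix 0 (v1 (by omega)) hu)).append
    (num ((v0 (by omega)).ix 1 (v1 (by omega)) hu))

/-- The flag selects the inverse layer, so that one argument covers both halves of the circuit. -/
theorem rotLayer (b : Bool) : Word 4 fun e =>
    layerWord (if b then (rotLayer (e 0) (e 1) (e 2) (e 3)).map Sym.inv
      else rotLayer (e 0) (e 1) (e 2) (e 3)) := by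
  have v0 : ∀ {d}, 0 < d → Comp d fun e => e 0 := fun h => Comp.var h
  have v1 : ∀ {d}, 1 < d → Comp d fun e => e 1 := fun h => Comp.var h
  have hs : Comp 4 fun e => e 2 * e 3 := (Comp.var (by omega)).mul (Comp.var (by omega))
  have hd : Comp 5 fun e => QuantumFanOut.den (e 2) (e 4 % e 3) :=
    (Comp.var (by omega)).den ((Comp.var (by omega)).mod (Comp.var (by omega)))
  have hi : ∀ t, Comp 5 fun e => QuantumFanOut.ix (e 0) t (e 1) (e 4) := fun t =>
    (v0 (by omega)).ix t (v1 (by omega)) (Comp.var (by omega))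
  cases b
  · simp only [QuantumFanOut.rotLayer, Bool.false_eq_true, if_false]
    refine layer ?_
    simp only [List.flatMap_append]
    exact (gates (g := fun e u => .rot 1 (QuantumFanOut.den (e 2) (u % e 3))
      (QuantumFanOut.ix (e 0) 0 (e 1) u)) hs (rot (Comp.const 1) hd (hi 0)) fun _ _ _ => rfl).append
      (gates (g := fun e u => .rot (QuantumFanOut.den (e 2) (u % e 3) - 1) (QuantumFanOut.den (e 2) (u % e 3))
      (QuantumFanOut.ix (e 0) 1 (e 1) u)) hs (rot hd.pred hd (hi 1)) fun _ _ _ => rfl)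
  · simp only [QuantumFanOut.rotLayer, if_true, List.map_append, List.map_map]
    refine layer ?_
    simp only [List.flatMap_append]
    exact (gates (g := fun e u => .rot (QuantumFanOut.den (e 2) (u % e 3) - 1) (QuantumFanOut.den (e 2) (u % e 3))
      (QuantumFanOut.ix (e 0) 0 (e 1) u)) hs (rot (hd.sub (Comp.const 1)) hd (hi 0)) fun _ _ _ => rfl).append
      (gates (g := fun e u => .rot (QuantumFanOut.den (e 2) (u % e 3) - (QuantumFanOut.den (e 2) (u % e 3) - 1)) (QuantumFanOut.den (e 2) (u % e 3))
      (QuantumFanOut.ix (e 0) 1 (e 1) u))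
      hs (rot (hd.sub hd.pred) hd (hi 1)) fun _ _ _ => rfl)

/-- A level is a palindrome of layers which, apart from the rotations, consist of involutions. -/
theorem invLayers_level (n k w m : ℕ) : invLayers (QuantumFanOut.level n k w m) =
    [QuantumFanOut.hadLayer n k w m, QuantumFanOut.copyLayer n k w m,
      QuantumFanOut.fanLayer n k w m, (QuantumFanOut.rotLayer n k w m).map Sym.inv,
      QuantumFanOut.fanLayer n k w m, QuantumFanOut.copyLayer n k w m,
      QuantumFanOut.hadLayer n k w m] := by
  have h1 : (QuantumFanOut.hadLayer n k w m).map Sym.inv = QuantumFanOut.hadLayer n k w m := by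
    simp [QuantumFanOut.hadLayer, Sym.inv]
  have h2 : (QuantumFanOut.copyLayer n k w m).map Sym.inv = QuantumFanOut.copyLayer n k w m := by
    simp [QuantumFanOut.copyLayer, Sym.inv]
  have h3 : (QuantumFanOut.fanLayer n k w m).map Sym.inv = QuantumFanOut.fanLayer n k w m := by
    simp [QuantumFanOut.fanLayer, Sym.inv]
  simp [invLayers, QuantumFanOut.level, h1, h2, h3]

theorem level (b : Bool) : Word 4 fun e =>
    (if b then invLayers (level (e 0) (e 1) (e 2) (e 3))
      else level (e 0) (e 1) (e 2) (e 3)).flatMap layerWord := by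
  have h := hadLayer.cons_layers (copyLayer.cons_layers (fanLayer.cons_layers
    ((rotLayer b).cons_layers (fanLayer.cons_layers (copyLayer.cons_layers
      (hadLayer.cons_layers (U := fun _ => []) nil))))))
  refine cast (congrArg _ (funext fun e => ?_)) h
  cases b
  · rfl
  · simp [invLayers_level]

theorem level_comp (b : Bool) {f g h i : (ℕ → ℕ) → ℕ} (hf : Comp d f) (hg : Comp d g)
    (hh : Comp d h) (hi : Comp d i) : Word d fun e =>
    (if b then invLayers (QuantumFanOut.level (f e) (g e) (h e) (i e))
      else QuantumFanOut.level (f e) (g e) (h e) (i e)).flatMap layerWord :=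
  (level b).comp (fun j => if j = 0 then f else if j = 1 then g else if j = 2 then h else i)
    fun j _ => by
      split_ifs
      exacts [hf, hg, hh, hi]

theorem cnot {f g : (ℕ → ℕ) → ℕ} (hf : Comp d f) (hg : Comp d g) :
    Word d fun e => layerWord [Sym.fan (f e) [g e]] := by
  refine layer ?_
  simp only [List.flatMap_cons, List.flatMap_nil, List.append_nil]
  refine fan hf ?_
  simp only [List.flatMap_cons, List.flatMap_nil, List.append_nil]
  exact num hg

theorem inputLayer : Word 1 fun e => layerWord (inputLayer (e 0)) := by
  refine layer (gates (Comp.var (by omega)) (fan (Comp.var (by omega)) ?_) fun _ _ _ => rfl)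
  simp only [List.flatMap_cons, List.flatMap_nil, List.append_nil]
  exact num ((Comp.var (by omega)).ix 2 (Comp.const 0) (Comp.var (by omega)))

theorem forward : Word 1 fun e => (forward (e 0)).flatMap layerWord := by
  have v0 : Comp 1 fun e => e 0 := Comp.var (by omega)
  have w0 : Comp 2 fun e => e 0 := Comp.var (by omega)
  have w1 : Comp 2 fun e => e 1 := Comp.var (by omega)
  refine append_layers (append_layers (append_layers (inputLayer.cons_layers (U := fun _ => []) nil)
    ?_) ?_) ?_
  · simp only [List.flatMap_assoc]
    exact flatMap_range v0.height (level_comp false w0 w1 (w0.width w1)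
      (w0.rows w1 (w0.width w1))) fun _ _ _ => rfl
  · exact (cnot (v0.ix 2 v0.height (Comp.const 0))
      (v0.ix 2 v0.height (Comp.const 2))).cons_layers ((cnot (v0.ix 2 v0.height (Comp.const 1))
      (v0.ix 2 v0.height (Comp.const 2))).cons_layers (U := fun _ => []) nil)
  · exact level_comp false v0 v0.height (Comp.const 3) (Comp.const 2)

/-- The inverse circuit is written as an increasing loop over `j` that visits the levels `height n -
1 - j`, because the loops available for printing only count upwards. -/
theorem invLayers_forward (n : ℕ) : invLayers (QuantumFanOut.forward n) =
    invLayers (QuantumFanOut.level n (height n) 3 2) ++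
      ([[.fan (ix n 2 (height n) 1) [ix n 2 (height n) 2]],
        [.fan (ix n 2 (height n) 0) [ix n 2 (height n) 2]]] ++
      ((List.range (height n)).flatMap (fun j => invLayers (QuantumFanOut.level n
        (height n - 1 - j) (width n (height n - 1 - j))
          (rows n (height n - 1 - j) (width n (height n - 1 - j))))) ++
      [QuantumFanOut.inputLayer n])) := by
  have h1 : (QuantumFanOut.inputLayer n).map Sym.inv = QuantumFanOut.inputLayer n := by
    simp [QuantumFanOut.inputLayer, Sym.inv]
  have h2 : (List.range (height n)).reverse =
      (List.range (height n)).map fun j => height n - 1 - j := by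
    apply List.ext_getElem <;> simp
  have h3 : ∀ (l : List ℕ) (f : ℕ → List (List Sym)), invLayers (l.flatMap f) =
      l.reverse.flatMap fun k => invLayers (f k) := by
    intro l f
    simp only [invLayers, List.reverse_flatMap, List.map_flatMap]
    rfl
  have h4 : ∀ U V, invLayers (U ++ V) = invLayers V ++ invLayers U := by
    simp [invLayers]
  have h5 : ∀ c c' l l', invLayers [[Sym.fan c l], [Sym.fan c' l']] =
      [[Sym.fan c' l'], [Sym.fan c l]] := fun _ _ _ _ => rfl
  have h6 : invLayers [QuantumFanOut.inputLayer n] = [QuantumFanOut.inputLayer n] := by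
    simp [invLayers, h1]
  rw [QuantumFanOut.forward, h4, h4, h4, h3, h2, List.flatMap_map, h5, h6]

theorem invLayers_forward_word : Word 1 fun e =>
    (invLayers (QuantumFanOut.forward (e 0))).flatMap layerWord := by
  have v0 : Comp 1 fun e => e 0 := Comp.var (by omega)
  have w0 : Comp 2 fun e => e 0 := Comp.var (by omega)
  have w1 : Comp 2 fun e => e 1 := Comp.var (by omega)
  have hk : Comp 2 fun e => QuantumFanOut.height (e 0) - 1 - e 1 :=
    (w0.height.sub (Comp.const 1)).sub w1
  simp only [invLayers_forward]
  refine append_layers ?_ (append_layers ?_ (append_layers ?_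
    (inputLayer.cons_layers (U := fun _ => []) nil)))
  · exact level_comp true v0 v0.height (Comp.const 3) (Comp.const 2)
  · exact (cnot (v0.ix 2 v0.height (Comp.const 1))
      (v0.ix 2 v0.height (Comp.const 2))).cons_layers ((cnot (v0.ix 2 v0.height (Comp.const 0))
      (v0.ix 2 v0.height (Comp.const 2))).cons_layers (U := fun _ => []) nil)
  · simp only [List.flatMap_assoc]
    exact flatMap_range v0.height (level_comp true w0 hk (w0.width hk)
      (w0.rows hk (w0.width hk))) fun _ _ _ => rfl

/-- The description of the circuit can be printed in logarithmic space. -/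
theorem circuit : Word 1 fun e => numeral (e 0 + 1 + 3 * span (e 0) * span (e 0)) ++
    (orLayers (e 0)).flatMap layerWord := by
  have v0 : Comp 1 fun e => e 0 := Comp.var (by omega)
  have h1 := num (v0.succ.add (((Comp.const 3).mul v0.span).mul v0.span))
  have h2 := (cnot (v0.ix 2 v0.height.succ (Comp.const 1)) v0).cons_layers (U := fun _ => []) nil
  simp only [orLayers]
  have h3 := forward.append_layers h2
  have h4 := h3.append_layers invLayers_forward_word
  exact h1.append h4

end Word

end QuantumFanOut

/-! ### Growth of the quotas, decay of the widths, and the height -/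

namespace QuantumFanOut

/-! ### The number of levels -/

/-- The ratio of the number of ancilla qubits available on a level to its width. -/
def quota (n k : ℕ) : ℕ := 8 * n / 2 ^ k / width n k

theorem rows_eq (n k : ℕ) : rows n k (width n k) = min (width n k).size (quota n k) := rfl

theorem quota_succ (n k : ℕ) : quota n (k + 1) = 8 * n / 2 ^ k / 2 / width n (k + 1) := by
  rw [quota, pow_succ, Nat.div_div_eq_div_mul, Nat.div_div_eq_div_mul, Nat.div_div_eq_div_mul,
    mul_assoc]

theorem width_mul_quota_le (n k : ℕ) : width n k * quota n k ≤ 8 * n / 2 ^ k := Nat.mul_div_le _ _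

theorem outs_pos {w m : ℕ} (hm : 0 < m) : 0 < outs w m := by
  unfold outs
  positivity

/-- As long as the quota is smaller than the length of the width, it grows exponentially. -/
theorem le_quota_succ {n k : ℕ} (h8 : 8 ≤ quota n k) (h : quota n k < (width n k).size) :
    2 ^ (quota n k - 2) - 1 ≤ quota n (k + 1) := by
  have hT := width_mul_quota_le n k
  have hw' : width n (k + 1) = outs (width n k) (quota n k) := by
    rw [width, rows_eq, min_eq_right h.le]
  rw [quota_succ, hw']
  set T := 8 * n / 2 ^ k
  set Q := quota n k
  set w := width n k
  obtain ⟨s, hs⟩ : ∃ s, Q = s + 2 := ⟨Q - 2, by omega⟩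
  have hQw : 2 ^ Q ≤ w := Nat.lt_size.1 h
  have hpow : 2 ^ Q = 4 * 2 ^ s := by rw [hs, pow_add]; ring
  have hone := Nat.one_le_two_pow (n := s)
  -- The cap is inactive, since `2 ^ Q ≤ w`.
  have hb : blockLen w Q = 2 ^ Q - 1 := by unfold blockLen; omega
  have hp : 0 < outs w Q := outs_pos (by omega)
  have h1 : (w - 1) / blockLen w Q * blockLen w Q ≤ w - 1 := Nat.div_mul_le_self _ _
  have h2 : ((w - 1) / blockLen w Q + 1) * blockLen w Q ≤ 2 * w := by
    rw [add_mul, one_mul]; omega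
  have h3 : outs w Q * blockLen w Q ≤ 2 * (w * Q) := by
    calc outs w Q * blockLen w Q = ((w - 1) / blockLen w Q + 1) * blockLen w Q * Q := by
          rw [outs]; ring
      _ ≤ 2 * w * Q := Nat.mul_le_mul_right _ h2
      _ = 2 * (w * Q) := by ring
  have h4 : Q - 2 = s := by omega
  rw [h4, Nat.le_div_iff_mul_le hp, Nat.le_div_iff_mul_le (by norm_num)]
  -- A factor of two is lost by rounding up the number of blocks and another by the halved budget.
  -- Together they account for the `- 2` in the exponent.
  have h5 : 4 * (2 ^ s - 1) ≤ blockLen w Q := by omega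
  have h6 : outs w Q * (4 * (2 ^ s - 1)) ≤ 2 * T :=
    (Nat.mul_le_mul_left _ h5).trans (h3.trans (by omega))
  have h7 : outs w Q * (4 * (2 ^ s - 1)) = 2 * ((2 ^ s - 1) * outs w Q * 2) := by ring
  omega

/-- If the quota is at least the length of the width, then all wires form one block. -/
theorem width_succ_eq_size {n k : ℕ} (hw : 0 < width n k) (h : (width n k).size ≤ quota n k) :
    width n (k + 1) = (width n k).size := by
  rw [width, rows_eq, min_eq_left h, outs, Nat.div_eq_of_lt, zero_add, one_mul]
  have h1 : width n k < 2 ^ (width n k).size := Nat.lt_size_self _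
  unfold blockLen
  omega

/-- The quota of a level suffices to finish with logarithmic steps. -/
def Sufficient (n k : ℕ) : Prop := width n k ≤ 2 ∨ (width n k).size ≤ quota n k

/-- The budget `T` is at least `w * w.size` and the next width is `w.size`, so the next quota is at
least `w / 2`. For `w ≥ 4` this is no less than `w.size.size`. -/
theorem Sufficient.succ {n k : ℕ} (h : Sufficient n k) (hw : 2 < width n k) :
    Sufficient n (k + 1) := by
  have h1 : (width n k).size ≤ quota n k := h.resolve_left (by omega)
  have hT := width_mul_quota_le n k
  rw [Sufficient, quota_succ, width_succ_eq_size (by omega) h1]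
  set T := 8 * n / 2 ^ k
  set w := width n k
  have hs : 0 < w.size := Nat.size_pos.2 (by omega)
  -- Width three is followed directly by width two.
  rcases Nat.lt_or_ge w 4 with h3 | h3
  · left
    exact Nat.size_le.2 (by omega)
  right
  have h2 : w / 2 ≤ T / 2 / w.size := by
    rw [Nat.le_div_iff_mul_le hs, Nat.le_div_iff_mul_le (by norm_num)]
    calc w / 2 * w.size * 2 = w / 2 * 2 * w.size := by ring
      _ ≤ w * w.size := Nat.mul_le_mul_right _ (Nat.div_mul_le_self _ _)
      _ ≤ w * quota n k := Nat.mul_le_mul_left _ h1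
      _ ≤ T := hT
  refine le_trans ?_ h2
  rcases Nat.lt_or_ge w 8 with h8 | h8
  · have : w.size ≤ 3 := Nat.size_le.2 (by omega)
    have : w.size.size ≤ 2 := Nat.size_le.2 (by omega)
    omega
  · have h4 : 3 < w.size := Nat.lt_size.2 (by omega)
    obtain ⟨s, hs⟩ : ∃ s, w.size = s + 2 := ⟨w.size - 2, by omega⟩
    have h5 : 2 ^ (s + 1) ≤ w := Nat.lt_size.1 (by omega)
    have h6 : s + 2 ≤ 2 ^ s := by
      obtain ⟨r, rfl⟩ : ∃ r, s = r + 2 := ⟨s - 2, by omega⟩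
      have := Nat.lt_two_pow_self (n := r)
      rw [pow_add]
      omega
    have h7 : w.size.size ≤ w.size := Nat.size_le.2 Nat.lt_two_pow_self
    rw [pow_succ] at h5
    omega

/-- The increment `1 - (3 - w)` is the indicator of `2 < w`. The search thus advances on every step
until it meets a narrow level and stays there. -/
theorem heightAux_spec (n i : ℕ) : (∀ j < heightAux n i, 2 < width n j) ∧
    (heightAux n i = i ∨ width n (heightAux n i) ≤ 2) := by
  induction i with
  | zero => simp [heightAux]
  | succ i ih =>
    simp only [heightAux]
    rcases Nat.lt_or_ge 2 (width n (heightAux n i)) with h | h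
    · have h1 : 1 - (3 - width n (heightAux n i)) = 1 := by omega
      rw [h1]
      refine ⟨fun j hj => ?_, .inl (by omega)⟩
      rcases Nat.lt_succ_iff_lt_or_eq.1 hj with hj | rfl
      · exact ih.1 j hj
      · exact h
    · have h1 : 1 - (3 - width n (heightAux n i)) = 0 := by omega
      rw [h1, add_zero]
      exact ⟨ih.1, .inr h⟩

theorem lt_width {n k : ℕ} (hk : k < height n) : 2 < width n k := (heightAux_spec n _).1 k hk

/-- The quota of level `0` is `8`, and while it is insufficient it does not fall below `8`, because
`2 ^ 6 - 1 ≥ 8`. -/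
theorem sufficient_or_eight_le {n k : ℕ} (hn : 1 ≤ n) (hk : ∀ j < k, 2 < width n j) :
    Sufficient n k ∨ 8 ≤ quota n k := by
  induction k with
  | zero =>
    right
    simp only [quota, width, pow_zero, Nat.div_one]
    rw [Nat.mul_div_cancel _ hn]
  | succ k ih =>
    rcases ih fun j hj => hk j (by omega) with h | h
    · exact .inl (h.succ (hk k (by omega)))
    · rcases Nat.lt_or_ge (quota n k) (width n k).size with h1 | h1
      · right
        have h2 := le_quota_succ h h1
        have h3 : 2 ^ 6 ≤ 2 ^ (quota n k - 2) := Nat.pow_le_pow_right (by norm_num) (by omega)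
        omega
      · exact .inl (Sufficient.succ (.inr h1) (hk k (by omega)))

theorem two_le_quota {n k : ℕ} (hn : 1 ≤ n) (hk : ∀ j < k, 2 < width n j) (hw : 2 < width n k) :
    2 ≤ quota n k := by
  have : 1 < (width n k).size := Nat.lt_size.2 (by omega)
  rcases sufficient_or_eight_le hn hk with (h | h) | h <;> omega

theorem rows_pos {n k : ℕ} (hk : k < height n) : 0 < rows n k (width n k) := by
  have h1 : ∀ j ≤ k, 2 < width n j := fun j hj => lt_width (by omega)
  have hn : 1 ≤ n := by
    have := h1 0 (by omega)
    rw [width] at this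
    omega
  have h2 := two_le_quota hn (fun j hj => h1 j hj.le) (h1 k le_rfl)
  have h3 : 0 < (width n k).size := Nat.size_pos.2 (by have := h1 k le_rfl; omega)
  rw [rows_eq]
  omega

/-- Otherwise all `8 * n + 8` steps of the search advance. After that many halvings the budget is
zero, whereas the quota of a level wider than two is at least two. -/
theorem width_height_le {n : ℕ} (hn : 1 ≤ n) : width n (height n) ≤ 2 := by
  by_contra hw
  push Not at hw
  have h1 : height n = 8 * n + 8 := (heightAux_spec n (8 * n + 8)).2.resolve_right (by
    rw [← height]; omega)
  have h2 := two_le_quota hn (fun j hj => lt_width hj) hw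
  have h3 : 8 * n < 2 ^ height n := by
    rw [h1]
    exact (Nat.lt_two_pow_self).trans_le (Nat.pow_le_pow_right (by norm_num) (by omega))
  rw [quota, Nat.div_eq_of_lt h3, Nat.zero_div] at h2
  omega

/-- The iterated exponential. -/
def tower : ℕ → ℕ
  | 0 => 1
  | k + 1 => 2 ^ tower k

theorem tower_pos (k : ℕ) : 0 < tower k := by
  cases k <;> simp [tower]

theorem tower_le_iterLog {k : ℕ} {x : ℝ} (h : (tower k : ℝ) ≤ x) (j : ℕ) (hj : j ≤ k) :
    (tower (k - j) : ℝ) ≤ iterLog j x := by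
  induction j with
  | zero => simpa [iterLog] using h
  | succ j ih =>
    have h1 := ih (by omega)
    obtain ⟨i, hi⟩ : ∃ i, k - j = i + 1 := ⟨k - j - 1, by omega⟩
    have h2 : k - (j + 1) = i := by omega
    have h3 : iterLog (j + 1) x = Real.logb 2 (iterLog j x) := by
      simp only [iterLog, Function.iterate_succ_apply']
    have h4 : (0 : ℝ) < tower (k - j) := by exact_mod_cast tower_pos _
    rw [h2, h3, Real.le_logb_iff_rpow_le (by norm_num) (h4.trans_le h1), Real.rpow_natCast]
    rw [hi, tower] at h1
    exact_mod_cast h1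

/-- The tower begins with `1`, which is still positive, so one more logarithm can be taken; hence `k
+ 1`. -/
theorem succ_le_logStar {k n : ℕ} (h : tower k ≤ n) : k + 1 ≤ logStar n := by
  refine (logStar_isGreatest _).2 fun j hj => ?_
  have h1 := tower_le_iterLog (k := k) (x := n) (by exact_mod_cast h) j (by omega)
  exact lt_of_lt_of_le (by exact_mod_cast tower_pos _) h1

theorem size_width_le (n k : ℕ) : (width n k).size ≤ n.size + 3 := by
  refine Nat.size_le.2 ((width_le n k).trans_lt ?_)
  have := Nat.lt_size_self n
  rw [pow_add]
  omega

/-- Let `p` be the first sufficient level. Below `p` the quotas dominate a tower of exponentials yet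
stay under the binary length of the width, so `p ≤ log* n`. From `p` on each width is the binary
length of the preceding one; read backwards, the widths also dominate a tower. -/
theorem height_le {n : ℕ} (hn : 1 ≤ n) : height n ≤ 2 * logStar n + 3 := by
  classical
  have hex : ∃ k, Sufficient n k := ⟨height n, .inl (width_height_le hn)⟩
  set p := Nat.find hex with hp
  have hpH : p ≤ height n := Nat.find_min' hex (.inl (width_height_le hn))
  -- The surplus `5` survives the losses: `2 ^ (t + 3) - 1 ≥ 2 ^ t + 5`. It also covers the `3`
  -- extra binary digits in `size_width_le`.
  have hup : ∀ k < p, tower k + 5 ≤ quota n k ∧ quota n k < (width n k).size := by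
    have hns : ∀ k < p, quota n k < (width n k).size := fun k hk => by
      by_contra h
      exact Nat.find_min hex hk (.inr (not_lt.1 h))
    intro k hk
    refine ⟨?_, hns k hk⟩
    induction k with
    | zero =>
      have := (sufficient_or_eight_le hn (k := 0) (by simp)).resolve_left (Nat.find_min hex hk)
      simp only [tower]
      omega
    | succ k ih =>
      have h1 := ih (by omega)
      have h8 := (sufficient_or_eight_le hn (k := k) fun j hj => lt_width (by omega)).resolve_left
        (Nat.find_min hex (show k < p by omega))
      have h2 := le_quota_succ h8 (hns k (by omega))
      have h3 : 2 ^ (tower k + 3) ≤ 2 ^ (quota n k - 2) :=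
        Nat.pow_le_pow_right (by norm_num) (by omega)
      rw [pow_add, show 2 ^ tower k = tower (k + 1) from rfl] at h3
      have := tower_pos (k + 1)
      omega
  have hpL : p ≤ logStar n := by
    rcases Nat.eq_zero_or_pos p with h | h
    · omega
    · obtain ⟨h1, h2⟩ := hup (p - 1) (by omega)
      have h3 := size_width_le n (p - 1)
      have h4 : tower (p - 1 + 1) ≤ n := Nat.lt_size.1 (by omega)
      have := succ_le_logStar h4
      omega
  have hdown : ∀ i, p + i ≤ height n → Sufficient n (p + i) := by
    intro i
    induction i with
    | zero => exact fun _ => Nat.find_spec hex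
    | succ i ih => exact fun h => (ih (by omega)).succ (lt_width (by omega))
  have hstep : ∀ c, p ≤ c → c < height n → width n (c + 1) = (width n c).size := by
    intro c hc hcH
    obtain ⟨i, rfl⟩ := Nat.exists_eq_add_of_le hc
    exact width_succ_eq_size (by have := lt_width hcH; omega)
      ((hdown i hcH.le).resolve_left (by have := lt_width hcH; omega))
  have hpow : ∀ c t, p ≤ c → c < height n → t < width n (c + 1) → 2 ^ t ≤ width n c := by
    intro c t hc hcH ht
    rw [hstep c hc hcH] at ht
    exact Nat.lt_size.1 ht
  -- The surplus `3` reproduces itself since `2 ^ (t + 3) > 2 ^ t + 3`, and cancels the `3` of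
  -- `size_width_le`. The induction starts from a width above two: the two widths before it are at
  -- least `4` and `8`.
  have hlow : ∀ i c, p ≤ c → c + 2 + i < height n → tower (i + 2) + 3 < width n c := by
    intro i
    induction i with
    | zero =>
      intro c hc hcH
      have h1 := hpow (c + 1) 2 (by omega) (by omega) (lt_width (by omega))
      have h2 := hpow c 3 hc (by omega) (by omega)
      simp only [tower]
      omega
    | succ i ih =>
      intro c hc hcH
      have h1 := hpow c _ hc (by omega) (ih (c + 1) (by omega) (by omega))
      rw [pow_add, show 2 ^ tower (i + 2) = tower (i + 2 + 1) from rfl] at h1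
      have := tower_pos (i + 2 + 1)
      have h2 : i + 1 + 2 = i + 2 + 1 := by omega
      rw [h2]
      omega
  rcases Nat.lt_or_ge (p + 3) (height n) with h | h
  · obtain ⟨i, hi⟩ : ∃ i, height n = p + 4 + i := ⟨height n - (p + 4), by omega⟩
    have h1 := hlow i (p + 1) (by omega) (by omega)
    rw [hstep p le_rfl (by omega)] at h1
    have h2 := size_width_le n p
    have h3 : tower (i + 2 + 1) ≤ n := Nat.lt_size.1 (by omega)
    have := succ_le_logStar h3
    omega
  · omega

theorem one_le_logStar {n : ℕ} (hn : 1 ≤ n) : 1 ≤ logStar n := succ_le_logStar (k := 0) hn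

end QuantumFanOut

/-! ### Operator calculus for lists of gates -/

namespace QuantumFanOut

/-! ### Sequences of gates -/

variable {N : ℕ}

/-- Apply the gates of a list in order. -/
noncomputable def runGates (l : List (Gate N)) (ψ : QState N) : QState N :=
  l.foldl (fun χ g => g.apply χ) ψ

@[simp] theorem runGates_nil (ψ : QState N) : runGates [] ψ = ψ := rfl

@[simp] theorem runGates_cons (g : Gate N) (l : List (Gate N)) (ψ : QState N) :
    runGates (g :: l) ψ = runGates l (g.apply ψ) := rfl

theorem runGates_append (l l' : List (Gate N)) (ψ : QState N) :
    runGates (l ++ l') ψ = runGates l' (runGates l ψ) := List.foldl_append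

theorem Gate.apply_add (g : Gate N) (ψ φ : QState N) : g.apply (ψ + φ) = g.apply ψ + g.apply φ := by
  cases g with
  | one U q => funext x; simp [Gate.apply, mul_add]; ring
  | fanOut c T h => rfl

theorem Gate.apply_smul (g : Gate N) (a : ℂ) (ψ : QState N) : g.apply (a • ψ) = a • g.apply ψ := by
  cases g with
  | one U q => funext x; simp [Gate.apply]; ring
  | fanOut c T h => rfl

/-- Running a list of gates is linear. -/
noncomputable def runLin (l : List (Gate N)) : QState N →ₗ[ℂ] QState N where
  toFun := runGates l
  map_add' ψ φ := by
    induction l generalizing ψ φ with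
    | nil => rfl
    | cons g l ih => simp only [runGates_cons, Gate.apply_add, ih]
  map_smul' a ψ := by
    induction l generalizing ψ with
    | nil => rfl
    | cons g l ih => simp only [runGates_cons, Gate.apply_smul, ih, RingHom.id_apply]

theorem runGates_smul (l : List (Gate N)) (a : ℂ) (ψ : QState N) :
    runGates l (a • ψ) = a • runGates l ψ := (runLin l).map_smul a ψ

/-- Supports can be computed on basis states. -/
theorem exists_of_runGates_ne_zero {l : List (Gate N)} {ψ : QState N} {u : Bits N}
    (h : runGates l ψ u ≠ 0) : ∃ z, ψ z ≠ 0 ∧ runGates l (ket z) u ≠ 0 := by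
  have h1 : ψ = ∑ z, ψ z • ket z := by
    funext x
    simp [ket, Finset.sum_apply, Pi.single_apply]
  have h2 : runGates l ψ u = ∑ z, ψ z * runGates l (ket z) u := by
    conv_lhs => rw [h1]
    change runLin l _ u = _
    rw [map_sum, Finset.sum_apply]
    refine Finset.sum_congr rfl fun z _ => ?_
    rw [map_smul]
    rfl
  rw [h2] at h
  obtain ⟨z, -, hz⟩ := Finset.exists_ne_zero_of_sum_ne_zero h
  exact ⟨z, left_ne_zero_of_mul hz, right_ne_zero_of_mul hz⟩

theorem one_apply_one (U V : OneQubit) (q : Fin N) (ψ : QState N) :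
    (Gate.one U q).apply ((Gate.one V q).apply ψ) = (Gate.one (U * V) q).apply ψ := by
  funext x
  simp [Gate.apply, Matrix.mul_apply]
  ring

theorem one_one_apply (q : Fin N) (ψ : QState N) : (Gate.one 1 q).apply ψ = ψ := by
  funext x
  cases h : x q <;> simp [Gate.apply, h] <;> rw [← h, Function.update_eq_self]

theorem apply_comm {g h : Gate N} (hd : Disjoint g.qubits h.qubits) (ψ : QState N) :
    g.apply (h.apply ψ) = h.apply (g.apply ψ) := by
  have key : ∀ (U : OneQubit) (p c : Fin N) (T : Finset (Fin N)) (hc : c ∉ T),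
      Disjoint (Gate.one U p).qubits (Gate.fanOut c T hc).qubits →
      (Gate.one U p).apply ((Gate.fanOut c T hc).apply ψ) =
        (Gate.fanOut c T hc).apply ((Gate.one U p).apply ψ) := by
    intro U p c T hc hd
    simp only [Gate.qubits, Finset.disjoint_singleton_left, Finset.mem_insert, not_or] at hd
    funext x
    simp only [Gate.apply]
    refine Finset.sum_congr rfl fun b _ => ?_
    have h1 : fanOutBits c T x p = x p := by simp [fanOutBits, hd.2]
    have h2 : fanOutBits c T (Function.update x p b) = Function.update (fanOutBits c T x) p b := by
      funext q
      rcases eq_or_ne q p with rfl | hq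
      · simp [fanOutBits, hd.2]
      · simp [fanOutBits, hq, Ne.symm hd.1]
    rw [h1, h2]
  cases g with
  | one U p =>
    cases h with
    | one V q =>
      simp only [Gate.qubits, Finset.disjoint_singleton, ne_eq] at hd
      funext x
      simp only [Gate.apply, Finset.mul_sum]
      rw [Finset.sum_comm]
      refine Finset.sum_congr rfl fun b _ => Finset.sum_congr rfl fun b' _ => ?_
      rw [Function.update_of_ne hd, Function.update_of_ne (Ne.symm hd), Function.update_comm hd]
      ring
    | fanOut c T hc => exact key U p c T hc hd
  | fanOut c T hc =>
    cases h with
    | one V q => exact (key V q c T hc hd.symm).symm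
    | fanOut c' T' hc' =>
      simp only [Gate.qubits, Finset.disjoint_insert_left, Finset.disjoint_insert_right,
        Finset.mem_insert, not_or] at hd
      funext x
      simp only [Gate.apply]
      congr 1
      funext q
      have h1 := hd.1.2
      have h2 := hd.2.1
      have h3 : q ∈ T → q ∉ T' := fun h => Finset.disjoint_left.1 hd.2.2 h
      by_cases hq : q ∈ T <;> by_cases hq' : q ∈ T' <;> simp_all [fanOutBits]

theorem runGates_apply_comm {g : Gate N} {l : List (Gate N)}
    (hd : ∀ h ∈ l, Disjoint g.qubits h.qubits) (ψ : QState N) :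
    runGates l (g.apply ψ) = g.apply (runGates l ψ) := by
  induction l generalizing ψ with
  | nil => rfl
  | cons h l ih =>
    rw [runGates_cons, runGates_cons, ← apply_comm (hd h (by simp)),
      ih fun k hk => hd k (by simp [hk])]

theorem runGates_reverse {l : List (Gate N)}
    (hd : l.Pairwise fun g h => Disjoint g.qubits h.qubits) (ψ : QState N) :
    runGates l.reverse ψ = runGates l ψ := by
  induction l generalizing ψ with
  | nil => rfl
  | cons g l ih =>
    rw [List.pairwise_cons] at hd
    rw [List.reverse_cons, runGates_append, ih hd.2, runGates_cons, runGates_nil,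
      runGates_cons, runGates_apply_comm hd.1]

/-- The inverse of a gate. -/
noncomputable def Gate.inv : Gate N → Gate N
  | .one U q => .one U⁻¹ q
  | .fanOut c T h => .fanOut c T h

theorem Gate.qubits_inv (g : Gate N) : g.inv.qubits = g.qubits := by
  cases g <;> rfl

theorem fanOutBits_fanOutBits {c : Fin N} {T : Finset (Fin N)} (h : c ∉ T) (x : Bits N) :
    fanOutBits c T (fanOutBits c T x) = x := by
  funext q
  by_cases hq : q ∈ T <;> simp [fanOutBits, hq, h]

theorem Gate.inv_apply_apply (g : Gate N) (ψ : QState N) : g.inv.apply (g.apply ψ) = ψ := by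
  cases g with
  | one U q => rw [Gate.inv, one_apply_one, inv_mul_cancel, one_one_apply]
  | fanOut c T h => funext x; simp [Gate.inv, Gate.apply, fanOutBits_fanOutBits h]

theorem runGates_inv_reverse (l : List (Gate N)) (ψ : QState N) :
    runGates (l.map Gate.inv).reverse (runGates l ψ) = ψ := by
  induction l generalizing ψ with
  | nil => rfl
  | cons g l ih =>
    rw [List.map_cons, List.reverse_cons, runGates_append, runGates_cons, runGates_nil,
      runGates_cons, ih]
    exact g.inv_apply_apply ψ

/-- The inverse circuit reverses the order of the layers but keeps the order inside each layer;
disjoint gates commute, so this is harmless. -/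
theorem runGates_inv {l : List (Gate N)}
    (hd : l.Pairwise fun g h => Disjoint g.qubits h.qubits) (ψ : QState N) :
    runGates (l.map Gate.inv) (runGates l ψ) = ψ := by
  rw [← runGates_reverse, runGates_inv_reverse]
  rw [List.pairwise_map]
  exact hd.imp fun h => by rwa [Gate.qubits_inv, Gate.qubits_inv]

theorem runGates_invLayers {U : List (List (Gate N))}
    (hd : ∀ L ∈ U, L.Pairwise fun g h => Disjoint g.qubits h.qubits) (ψ : QState N) :
    runGates (U.reverse.map (List.map Gate.inv)).flatten (runGates U.flatten ψ) = ψ := by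
  induction U generalizing ψ with
  | nil => rfl
  | cons L U ih =>
    simp only [List.reverse_cons, List.map_append, List.flatten_append, List.flatten_cons,
      runGates_append]
    rw [ih fun L' h => hd L' (by simp [h])]
    simpa using runGates_inv (hd L (by simp)) ψ

/-! ### Pauli and Hadamard gates -/

/-- The bit flip. -/
noncomputable def pauliX : OneQubit :=
  ⟨Matrix.of fun i j => if i = j then 0 else 1, by
    rw [Matrix.mem_unitaryGroup_iff]
    ext i j
    cases i <;> cases j <;> simp [Matrix.mul_apply, Matrix.star_apply]⟩

/-- The phase flip. -/
noncomputable def pauliZ : OneQubit :=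
  ⟨Matrix.of fun i j => if i = j then (if i then -1 else 1) else 0, by
    rw [Matrix.mem_unitaryGroup_iff]
    ext i j
    cases i <;> cases j <;> simp [Matrix.mul_apply, Matrix.star_apply]⟩

theorem pauliX_apply (q : Fin N) (ψ : QState N) (x : Bits N) :
    (Gate.one pauliX q).apply ψ x = ψ (Function.update x q (!x q)) := by
  cases h : x q <;> simp [Gate.apply, pauliX, h]

theorem pauliZ_apply (q : Fin N) (ψ : QState N) (x : Bits N) :
    (Gate.one pauliZ q).apply ψ x = (if x q then -1 else 1) * ψ x := by
  cases h : x q <;> simp [Gate.apply, pauliZ, h] <;> rw [← h, Function.update_eq_self]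

theorem rotZ_apply (α : ℝ) (q : Fin N) (ψ : QState N) (x : Bits N) :
    (Gate.one (rotZ α) q).apply ψ x =
      (if x q then Complex.exp (α * Complex.I) else 1) * ψ x := by
  cases h : x q <;> simp [Gate.apply, rotZ, h] <;> rw [← h, Function.update_eq_self]

theorem pauliZ_mul_hadamard : pauliZ * hadamard = hadamard * pauliX := by
  apply Subtype.ext
  ext i j
  cases i <;> cases j <;> simp [pauliZ, hadamard, pauliX, Matrix.mul_apply]

theorem hadamard_mul_pauliZ : hadamard * pauliZ = pauliX * hadamard := by
  apply Subtype.ext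
  ext i j
  cases i <;> cases j <;> simp [pauliZ, hadamard, pauliX, Matrix.mul_apply]

theorem hadamard_inv : hadamard⁻¹ = hadamard := by
  refine inv_eq_of_mul_eq_one_left (Subtype.ext ?_)
  have h : ((√2 : ℝ) : ℂ) ^ 2 = 2 := by
    rw [← Complex.ofReal_pow, Real.sq_sqrt (by norm_num)]; norm_num
  ext i j
  cases i <;> cases j <;> simp [hadamard, Matrix.mul_apply] <;> field_simp <;> simp [h]
  all_goals norm_num

theorem rotZ_mul (α β : ℝ) : rotZ α * rotZ β = rotZ (α + β) := by
  apply Subtype.ext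
  ext i j
  cases i <;> cases j <;> simp [rotZ, add_mul, Complex.exp_add]

theorem rotZ_two_pi : rotZ (2 * Real.pi) = 1 := by
  apply Subtype.ext
  ext i j
  cases i <;> cases j <;> simp [rotZ, Complex.exp_two_pi_mul_I]

theorem rotZ_inv {r s : ℕ} (hs : 0 < s) (hr : r ≤ s) :
    (rotZ (2 * Real.pi * (r / s)))⁻¹ = rotZ (2 * Real.pi * ((s - r : ℕ) / s)) := by
  refine inv_eq_of_mul_eq_one_left ?_
  rw [rotZ_mul, ← rotZ_two_pi]
  congr 1
  have : (s : ℝ) ≠ 0 := by positivity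
  push_cast [hr]
  field_simp
  ring

/-- Hadamard gates on the qubits of a list. -/
noncomputable def hadamards (l : List (Fin N)) : List (Gate N) := l.map (Gate.one hadamard)

theorem pauliZ_hadamards {l : List (Fin N)} (hl : l.Nodup) {c : Fin N} (hc : c ∈ l)
    (ψ : QState N) : (Gate.one pauliZ c).apply (runGates (hadamards l) ψ) =
      runGates (hadamards l) ((Gate.one pauliX c).apply ψ) := by
  induction l generalizing ψ with
  | nil => simp at hc
  | cons a l ih =>
    rw [List.nodup_cons] at hl
    simp only [hadamards, List.map_cons, runGates_cons] at ih ⊢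
    by_cases hca : c = a
    · subst hca
      rw [← runGates_apply_comm, one_apply_one, one_apply_one, pauliZ_mul_hadamard]
      intro g hg
      obtain ⟨q, hq, rfl⟩ := List.mem_map.1 hg
      simpa [Gate.qubits] using fun h : c = q => hl.1 (h ▸ hq)
    · rw [ih hl.2 (by simpa [hca] using hc), apply_comm]
      simpa [Gate.qubits] using hca

theorem hadamards_pauliZ {l : List (Fin N)} (hl : l.Nodup) {c : Fin N} (hc : c ∈ l)
    (ψ : QState N) : runGates (hadamards l) ((Gate.one pauliZ c).apply ψ) =
      (Gate.one pauliX c).apply (runGates (hadamards l) ψ) := by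
  induction l generalizing ψ with
  | nil => simp at hc
  | cons a l ih =>
    rw [List.nodup_cons] at hl
    simp only [hadamards, List.map_cons, runGates_cons] at ih ⊢
    by_cases hca : c = a
    · subst hca
      rw [one_apply_one, hadamard_mul_pauliZ, ← one_apply_one, runGates_apply_comm]
      intro g hg
      obtain ⟨q, hq, rfl⟩ := List.mem_map.1 hg
      simpa [Gate.qubits] using fun h : c = q => hl.1 (h ▸ hq)
    · rw [apply_comm, ih hl.2 (by simpa [hca] using hc)]
      simpa [Gate.qubits] using Ne.symm hca

theorem pauliZ_hadamards_of_notMem {l : List (Fin N)} {c : Fin N} (hc : c ∉ l)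
    (ψ : QState N) : runGates (hadamards l) ((Gate.one pauliZ c).apply ψ) =
      (Gate.one pauliZ c).apply (runGates (hadamards l) ψ) := by
  refine runGates_apply_comm (fun g hg => ?_) ψ
  obtain ⟨q, hq, rfl⟩ := List.mem_map.1 hg
  simpa [Gate.qubits] using fun h : c = q => hc (h ▸ hq)

theorem pauliZ_ket (z : Bits N) (p : Fin N) :
    (Gate.one pauliZ p).apply (ket z) = (if z p then -1 else 1 : ℂ) • ket z := by
  funext x
  rw [pauliZ_apply]
  by_cases h : x = z
  · subst h; simp
  · simp [ket, h]

/-- A state which is an eigenvector of a phase flip is supported on the corresponding values. -/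
theorem eq_of_pauliZ_eq {ψ : QState N} {p : Fin N} {b : Bool}
    (h : (Gate.one pauliZ p).apply ψ = (if b then -1 else 1 : ℂ) • ψ) {u : Bits N}
    (hu : ψ u ≠ 0) : u p = b := by
  have := congrFun h u
  rw [pauliZ_apply, Pi.smul_apply, smul_eq_mul] at this
  have := mul_right_cancel₀ hu this
  revert this
  cases u p <;> cases b <;> norm_num

/-- Conjugation of a diagonal operator by Hadamard gates: where the diagonal is even or odd under
a bit flip, the corresponding qubit is determined. -/
theorem hadamards_diagonal {l : List (Fin N)} (hl : l.Nodup) {D : List (Gate N)} {δ : Bits N → ℂ}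
    (hD : ∀ ψ x, runGates D ψ x = δ x * ψ x) {z : Bits N} (hz : ∀ c ∈ l, z c = false)
    {u : Bits N} (hu : runGates (hadamards l ++ D ++ hadamards l) (ket z) u ≠ 0) :
    (∀ p ∉ l, u p = z p) ∧ ∀ c ∈ l, ∀ b : Bool,
      (∀ x : Bits N, (∀ p ∉ l, x p = z p) →
        δ (Function.update x c (!x c)) = (if b then -1 else 1) * δ x) → u c = b := by
  rw [runGates_append, runGates_append] at hu
  have hDZ : ∀ p ψ, runGates D ((Gate.one pauliZ p).apply ψ) =
      (Gate.one pauliZ p).apply (runGates D ψ) := by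
    intro p ψ
    funext x
    rw [hD, pauliZ_apply, pauliZ_apply, hD]
    ring
  -- The parity of the diagonal is assumed only for strings that agree with `z` off `l`; this shows
  -- that no others occur after the first Hadamard gates.
  have h1 : ∀ p ∉ l, ∀ x, runGates (hadamards l) (ket z) x ≠ 0 → x p = z p := by
    intro p hp x hx
    refine eq_of_pauliZ_eq ?_ hx
    rw [← pauliZ_hadamards_of_notMem hp, pauliZ_ket, runGates_smul]
  refine ⟨fun p hp => eq_of_pauliZ_eq ?_ hu, fun c hc b hb => eq_of_pauliZ_eq ?_ hu⟩
  · rw [← pauliZ_hadamards_of_notMem hp, ← hDZ, ← pauliZ_hadamards_of_notMem hp, pauliZ_ket,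
      runGates_smul, runGates_smul, runGates_smul]
  -- Moved past the last Hadamard gates, the phase flip on `c` becomes a bit flip. The state before
  -- `D` is invariant under this flip because `z c = 0`, so the flip acts on the state after `D` by
  -- the sign of the diagonal.
  · rw [pauliZ_hadamards hl hc, ← runGates_smul]
    congr 1
    have hzc : (Gate.one pauliZ c).apply (ket z) = ket z := by
      rw [pauliZ_ket, hz c hc]; simp
    have hX : (Gate.one pauliX c).apply (runGates (hadamards l) (ket z)) =
        runGates (hadamards l) (ket z) := by
      rw [← hadamards_pauliZ hl hc, hzc]
    funext x
    rw [pauliX_apply, hD, Pi.smul_apply, hD, smul_eq_mul, ← mul_assoc]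
    have hx := congrFun hX x
    rw [pauliX_apply] at hx
    rw [hx]
    by_cases h0 : runGates (hadamards l) (ket z) x = 0
    · rw [h0, mul_zero, mul_zero]
    · rw [hb x fun p hp => h1 p hp x h0]

/-! ### Layers of fan-out gates -/

/-- The effect on bit strings of a list of fan-out gates, given by controls and targets. -/
def fanBits (l : List (Fin N × Finset (Fin N))) (x : Bits N) : Bits N :=
  l.foldr (fun g y => fanOutBits g.1 g.2 y) x

theorem fanBits_of_notMem {l : List (Fin N × Finset (Fin N))} {p : Fin N}
    (hp : ∀ g ∈ l, p ∉ g.2) (x : Bits N) : fanBits l x p = x p := by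
  induction l with
  | nil => rfl
  | cons g l ih =>
    have h1 := hp g (by simp)
    simp only [fanBits, List.foldr_cons] at ih ⊢
    rw [fanOutBits, if_neg h1, ih fun g hg => hp g (by simp [hg])]

/-- No gate of the list changes the control of another one, so each target sees the original value
of its control. -/
theorem fanBits_of_mem {l : List (Fin N × Finset (Fin N))}
    (hd : l.Pairwise fun g h => Disjoint (insert g.1 g.2) (insert h.1 h.2))
    {p : Fin N} {g : Fin N × Finset (Fin N)} (hg : g ∈ l) (hp : p ∈ g.2)
    (x : Bits N) : fanBits l x p = xor (x p) (x g.1) := by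
  induction l with
  | nil => simp at hg
  | cons k l ih =>
    rw [List.pairwise_cons] at hd
    simp only [fanBits, List.foldr_cons] at ih ⊢
    rcases List.mem_cons.1 hg with rfl | hgl
    · have h1 : ∀ q ∈ insert g.1 g.2, fanBits l x q = x q := fun q hq =>
        fanBits_of_notMem (fun h hh hq' => Finset.disjoint_left.1 (hd.1 h hh) hq
          (Finset.mem_insert_of_mem hq')) x
      rw [fanOutBits, if_pos hp]
      exact congrArg₂ xor (h1 p (Finset.mem_insert_of_mem hp)) (h1 _ (Finset.mem_insert_self _ _))
    · rw [fanOutBits, if_neg, ih hd.2 hgl]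
      exact fun hpk => Finset.disjoint_left.1 (hd.1 g hgl) (Finset.mem_insert_of_mem hpk)
        (Finset.mem_insert_of_mem hp)

end QuantumFanOut

namespace QuantumFanOut

/-! ### From symbolic gates to gates -/

/-- The qubit with a given index. -/
def qubit {N : ℕ} (hN : 0 < N) (q : ℕ) : Fin N := ⟨q % N, Nat.mod_lt _ hN⟩

theorem qubit_inj {N : ℕ} (hN : 0 < N) {q q' : ℕ} (hq : q < N) (hq' : q' < N) :
    qubit hN q = qubit hN q' ↔ q = q' := by
  simp [qubit, Nat.mod_eq_of_lt hq, Nat.mod_eq_of_lt hq']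

theorem qubit_val {N : ℕ} (hN : 0 < N) {q : ℕ} (hq : q < N) : (qubit hN q : ℕ) = q :=
  Nat.mod_eq_of_lt hq

namespace Sym

/-- The qubits on which a gate acts. -/
def qubits : Sym → List ℕ
  | .had q => [q]
  | .rot _ _ q => [q]
  | .fan c l => c :: l

/-- The gate acts on distinct qubits of an `N`-qubit system and its angle is well-formed. -/
def Valid (N : ℕ) (g : Sym) : Prop :=
  (∀ q ∈ g.qubits, q < N) ∧ g.qubits.Nodup ∧ match g with
    | .rot r s _ => 0 < s ∧ r ≤ s
    | _ => True

/-- The gate denoted by a symbolic gate. -/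
noncomputable def gate {N : ℕ} (hN : 0 < N) : Sym → Gate N
  | .had q => .one hadamard (qubit hN q)
  | .rot r s q => .one (rotZ (2 * Real.pi * (r / s))) (qubit hN q)
  | .fan c l => .fanOut (qubit hN c) ((l.map (qubit hN)).toFinset.erase (qubit hN c))
      (Finset.notMem_erase _ _)

variable {N : ℕ} (hN : 0 < N)

theorem gate_qubits (g : Sym) : (g.gate hN).qubits = (g.qubits.map (qubit hN)).toFinset := by
  cases g with
  | had q => simp [gate, qubits, Gate.qubits]
  | rot r s q => simp [gate, qubits, Gate.qubits]
  | fan c l =>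
    ext p
    by_cases hp : p = qubit hN c <;> simp [gate, qubits, Gate.qubits, hp]

theorem gate_size_le (g : Sym) : (g.gate hN).size ≤ g.qubits.length := by
  rw [Gate.size, gate_qubits]
  exact (List.toFinset_card_le _).trans (by simp)

/-- The erasure in `Sym.gate` serves only to denote a gate in all cases; for a valid gate it removes
nothing. -/
theorem targets_eq {c : ℕ} {l : List ℕ} (h : (Sym.fan c l).Valid N) :
    (l.map (qubit hN)).toFinset.erase (qubit hN c) = (l.map (qubit hN)).toFinset := by
  refine Finset.erase_eq_of_notMem fun hc => ?_
  simp only [List.mem_toFinset, List.mem_map] at hc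
  obtain ⟨a, ha, hac⟩ := hc
  rw [qubit_inj hN (h.1 a (by simp [qubits, ha])) (h.1 c (by simp [qubits]))] at hac
  subst hac
  exact (List.nodup_cons.1 h.2.1).1 ha

theorem gateCode {g : Sym} (h : g.Valid N) : GateCode (g.gate hN) g.word := by
  cases g with
  | had q =>
    have := GateCode.had (qubit hN q)
    rwa [qubit_val hN (h.1 q (by simp [qubits]))] at this
  | rot r s q =>
    have := GateCode.rot r s h.2.2.1 (qubit hN q)
    rwa [qubit_val hN (h.1 q (by simp [qubits]))] at this
  | fan c l =>
    have hnd := List.nodup_cons.1 h.2.1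
    have hl : ∀ q ∈ l, q < N := fun q hq => h.1 q (by simp [qubits, hq])
    have h1 : qubit hN c ∉ (l.map (qubit hN)).toFinset := by
      rw [← targets_eq hN h]
      exact Finset.notMem_erase _ _
    have h2 : (l.map (qubit hN)).Nodup := by
      refine List.Nodup.map_on (fun a ha b hb hab => ?_) hnd.2
      exact (qubit_inj hN (hl a ha) (hl b hb)).1 hab
    have := GateCode.fan (qubit hN c) (l.map (qubit hN)) h2 h1
    rw [qubit_val hN (h.1 c (by simp [qubits]))] at this
    have h3 : (l.map (qubit hN)).map Fin.val = l := by
      rw [List.map_map]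
      exact (List.map_congr_left fun q hq => qubit_val hN (hl q hq)).trans (List.map_id l)
    simp only [bind_pure_comp, List.map_eq_map, h3] at this
    have h4 : (Sym.fan c l).gate hN = .fanOut (qubit hN c) (l.map (qubit hN)).toFinset h1 := by
      simp only [gate, targets_eq hN h]
    rw [h4]
    exact this

theorem inv_qubits (g : Sym) : g.inv.qubits = g.qubits := by
  cases g <;> rfl

theorem Valid.inv {g : Sym} (h : g.Valid N) : g.inv.Valid N := by
  refine ⟨by rw [inv_qubits]; exact h.1, by rw [inv_qubits]; exact h.2.1, ?_⟩
  cases g with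
  | had q => trivial
  | rot r s q => exact ⟨h.2.2.1, Nat.sub_le _ _⟩
  | fan c l => trivial

theorem gate_inv {g : Sym} (h : g.Valid N) : g.inv.gate hN = (g.gate hN).inv := by
  cases g with
  | had q => simp [Sym.inv, gate, Gate.inv, hadamard_inv]
  | rot r s q => simp [Sym.inv, gate, Gate.inv, rotZ_inv h.2.2.1 h.2.2.2]
  | fan c l => rfl

end Sym

/-- The gates of a layer are valid and act on disjoint sets of qubits. -/
def LayerValid (N : ℕ) (L : List Sym) : Prop :=
  (∀ g ∈ L, g.Valid N) ∧ L.Pairwise fun g h => List.Disjoint g.qubits h.qubits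

theorem LayerValid.inv {N : ℕ} {L : List Sym} (h : LayerValid N L) :
    LayerValid N (L.map Sym.inv) := by
  refine ⟨fun g hg => ?_, ?_⟩
  · obtain ⟨g', hg', rfl⟩ := List.mem_map.1 hg
    exact (h.1 g' hg').inv
  · rw [List.pairwise_map]
    exact h.2.imp fun h => by rwa [Sym.inv_qubits, Sym.inv_qubits]

theorem LayerValid.disjoint {N : ℕ} (hN : 0 < N) {L : List Sym} (h : LayerValid N L) :
    (L.map (Sym.gate hN)).Pairwise fun g h => Disjoint g.qubits h.qubits := by
  rw [List.pairwise_map]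
  refine List.Pairwise.imp_of_mem (fun {g k} hg hk hd => ?_) h.2
  rw [Sym.gate_qubits, Sym.gate_qubits, Finset.disjoint_left]
  intro p hp hp'
  simp only [List.mem_toFinset, List.mem_map] at hp hp'
  obtain ⟨a, ha, rfl⟩ := hp
  obtain ⟨b, hb, hab⟩ := hp'
  rw [qubit_inj hN ((h.1 k hk).1 b hb) ((h.1 g hg).1 a ha)] at hab
  subst hab
  exact hd ha hb

/-- The circuit denoted by a list of valid symbolic layers. -/
noncomputable def mkCircuit {N : ℕ} (hN : 0 < N) (U : List (List Sym))
    (h : ∀ L ∈ U, LayerValid N L) : Circuit N where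
  layers := U.map (List.map (Sym.gate hN))
  disjoint L hL := by
    obtain ⟨L', hL', rfl⟩ := List.mem_map.1 hL
    exact (h L' hL').disjoint hN

theorem circuitCode_mkCircuit {N : ℕ} (hN : 0 < N) (U : List (List Sym))
    (h : ∀ L ∈ U, LayerValid N L) :
    CircuitCode (mkCircuit hN U h) (numeral N ++ U.flatMap layerWord) := by
  refine ⟨U.map layerWord, ?_, by rw [List.flatMap_def]⟩
  simp only [mkCircuit, List.forall₂_map_left_iff, List.forall₂_map_right_iff]
  refine List.forall₂_same.2 fun L hL => ⟨L.map Sym.word, ?_, by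
    rw [layerWord, List.flatMap_def]⟩
  simp only [List.forall₂_map_left_iff, List.forall₂_map_right_iff]
  exact List.forall₂_same.2 fun g hg => Sym.gateCode hN ((h L hL).1 g hg)

/-- The total number of qubits listed in the gates. -/
def symSize (U : List (List Sym)) : ℕ :=
  (U.map fun L => (L.map fun g => g.qubits.length).sum).sum

theorem size_mkCircuit_le {N : ℕ} (hN : 0 < N) (U : List (List Sym))
    (h : ∀ L ∈ U, LayerValid N L) : (mkCircuit hN U h).size ≤ symSize U := by
  simp only [Circuit.size, mkCircuit, symSize, List.map_map]
  refine List.sum_le_sum fun L _ => ?_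
  simp only [Function.comp, List.map_map]
  exact List.sum_le_sum fun g _ => Sym.gate_size_le hN g

/-! ### Validity of the layers -/

theorem pairwise_map_range {α : Type} {R : α → α → Prop} {f : ℕ → α} {n : ℕ}
    (h : ∀ i < n, ∀ j < n, i ≠ j → R (f i) (f j)) : ((List.range n).map f).Pairwise R := by
  rw [List.pairwise_map]
  refine List.Pairwise.imp_of_mem (fun {i j} hi hj hij => ?_) List.nodup_range
  exact h i (List.mem_range.1 hi) j (List.mem_range.1 hj) hij

/-- The number of qubits of the circuit. -/
abbrev qubits (n : ℕ) : ℕ := n + 1 + 3 * span n * span n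

theorem qubits_pos (n : ℕ) : 0 < qubits n := by unfold qubits; omega

theorem ix_lt {n t k u : ℕ} (ht : t ≤ 2) (hk : k < span n) (hu : u < span n) :
    ix n t k u < qubits n := by
  have h1 : t * span n + k + 1 ≤ 3 * span n := by nlinarith
  have h2 : (t * span n + k + 1) * span n ≤ 3 * span n * span n := Nat.mul_le_mul_right _ h1
  unfold ix qubits
  nlinarith

/-- Beyond the offset `n + 1`, the coordinates are digits in base `span n`. The leading digit `t`
needs no bound. -/
theorem ix_inj {n t k u t' k' u' : ℕ} (hk : k < span n) (hu : u < span n) (hk' : k' < span n)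
    (hu' : u' < span n) : ix n t k u = ix n t' k' u' ↔ t = t' ∧ k = k' ∧ u = u' := by
  refine ⟨fun h => ?_, fun ⟨h1, h2, h3⟩ => by rw [h1, h2, h3]⟩
  have h0 : (t * span n + k) * span n + u = (t' * span n + k') * span n + u' := by
    unfold ix at h; omega
  have key : ∀ a b : ℕ, b < span n → (a * span n + b) / span n = a ∧
      (a * span n + b) % span n = b := fun a b hb => by
    have hpos : 0 < span n := by omega
    rw [mul_comm]
    exact ⟨by rw [Nat.mul_add_div hpos, Nat.div_eq_of_lt hb, add_zero],
      by rw [Nat.mul_add_mod, Nat.mod_eq_of_lt hb]⟩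
  obtain ⟨h1, h2⟩ := key (t * span n + k) u hu
  obtain ⟨h3, h4⟩ := key (t' * span n + k') u' hu'
  rw [h0, h3] at h1
  rw [h0, h4] at h2
  obtain ⟨h5, h6⟩ := key t k hk
  obtain ⟨h7, h8⟩ := key t' k' hk'
  rw [← h1, h7] at h5
  rw [← h1, h8] at h6
  exact ⟨h5.symm, h6.symm, h2.symm⟩

theorem lt_ix (n t k u : ℕ) : n < ix n t k u := by unfold ix; omega

/-- The coordinates of a level are in range. -/
structure LevelOK (n k w m : ℕ) : Prop where
  hm : 0 < m
  hk : k + 1 < span n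
  hw : w ≤ span n
  hwm : w * m ≤ span n
  ho : outs w m ≤ span n

/-- The output wire that controls copy `v`. -/
def owner (w m v : ℕ) : ℕ := v / m / blockLen w m * m + v % m

theorem blockLen_pos {w m : ℕ} (hm : 0 < m) : 0 < blockLen w m := by
  have : 2 ^ 1 ≤ 2 ^ m := Nat.pow_le_pow_right (by norm_num) hm
  unfold blockLen
  omega

theorem owner_lt {w m v : ℕ} (hv : v < w * m) : owner w m v < outs w m := by
  have hm : 0 < m := Nat.pos_of_ne_zero fun h => by simp [h] at hv
  have h1 : v / m ≤ w - 1 := by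
    have := Nat.div_lt_of_lt_mul (by rwa [mul_comm] at hv)
    omega
  have h2 : v / m / blockLen w m ≤ (w - 1) / blockLen w m := Nat.div_le_div_right h1
  have h3 := Nat.mod_lt v hm
  unfold owner outs
  nlinarith

/-- Copy `v` belongs to wire `v / m` and row `v % m`, so block and row determine its unique owner.
That different output wires have disjoint targets is read off from this form. -/
theorem mem_targets {n k w m o p : ℕ} (hm : 0 < m) : p ∈ targets n k w m o ↔
    ∃ v < w * m, owner w m v = o ∧ (p = ix n 0 k v ∨ p = ix n 1 k v) := by
  have hb := blockLen_pos (w := w) hm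
  simp only [targets, List.mem_flatMap, List.mem_range, List.mem_cons, List.not_mem_nil, or_false]
  constructor
  · rintro ⟨i, hi, hp⟩
    have hlt := Nat.mod_lt o hm
    have h1 : ((o / m * blockLen w m + i) * m + o % m) / m = o / m * blockLen w m + i := by
      rw [mul_comm _ m, Nat.mul_add_div hm, Nat.div_eq_of_lt hlt, add_zero]
    have h2 : (o / m * blockLen w m + i) / blockLen w m = o / m := by
      rw [mul_comm (o / m), Nat.mul_add_div hb,
        Nat.div_eq_of_lt (hi.trans_le (min_le_left _ _)), add_zero]
    refine ⟨_, ?_, ?_, hp⟩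
    · have h3 := hi.trans_le (min_le_right _ _)
      have : o / m * blockLen w m + i + 1 ≤ w := by omega
      nlinarith
    · rw [owner, h1, h2, mul_comm (o / m * blockLen w m + i) m, Nat.mul_add_mod, Nat.mod_mod,
        Nat.div_add_mod']
  · rintro ⟨v, hv, rfl, hp⟩
    have hlt := Nat.mod_lt v hm
    have h1 : owner w m v / m = v / m / blockLen w m := by
      rw [owner, mul_comm _ m, Nat.mul_add_div hm, Nat.div_eq_of_lt hlt, add_zero]
    have h2 : owner w m v % m = v % m := by
      rw [owner, mul_comm _ m, Nat.mul_add_mod, Nat.mod_mod]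
    have h3 := Nat.div_add_mod (v / m) (blockLen w m)
    have h4 := Nat.mod_lt (v / m) hb
    have h5 : v / m < w := Nat.div_lt_of_lt_mul (by rwa [mul_comm] at hv)
    rw [mul_comm] at h3
    refine ⟨v / m % blockLen w m, ?_, ?_⟩
    · rw [h1]; omega
    · rw [h1, h2, h3, mul_comm (v / m), Nat.div_add_mod]
      exact hp

namespace LevelOK

variable {n k w m : ℕ}

theorem wire_lt (h : LevelOK n k w m) {o : ℕ} (ho : o < outs w m) :
    ix n 2 (k + 1) o < qubits n :=
  ix_lt le_rfl h.hk (ho.trans_le h.ho)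

theorem copy_lt (h : LevelOK n k w m) {t v : ℕ} (ht : t ≤ 2) (hv : v < w * m) :
    ix n t k v < qubits n :=
  ix_lt ht (by have := h.hk; omega) (hv.trans_le h.hwm)

theorem wire_inj (h : LevelOK n k w m) {o o' : ℕ} (ho : o < outs w m) (ho' : o' < outs w m) :
    ix n 2 (k + 1) o = ix n 2 (k + 1) o' ↔ o = o' := by
  rw [ix_inj h.hk (ho.trans_le h.ho) h.hk (ho'.trans_le h.ho)]
  simp

theorem copy_inj (h : LevelOK n k w m) {t t' v v' : ℕ} (hv : v < w * m) (hv' : v' < w * m) :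
    ix n t k v = ix n t' k v' ↔ t = t' ∧ v = v' := by
  have hk := h.hk
  rw [ix_inj (by omega) (hv.trans_le h.hwm) (by omega) (hv'.trans_le h.hwm)]
  simp

theorem wire_ne_copy (h : LevelOK n k w m) {t o v : ℕ} (ho : o < outs w m) (hv : v < w * m) :
    ix n 2 (k + 1) o ≠ ix n t k v := by
  have hk := h.hk
  rw [Ne, ix_inj h.hk (ho.trans_le h.ho) (by omega) (hv.trans_le h.hwm)]
  omega

theorem nodup_targets (h : LevelOK n k w m) {o : ℕ} : (targets n k w m o).Nodup := by
  have hm := h.hm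
  have hlt := Nat.mod_lt o hm
  have key : ∀ i < min (blockLen w m) (w - o / m * blockLen w m),
      (o / m * blockLen w m + i) * m + o % m < w * m := fun i hi => by
    have h3 := hi.trans_le (min_le_right _ _)
    have : o / m * blockLen w m + i + 1 ≤ w := by omega
    nlinarith
  rw [targets, List.nodup_flatMap]
  refine ⟨fun i hi => ?_, List.Pairwise.imp_of_mem (fun {i j} hi hj hij => ?_) List.nodup_range⟩
  · rw [List.mem_range] at hi
    simp [h.copy_inj (key i hi) (key i hi)]
  · rw [List.mem_range] at hi hj
    have hne : (o / m * blockLen w m + i) * m + o % m ≠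
        (o / m * blockLen w m + j) * m + o % m := fun he => hij (by
      have := Nat.eq_of_mul_eq_mul_right hm (Nat.add_right_cancel he)
      omega)
    intro p hp hp'
    simp only [List.mem_cons, List.not_mem_nil, or_false] at hp hp'
    rcases hp with rfl | rfl <;> rcases hp' with hp | hp <;>
      exact hne ((h.copy_inj (key i hi) (key j hj)).1 hp).2

theorem hadLayer_valid (h : LevelOK n k w m) : LayerValid (qubits n) (hadLayer n k w m) := by
  constructor
  · simp only [hadLayer, List.mem_map, List.mem_range, forall_exists_index, and_imp]
    rintro _ o ho rfl
    simpa [Sym.Valid, Sym.qubits] using h.wire_lt ho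
  · refine pairwise_map_range fun i hi j hj hij => ?_
    simp only [Sym.qubits, List.singleton_disjoint, List.mem_singleton]
    rwa [h.wire_inj hi hj]

theorem copy_index_lt {i j : ℕ} (hi : i < w) (hj : j < m) : i * m + j < w * m := by
  have : i + 1 ≤ w := hi
  nlinarith

theorem copy_index_div {i j : ℕ} (hj : j < m) : (i * m + j) / m = i := by
  rw [mul_comm, Nat.mul_add_div (by omega), Nat.div_eq_of_lt hj, add_zero]

theorem copyLayer_valid (h : LevelOK n k w m) : LayerValid (qubits n) (copyLayer n k w m) := by
  have hk := h.hk
  have hw := h.hw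
  have hwm := h.hwm
  have h1 : ∀ i < w, ∀ v < w * m, ix n 2 k i ≠ ix n 0 k v := fun i hi v hv => by
    rw [Ne, ix_inj (by omega) (by omega) (by omega) (by omega)]
    omega
  constructor
  · simp only [copyLayer, List.mem_map, List.mem_range, forall_exists_index, and_imp]
    rintro _ i hi rfl
    simp only [Sym.Valid, Sym.qubits, List.mem_cons, List.mem_map, List.mem_range,
      List.nodup_cons, not_exists, not_and, and_true]
    refine ⟨?_, fun j hj => (h1 i hi _ (copy_index_lt hi hj)).symm, ?_⟩
    · rintro q (rfl | ⟨j, hj, rfl⟩)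
      · exact ix_lt le_rfl (by omega) (by omega)
      · exact h.copy_lt (by omega) (copy_index_lt hi hj)
    · refine List.Nodup.map_on (fun a ha b hb hab => ?_) List.nodup_range
      rw [List.mem_range] at ha hb
      have := ((h.copy_inj (copy_index_lt hi ha) (copy_index_lt hi hb)).1 hab).2
      omega
  · refine pairwise_map_range fun i hi j hj hij => ?_
    intro p hp hp'
    simp only [Sym.qubits, List.mem_cons, List.mem_map, List.mem_range] at hp hp'
    rcases hp with rfl | ⟨a, ha, rfl⟩ <;> rcases hp' with hp | ⟨b, hb, hp⟩
    · rw [ix_inj (by omega) (by omega) (by omega) (by omega)] at hp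
      omega
    · exact h1 i hi _ (copy_index_lt hj hb) hp.symm
    · exact h1 j hj _ (copy_index_lt hi ha) hp.symm
    · have := ((h.copy_inj (copy_index_lt hj hb) (copy_index_lt hi ha)).1 hp).2
      have h2 := congrArg (· / m) this
      simp only [copy_index_div ha, copy_index_div hb] at h2
      exact hij h2.symm

theorem fanLayer_valid (h : LevelOK n k w m) : LayerValid (qubits n) (fanLayer n k w m) := by
  constructor
  · simp only [fanLayer, List.mem_map, List.mem_range, forall_exists_index, and_imp]
    rintro _ o ho rfl
    simp only [Sym.Valid, Sym.qubits, List.mem_cons, List.nodup_cons, and_true]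
    refine ⟨?_, fun hp => ?_, h.nodup_targets⟩
    · rintro q (rfl | hq)
      · exact h.wire_lt ho
      · obtain ⟨v, hv, -, rfl | rfl⟩ := (mem_targets h.hm).1 hq
        · exact h.copy_lt (by omega) hv
        · exact h.copy_lt (by omega) hv
    · obtain ⟨v, hv, -, h1 | h1⟩ := (mem_targets h.hm).1 hp
      · exact h.wire_ne_copy ho hv h1
      · exact h.wire_ne_copy ho hv h1
  · refine pairwise_map_range fun i hi j hj hij => ?_
    intro p hp hp'
    simp only [Sym.qubits, List.mem_cons, mem_targets h.hm] at hp hp'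
    rcases hp with rfl | ⟨v, hv, hvo, hp⟩ <;> rcases hp' with hp' | ⟨v', hv', hvo', hp'⟩
    · exact hij ((h.wire_inj hi hj).1 hp')
    · rcases hp' with hp' | hp' <;> exact h.wire_ne_copy hi hv' hp'
    · subst hp'
      rcases hp with hp' | hp' <;> exact h.wire_ne_copy hj hv hp'
    · have : v = v' := by
        rcases hp with rfl | rfl <;> rcases hp' with hp' | hp' <;>
          exact ((h.copy_inj hv hv').1 hp').2
      subst this
      exact hij (hvo.symm.trans hvo')

theorem den_pos (w j : ℕ) : 0 < den w j := by
  have : 0 < 2 ^ (j + 2) := by positivity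
  unfold den
  omega

theorem rotLayer_valid (h : LevelOK n k w m) : LayerValid (qubits n) (rotLayer n k w m) := by
  constructor
  · simp only [rotLayer, List.mem_append, List.mem_map, List.mem_range]
    rintro _ (⟨v, hv, rfl⟩ | ⟨v, hv, rfl⟩)
    · have h1 := den_pos w (v % m)
      simpa [Sym.Valid, Sym.qubits] using ⟨h.copy_lt (by omega) hv, h1, h1⟩
    · have h1 := den_pos w (v % m)
      simpa [Sym.Valid, Sym.qubits] using ⟨h.copy_lt (by omega) hv, h1⟩
  · rw [rotLayer, List.pairwise_append]
    refine ⟨pairwise_map_range fun i hi j hj hij => ?_,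
      pairwise_map_range fun i hi j hj hij => ?_, ?_⟩
    · simp only [Sym.qubits, List.singleton_disjoint, List.mem_singleton]
      rw [h.copy_inj hi hj]
      simpa using hij
    · simp only [Sym.qubits, List.singleton_disjoint, List.mem_singleton]
      rw [h.copy_inj hi hj]
      simpa using hij
    · simp only [List.mem_map, List.mem_range]
      rintro _ ⟨i, hi, rfl⟩ _ ⟨j, hj, rfl⟩
      simp only [Sym.qubits, List.singleton_disjoint, List.mem_singleton]
      rw [h.copy_inj hi hj]
      simp

theorem level_valid (h : LevelOK n k w m) : ∀ L ∈ level n k w m, LayerValid (qubits n) L := by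
  simp [level, h.hadLayer_valid, h.copyLayer_valid, h.fanLayer_valid, h.rotLayer_valid]

end LevelOK

theorem inputLayer_valid (n : ℕ) : LayerValid (qubits n) (inputLayer n) := by
  have hs : n < span n := by unfold span; omega
  have h1 : ∀ i j, i < n → ix n 2 0 j ≠ i := fun i j hi => by
    have := lt_ix n 2 0 j
    omega
  constructor
  · simp only [inputLayer, List.mem_map, List.mem_range, forall_exists_index, and_imp]
    rintro _ i hi rfl
    simp only [Sym.Valid, Sym.qubits, List.mem_cons, List.not_mem_nil, or_false, forall_eq_or_imp,
      forall_eq, List.nodup_cons, not_false_eq_true, List.nodup_nil, and_true]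
    exact ⟨⟨by unfold qubits; omega, ix_lt le_rfl (by omega) (by omega)⟩, (h1 i i hi).symm⟩
  · refine pairwise_map_range fun i hi j hj hij => ?_
    have h2 : ix n 2 0 j ≠ ix n 2 0 i := by
      rw [Ne, ix_inj (by omega) (by omega) (by omega) (by omega)]
      omega
    simp [Sym.qubits, Ne.symm hij, h2, h1 i j hi, (h1 j i hj).symm]

theorem single_valid {N c p : ℕ} (hc : c < N) (hp : p < N) (h : c ≠ p) :
    LayerValid N [.fan c [p]] := by
  simp [LayerValid, Sym.Valid, Sym.qubits, hc, hp, h]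

end QuantumFanOut

/-! ### Correctness of a single level -/

namespace QuantumFanOut

/-! ### The action of the layers -/

/-- The bit at a given index. -/
def bitAt {N : ℕ} (hN : 0 < N) (x : Bits N) (p : ℕ) : Bool := x (qubit hN p)

/-- The gates of a list of layers. -/
noncomputable def gates {N : ℕ} (hN : 0 < N) (U : List (List Sym)) : List (Gate N) :=
  (U.map (List.map (Sym.gate hN))).flatten

theorem gates_append {N : ℕ} (hN : 0 < N) (U V : List (List Sym)) :
    gates hN (U ++ V) = gates hN U ++ gates hN V := by
  simp [gates]

theorem bitAt_update {N : ℕ} (hN : 0 < N) (x : Bits N) {p q : ℕ} (hp : p < N) (hq : q < N)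
    (b : Bool) : bitAt hN (Function.update x (qubit hN p) b) q =
      if q = p then b else bitAt hN x q := by
  simp [bitAt, Function.update_apply, qubit_inj hN hq hp]

theorem runGates_fanOut {N : ℕ} {ι : Type} (c : ι → Fin N) (T : ι → Finset (Fin N))
    (h : ∀ i, c i ∉ T i) (l : List ι) (ψ : QState N) (x : Bits N) :
    runGates (l.map fun i => .fanOut (c i) (T i) (h i)) ψ x =
      ψ (fanBits (l.map fun i => (c i, T i)) x) := by
  induction l generalizing ψ with
  | nil => rfl
  | cons i l ih => rw [List.map_cons, runGates_cons, ih]; rfl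

/-- Later arguments need only these properties of the permutation `κ`. Disjointness makes the
effects of the gates independent of their order. -/
theorem exists_fan_action {N : ℕ} (hN : 0 < N) {ι : Type} {c : ι → ℕ} {t : ι → List ℕ} {l : List ι}
    (hL : LayerValid N (l.map fun i => .fan (c i) (t i))) :
    ∃ κ : Bits N → Bits N,
      (∀ ψ x, runGates (gates hN [l.map fun i => .fan (c i) (t i)]) ψ x = ψ (κ x)) ∧
      (∀ x, κ (κ x) = x) ∧
      (∀ x, ∀ i ∈ l, ∀ p ∈ t i, bitAt hN (κ x) p = xor (bitAt hN x p) (bitAt hN x (c i))) ∧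
      ∀ x, ∀ p < N, (∀ i ∈ l, p ∉ t i) → bitAt hN (κ x) p = bitAt hN x p := by
  set T : ι → Finset (Fin N) :=
    fun i => ((t i).map (qubit hN)).toFinset.erase (qubit hN (c i)) with hT
  have hval : ∀ i ∈ l, (Sym.fan (c i) (t i)).Valid N := fun i hi =>
    hL.1 _ (List.mem_map.2 ⟨i, hi, rfl⟩)
  have hmem : ∀ i ∈ l, ∀ p < N, qubit hN p ∈ T i ↔ p ∈ t i := fun i hi p hp => by
    rw [hT]
    simp only [Sym.targets_eq hN (hval i hi), List.mem_toFinset, List.mem_map]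
    constructor
    · rintro ⟨a, ha, hap⟩
      rw [qubit_inj hN ((hval i hi).1 a (by simp [Sym.qubits, ha])) hp] at hap
      rwa [← hap]
    · exact fun h => ⟨p, h, rfl⟩
  have h0 : gates hN [l.map fun i => .fan (c i) (t i)] =
      l.map fun i => .fanOut (qubit hN (c i)) (T i) (Finset.notMem_erase _ _) := by
    simp [gates, Sym.gate, hT]
  have h1 : ∀ ψ x, runGates (gates hN [l.map fun i => .fan (c i) (t i)]) ψ x =
      ψ (fanBits (l.map fun i => (qubit hN (c i), T i)) x) := fun ψ x => by
    rw [h0, runGates_fanOut]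
  have hd := hL.disjoint hN
  refine ⟨_, h1, fun x => ?_, fun x i hi p hp => ?_, fun x p hpN hp => ?_⟩
  -- A fan-out layer is its own inverse as a list of gates. Applied to `ket x`, this says that `κ`
  -- is an involution.
  · have h2 := runGates_inv hd (ket x)
    have h3 : (((l.map fun i => Sym.fan (c i) (t i)).map (Sym.gate hN)).map Gate.inv) =
        gates hN [l.map fun i => .fan (c i) (t i)] := by
      simp [gates, Sym.gate, Gate.inv]
    have h4 : ((l.map fun i => Sym.fan (c i) (t i)).map (Sym.gate hN)) =
        gates hN [l.map fun i => .fan (c i) (t i)] := by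
      simp [gates]
    rw [h3, h4] at h2
    have h5 := congrFun h2 x
    rw [h1, h1] at h5
    by_contra hne
    simp [ket, hne] at h5
  · have hpN : p < N := (hval i hi).1 p (by simp [Sym.qubits, hp])
    refine fanBits_of_mem (g := (qubit hN (c i), T i)) ?_ (List.mem_map.2 ⟨i, hi, rfl⟩)
      ((hmem i hi p hpN).2 hp) x
    rw [List.map_map, List.pairwise_map] at hd
    rw [List.pairwise_map]
    exact hd
  · refine fanBits_of_notMem (fun g hg => ?_) x
    obtain ⟨i, hi, rfl⟩ := List.mem_map.1 hg
    exact fun h => hp i hi ((hmem i hi p hpN).1 h)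

theorem runGates_rotZ {N : ℕ} {ι : Type} (α : ι → ℝ) (q : ι → Fin N) (l : List ι) (ψ : QState N)
    (x : Bits N) : runGates (l.map fun i => .one (rotZ (α i)) (q i)) ψ x =
      (l.map fun i => if x (q i) then Complex.exp (α i * Complex.I) else 1).prod * ψ x := by
  induction l generalizing ψ with
  | nil => simp
  | cons i l ih =>
    rw [List.map_cons, runGates_cons, ih, rotZ_apply, List.map_cons, List.prod_cons, mul_left_comm,
      mul_assoc]

/-- The phase by which the copies of row `j` are rotated. -/
noncomputable def phase (w j : ℕ) : ℂ := Complex.exp (2 * Real.pi * Complex.I / den w j)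

theorem phase_ne_zero (w j : ℕ) : phase w j ≠ 0 := Complex.exp_ne_zero _

theorem runGates_rotLayer {n k w m : ℕ} (ψ : QState (qubits n)) (x : Bits (qubits n)) :
    runGates (gates (qubits_pos n) [rotLayer n k w m]) ψ x =
      (∏ v ∈ Finset.range (w * m),
        ((if bitAt (qubits_pos n) x (ix n 0 k v) then phase w (v % m) else 1) *
        (if bitAt (qubits_pos n) x (ix n 1 k v) then (phase w (v % m))⁻¹ else 1))) * ψ x := by
  have h0 : gates (qubits_pos n) [rotLayer n k w m] =
      ((List.range (w * m)).map fun v => Gate.one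
        (rotZ (2 * Real.pi * ((1 : ℕ) / (den w (v % m) : ℕ))))
          (qubit (qubits_pos n) (ix n 0 k v))) ++
      ((List.range (w * m)).map fun v => Gate.one
        (rotZ (2 * Real.pi * ((den w (v % m) - 1 : ℕ) / (den w (v % m) : ℕ))))
          (qubit (qubits_pos n) (ix n 1 k v))) := by
    simp only [gates, rotLayer, List.map_cons, List.map_append, List.map_map, List.map_nil,
      List.flatten_cons, List.flatten_nil, List.append_nil]
    rfl
  have h1 : ∀ v, Complex.exp (((2 * Real.pi * ((1 : ℕ) / (den w (v % m) : ℕ)) : ℝ) : ℂ) *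
      Complex.I) = phase w (v % m) := fun v => by
    rw [phase]
    congr 1
    push_cast
    ring
  have h2 : ∀ v, Complex.exp (((2 * Real.pi * ((den w (v % m) - 1 : ℕ) /
      (den w (v % m) : ℕ)) : ℝ) : ℂ) * Complex.I) = (phase w (v % m))⁻¹ := fun v => by
    have hp := LevelOK.den_pos w (v % m)
    have hc : (den w (v % m) : ℂ) ≠ 0 := by exact_mod_cast hp.ne'
    -- Rotation by `(s - 1) / s` of a turn differs from rotation by `-1 / s` by a full turn.
    rw [phase, ← Complex.exp_neg]
    refine Eq.trans ?_ (Complex.exp_periodic _)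
    congr 1
    push_cast [Nat.cast_sub (show 1 ≤ den w (v % m) from hp)]
    field_simp
    ring
  rw [h0, runGates_append, runGates_rotZ, runGates_rotZ, ← mul_assoc, Finset.prod_mul_distrib]
  simp only [h1, h2, bitAt]
  rw [mul_comm (List.prod _)]
  rfl

/-- The squared phase is a primitive root of unity of order `2 ^ (j + 1)`. The square arises because
flipping an output wire turns the phase into its inverse. The bound on `2 ^ (j + 2)` disables the
cap in `den`. -/
theorem phase_sq_pow {w j A : ℕ} (hden : 2 ^ (j + 2) ≤ 4 * w + 4) {b : Bool}
    (hA : A % 2 ^ (j + 1) = if b then 2 ^ j else 0) :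
    (phase w j ^ 2) ^ A = if b then -1 else 1 := by
  have h0 : phase w j ^ 2 = Complex.exp (2 * Real.pi * Complex.I / 2 ^ (j + 1)) := by
    rw [phase, den, min_eq_left hden, ← Complex.exp_nat_mul]
    congr 1
    push_cast
    field_simp
    ring
  have h1 : (phase w j ^ 2) ^ 2 ^ (j + 1) = 1 := by
    rw [h0, ← Complex.exp_nat_mul, ← Complex.exp_two_pi_mul_I]
    congr 1
    push_cast
    field_simp
  have h2 : (phase w j ^ 2) ^ 2 ^ j = -1 := by
    rw [h0, ← Complex.exp_nat_mul, ← Complex.exp_pi_mul_I]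
    congr 1
    push_cast
    field_simp
    ring
  rw [← Nat.div_add_mod A (2 ^ (j + 1)), pow_add, pow_mul, h1, one_pow, one_mul, hA]
  cases b
  · simp
  · simpa using h2

/-- The weight of the wires in the block of output wire `o`. -/
def blockWeight (w m o : ℕ) (f : ℕ → Bool) : ℕ :=
  ((Finset.range w).filter fun i => i / blockLen w m = o / m ∧ f i = true).card

/-- In the row of `o`, each wire of the block has exactly one copy, with index `i * m + o % m`. -/
theorem card_owner {w m o : ℕ} (hm : 0 < m) (f : ℕ → Bool) :
    ((Finset.range (w * m)).filter fun v => owner w m v = o ∧ f (v / m) = true).card =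
      blockWeight w m o f := by
  have hlt := Nat.mod_lt o hm
  symm
  refine Finset.card_bij (fun i _ => i * m + o % m) (fun i hi => ?_) (fun i _ j _ hij => ?_)
    fun v hv => ?_
  · simp only [Finset.mem_filter, Finset.mem_range] at hi ⊢
    refine ⟨LevelOK.copy_index_lt hi.1 hlt, ?_, by rw [LevelOK.copy_index_div hlt]; exact hi.2.2⟩
    rw [owner, LevelOK.copy_index_div hlt, hi.2.1, mul_comm i m, Nat.mul_add_mod, Nat.mod_mod,
      Nat.div_add_mod']
  · exact Nat.eq_of_mul_eq_mul_right hm (Nat.add_right_cancel hij)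
  · simp only [Finset.mem_filter, Finset.mem_range] at hv
    obtain ⟨hv, rfl, hf⟩ := hv
    have h1 := Nat.mod_lt v hm
    refine ⟨v / m, ?_, ?_⟩
    · simp only [Finset.mem_filter, Finset.mem_range]
      refine ⟨Nat.div_lt_of_lt_mul (by rwa [mul_comm] at hv), ?_, hf⟩
      rw [owner, LevelOK.copy_index_div h1]
    · rw [owner, mul_comm _ m, mul_comm (v / m / _), Nat.mul_add_mod, Nat.mod_mod, Nat.div_add_mod]

/-- Between the two Hadamard layers the level is diagonal. Flipping output wire `o` multiplies the
diagonal by the squared phase of its row, or the inverse of this, to the power of the block weight.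
In the two cases of the hypothesis this is `-1` or `1`, and `hadamards_diagonal` determines the
wire. -/
theorem level_support {n k w m : ℕ} (h : LevelOK n k w m) (hden : ∀ j < m, 2 ^ (j + 2) ≤ 4 * w + 4)
    {z u : Bits (qubits n)}
    (ht : ∀ t < 2, ∀ v < w * m, bitAt (qubits_pos n) z (ix n t k v) = false)
    (hz : ∀ o < outs w m, bitAt (qubits_pos n) z (ix n 2 (k + 1) o) = false)
    (hu : runGates (gates (qubits_pos n) (level n k w m)) (ket z) u ≠ 0) :
    (∀ p < qubits n, (∀ o < outs w m, p ≠ ix n 2 (k + 1) o) →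
      bitAt (qubits_pos n) u p = bitAt (qubits_pos n) z p) ∧
    ∀ o < outs w m, ∀ b : Bool,
      blockWeight w m o (fun i => bitAt (qubits_pos n) z (ix n 2 k i)) % 2 ^ (o % m + 1) =
        (if b then 2 ^ (o % m) else 0) → bitAt (qubits_pos n) u (ix n 2 (k + 1) o) = b := by
  set hN := qubits_pos n
  have hm := h.hm
  have hk := h.hk
  have hw := h.hw
  have hwm := h.hwm
  obtain ⟨κ, hκ, hκκ, hκt, hκn⟩ := exists_fan_action hN h.copyLayer_valid
  obtain ⟨l, hl, hll, hlt, hln⟩ := exists_fan_action hN h.fanLayer_valid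
  set ρ : Bits (qubits n) → ℂ := fun x => ∏ v ∈ Finset.range (w * m),
        ((if bitAt hN x (ix n 0 k v) then phase w (v % m) else 1) *
        (if bitAt hN x (ix n 1 k v) then (phase w (v % m))⁻¹ else 1)) with hρ
  set H : List (Fin (qubits n)) := (List.range (outs w m)).map fun o =>
    qubit hN (ix n 2 (k + 1) o) with hH
  have hmemH : ∀ p < qubits n, qubit hN p ∈ H ↔ ∃ o < outs w m, p = ix n 2 (k + 1) o := by
    intro p hp
    simp only [hH, List.mem_map, List.mem_range]
    refine exists_congr fun o => and_congr_right fun ho => ?_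
    rw [qubit_inj hN (h.wire_lt ho) hp, eq_comm]
  have hHn : H.Nodup := by
    refine List.Nodup.map_on (fun a ha b hb hab => ?_) List.nodup_range
    rw [List.mem_range] at ha hb
    rwa [qubit_inj hN (h.wire_lt ha) (h.wire_lt hb), h.wire_inj ha hb] at hab
  set D := gates hN [copyLayer n k w m, fanLayer n k w m, rotLayer n k w m, fanLayer n k w m,
    copyLayer n k w m] with hDdef
  -- The copy and fan-out layers conjugate the rotations by a permutation of basis strings, so the
  -- product stays diagonal and the ancilla qubits are cleaned.
  have hD : ∀ ψ x, runGates D ψ x = ρ (l (κ x)) * ψ x := fun ψ x => by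
    have e : D = gates hN [copyLayer n k w m] ++ (gates hN [fanLayer n k w m] ++
        (gates hN [rotLayer n k w m] ++ (gates hN [fanLayer n k w m] ++
          gates hN [copyLayer n k w m]))) := by
      simp only [← gates_append]
      rfl
    rw [e]
    simp only [runGates_append]
    rw [copyLayer, hκ, fanLayer, hl, runGates_rotLayer, hl, hκ, hll, hκκ]
  have hlevel : gates hN (level n k w m) = hadamards H ++ D ++ hadamards H := by
    have e : gates hN [hadLayer n k w m] = hadamards H := by
      simp only [gates, hadLayer, hadamards, hH, List.map_cons, List.map_map, List.map_nil,
        List.flatten_cons, List.flatten_nil, List.append_nil]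
      rfl
    rw [← e, hDdef, ← gates_append, ← gates_append]
    rfl
  rw [hlevel] at hu
  obtain ⟨hu1, hu2⟩ := hadamards_diagonal hHn hD (fun c hc => by
    obtain ⟨o, ho, rfl⟩ := List.mem_map.1 hc
    exact hz o (List.mem_range.1 ho)) hu
  refine ⟨fun p hp hpo => hu1 _ fun hpH => ?_, fun o ho b hb => ?_⟩
  · obtain ⟨o, ho, h1⟩ := (hmemH p hp).1 hpH
    exact hpo o ho h1
  refine hu2 _ ((hmemH _ (h.wire_lt ho)).2 ⟨o, ho, rfl⟩) b fun x hx => ?_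
  have hdiv : ∀ v < w * m, v / m < w := fun v hv =>
    Nat.div_lt_of_lt_mul (by rwa [mul_comm] at hv)
  have hwire : ∀ i < w, ∀ o < outs w m, ix n 2 k i ≠ ix n 2 (k + 1) o := fun i hi o ho => by
    rw [Ne, ix_inj (by omega) (by omega) h.hk (ho.trans_le h.ho)]
    omega
  have hwN : ∀ i < w, ix n 2 k i < qubits n := fun i hi => ix_lt le_rfl (by omega) (by omega)
  -- the copies after both fan-out layers
  have hcopy : ∀ y : Bits (qubits n), (∀ t < 2, ∀ v < w * m, bitAt hN y (ix n t k v) = false) →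
      ∀ v < w * m,
      bitAt hN (l (κ y)) (ix n 0 k v) =
        xor (bitAt hN y (ix n 2 k (v / m))) (bitAt hN y (ix n 2 (k + 1) (owner w m v))) ∧
      bitAt hN (l (κ y)) (ix n 1 k v) = bitAt hN y (ix n 2 (k + 1) (owner w m v)) := by
    intro y hy v hv
    have hov := owner_lt hv
    have hκo : bitAt hN (κ y) (ix n 2 (k + 1) (owner w m v)) =
        bitAt hN y (ix n 2 (k + 1) (owner w m v)) := by
      refine hκn y _ (h.wire_lt hov) fun i hi hp => ?_
      rw [List.mem_range] at hi
      obtain ⟨j, hj, hp⟩ := List.mem_map.1 hp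
      exact h.wire_ne_copy hov (LevelOK.copy_index_lt hi (List.mem_range.1 hj)) hp.symm
    have hκ0 : bitAt hN (κ y) (ix n 0 k v) = bitAt hN y (ix n 2 k (v / m)) := by
      rw [hκt y (v / m) (List.mem_range.2 (hdiv v hv)) _ (List.mem_map.2 ⟨v % m,
        List.mem_range.2 (Nat.mod_lt v hm), by rw [mul_comm, Nat.div_add_mod]⟩), hy 0 (by omega) v hv,
        Bool.false_xor]
    have hκ1 : bitAt hN (κ y) (ix n 1 k v) = false := by
      rw [hκn y _ (h.copy_lt (by omega) hv) fun i hi hp => ?_, hy 1 (by omega) v hv]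
      rw [List.mem_range] at hi
      obtain ⟨j, hj, hp⟩ := List.mem_map.1 hp
      have := (h.copy_inj (LevelOK.copy_index_lt hi (List.mem_range.1 hj)) hv).1 hp
      omega
    have hor := List.mem_range.2 hov
    rw [hlt _ _ hor _ ((mem_targets hm).2 ⟨v, hv, rfl, .inl rfl⟩),
      hlt _ _ hor _ ((mem_targets hm).2 ⟨v, hv, rfl, .inr rfl⟩), hκo, hκ0, hκ1, Bool.false_xor]
    exact ⟨rfl, rfl⟩
  -- With wire value `a` and output value `b`, the copy holds `a ⊕ b` and the companion `b`.
  -- Opposite rotations cancel if `a = 0` and leave the phase with exponent `(-1)^b` if `a = 1`.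
  have hρy : ∀ y : Bits (qubits n), (∀ t < 2, ∀ v < w * m, bitAt hN y (ix n t k v) = false) →
      ρ (l (κ y)) = ∏ v ∈ Finset.range (w * m),
        if bitAt hN y (ix n 2 k (v / m)) then
          (if bitAt hN y (ix n 2 (k + 1) (owner w m v)) then (phase w (v % m))⁻¹
            else phase w (v % m)) else 1 := by
    intro y hy
    refine Finset.prod_congr rfl fun v hv => ?_
    obtain ⟨h1, h2⟩ := hcopy y hy v (Finset.mem_range.1 hv)
    rw [h1, h2]
    have := phase_ne_zero w (v % m)
    cases bitAt hN y (ix n 2 k (v / m)) <;>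
      cases bitAt hN y (ix n 2 (k + 1) (owner w m v)) <;> simp [this]
  have hxz : ∀ p < qubits n, (∀ o < outs w m, p ≠ ix n 2 (k + 1) o) → bitAt hN x p = bitAt hN z p :=
    fun p hp hpo => hx _ fun hpH => by
      obtain ⟨o, ho, h1⟩ := (hmemH p hp).1 hpH
      exact hpo o ho h1
  have hxt : ∀ t < 2, ∀ v < w * m, bitAt hN x (ix n t k v) = false := fun t ht' v hv => by
    rw [hxz _ (h.copy_lt (by omega) hv) fun o ho => (h.wire_ne_copy ho hv).symm, ht t ht' v hv]
  set c := ix n 2 (k + 1) o with hc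
  have hcN : c < qubits n := h.wire_lt ho
  set x' := Function.update x (qubit hN c) (!x (qubit hN c)) with hx'
  have hx't : ∀ t < 2, ∀ v < w * m, bitAt hN x' (ix n t k v) = false := fun t ht' v hv => by
    rw [hx', bitAt_update hN x hcN (h.copy_lt (by omega) hv),
      if_neg (h.wire_ne_copy ho hv).symm, hxt t ht' v hv]
  rw [hρy x hxt, hρy x' hx't]
  -- `F` is the contribution of a single copy whose wire is set to the ratio of the diagonal after
  -- and before the flip. Its power will be a sign, so the choice between `F` and its inverse
  -- becomes irrelevant.
  set F : ℂ := if bitAt hN x c then phase w (o % m) ^ 2 else (phase w (o % m) ^ 2)⁻¹ with hF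
  have hratio : ∀ v ∈ Finset.range (w * m),
      (if bitAt hN x' (ix n 2 k (v / m)) then
          (if bitAt hN x' (ix n 2 (k + 1) (owner w m v)) then (phase w (v % m))⁻¹
            else phase w (v % m)) else 1) =
      (if owner w m v = o ∧ bitAt hN z (ix n 2 k (v / m)) = true then F else 1) *
      (if bitAt hN x (ix n 2 k (v / m)) then
          (if bitAt hN x (ix n 2 (k + 1) (owner w m v)) then (phase w (v % m))⁻¹
            else phase w (v % m)) else 1) := by
    intro v hv
    rw [Finset.mem_range] at hv
    have hov := owner_lt hv
    rw [hx', bitAt_update hN x hcN (hwN _ (hdiv v hv)), if_neg (hwire _ (hdiv v hv) o ho),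
      bitAt_update hN x hcN (h.wire_lt hov), hxz _ (hwN _ (hdiv v hv)) (hwire _ (hdiv v hv))]
    have hph := phase_ne_zero w (v % m)
    by_cases ha : bitAt hN z (ix n 2 k (v / m)) = true
    · by_cases hvo : owner w m v = o
      · have h1 : o % m = v % m := by
          rw [← hvo, owner, mul_comm _ m, Nat.mul_add_mod, Nat.mod_mod]
        have hxc : x (qubit hN c) = bitAt hN x c := rfl
        simp only [hvo, ← hc, if_true, ha, and_self, hF, h1, hxc]
        cases bitAt hN x c
        · simp; field_simp
        · simp; field_simp
      · have h1 : ix n 2 (k + 1) (owner w m v) ≠ c := fun he => hvo ((h.wire_inj hov ho).1 he)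
        simp [h1, hvo]
    · simp [ha]
  rw [Finset.prod_congr rfl hratio, Finset.prod_mul_distrib]
  congr 1
  rw [← Finset.prod_filter, Finset.prod_const, card_owner hm fun i => bitAt hN z (ix n 2 k i)]
  have hpow := phase_sq_pow (hden (o % m) (Nat.mod_lt o hm)) hb
  rw [hF]
  cases bitAt hN x c
  · rw [if_neg Bool.false_ne_true, inv_pow, hpow]
    cases b <;> norm_num
  · rw [if_pos rfl, hpow]

end QuantumFanOut

namespace QuantumFanOut

/-! ### The invariant of the levels -/

theorem levelOK_width {n k : ℕ} (hk : k < height n) :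
    LevelOK n k (width n k) (rows n k (width n k)) := by
  have h1 := rows_pos hk
  have h2 := mul_rows_le n k (width n k)
  have h3 := heightAux_le n (8 * n + 8)
  have h4 := width_le n (k + 1)
  have h5 := width_le n k
  have h6 := Nat.le_mul_of_pos_right (width n k * rows n k (width n k)) (show 0 < 2 ^ k by positivity)
  rw [← height] at h3
  rw [width] at h4
  exact ⟨h1, by unfold span; omega, by unfold span; omega, by unfold span; omega,
    by unfold span; omega⟩

theorem outs_three_two : outs 3 2 = 2 := rfl

theorem levelOK_last (n : ℕ) : LevelOK n (height n) 3 2 := by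
  have h3 := heightAux_le n (8 * n + 8)
  rw [← height] at h3
  exact ⟨by omega, by unfold span; omega, by unfold span; omega, by unfold span; omega,
    by rw [outs_three_two]; unfold span; omega⟩

/-- A row number is smaller than the binary length of `w`, so `2 ^ j ≤ w`; the cap in `den` is
chosen with this in view. -/
theorem pow_le_of_lt_rows {n k w j : ℕ} (hj : j < rows n k w) : 2 ^ (j + 2) ≤ 4 * w + 4 := by
  have : 2 ^ j ≤ w := Nat.lt_size.1 (hj.trans_le (min_le_left _ _))
  rw [pow_add]
  omega

theorem blockLen_lt (w m : ℕ) : blockLen w m < 2 ^ m := by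
  have := Nat.two_pow_pos m
  unfold blockLen
  omega

theorem blockWeight_le {w m o : ℕ} (hm : 0 < m) (f : ℕ → Bool) :
    blockWeight w m o f ≤ blockLen w m := by
  refine (Finset.card_le_card (t := Finset.Ico (o / m * blockLen w m)
    (o / m * blockLen w m + blockLen w m)) fun i hi => ?_).trans (by simp)
  simp only [Finset.mem_filter] at hi
  rw [Finset.mem_Ico, ← hi.2.1]
  have h1 := Nat.div_add_mod' i (blockLen w m)
  have h2 := Nat.mod_lt i (blockLen_pos (w := w) hm)
  omega

/-- Two bits and their sum have weight `0` or `2`. Modulo `4` these are precisely the two cases that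
row `1` decides with certainty. -/
theorem blockWeight_three {f : ℕ → Bool} (h : f 2 = xor (f 0) (f 1)) :
    blockWeight 3 2 1 f % 2 ^ (1 % 2 + 1) = if (f 0 || f 1) then 2 ^ (1 % 2) else 0 := by
  have hb : ∀ i < 3, i / blockLen 3 2 = 1 / 2 := by decide
  rw [blockWeight, Finset.filter_congr (q := fun i => f i = true) fun i hi => by
    simp [hb i (Finset.mem_range.1 hi)], Finset.card_filter]
  simp only [Finset.sum_range_succ, Finset.sum_range_zero, h]
  cases f 0 <;> cases f 1 <;> simp

/-- The wires of level `k` carry the value `o` as their Or, and later wires and all other ancilla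
qubits are zero. -/
structure LevelState (n k w : ℕ) (o : Bool) (z : Bits (qubits n)) : Prop where
  copies : ∀ t < 2, ∀ k' < span n, ∀ u < span n, bitAt (qubits_pos n) z (ix n t k' u) = false
  later : ∀ k' < span n, ∀ u < span n, k < k' → bitAt (qubits_pos n) z (ix n 2 k' u) = false
  beyond : ∀ u < span n, w ≤ u → bitAt (qubits_pos n) z (ix n 2 k u) = false
  or : (∃ u < w, bitAt (qubits_pos n) z (ix n 2 k u) = true) ↔ o = true

/-- The row is the 2-adic valuation of `A`. -/
theorem exists_row {A m : ℕ} (h0 : 0 < A) (hA : A < 2 ^ m) :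
    ∃ j < m, A % 2 ^ (j + 1) = 2 ^ j := by
  obtain ⟨j, r, ⟨s, rfl⟩, hA'⟩ := Nat.exists_eq_two_pow_mul_odd h0.ne'
  refine ⟨j, ?_, ?_⟩
  · refine (Nat.pow_lt_pow_iff_right (by norm_num : 1 < 2)).1 (lt_of_le_of_lt ?_ hA)
    rw [hA']
    exact Nat.le_mul_of_pos_right _ (by omega)
  · have h1 : A = 2 ^ (j + 1) * s + 2 ^ j := by rw [hA', pow_succ]; ring
    rw [h1, Nat.mul_add_mod, Nat.mod_eq_of_lt]
    exact Nat.pow_lt_pow_right (by norm_num) (by omega)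

/-- If all wires are zero, every block weight vanishes and every output is zero. Otherwise some
block has positive weight below `2 ^ m`, and its output in the row given by `exists_row` is one.
Nothing is claimed about the remaining outputs, which may be in superposition. -/
theorem LevelState.level {n k w m : ℕ} {o : Bool} {z u : Bits (qubits n)}
    (hz : LevelState n k w o z) (h : LevelOK n k w m) (hden : ∀ j < m, 2 ^ (j + 2) ≤ 4 * w + 4)
    (hu : runGates (gates (qubits_pos n) (level n k w m)) (ket z) u ≠ 0) :
    LevelState n (k + 1) (outs w m) o u := by
  have hm := h.hm
  have hk := h.hk
  have hw := h.hw
  have ho := h.ho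
  have hwm := h.hwm
  obtain ⟨h1, h2⟩ := level_support h hden
    (fun t ht v hv => hz.copies t ht k (by omega) v (by omega))
    (fun o ho => hz.later (k + 1) hk o (by omega) (by omega)) hu
  refine ⟨fun t ht k' hk' v hv => ?_, fun k' hk' v hv hkk => ?_, fun v hv hov => ?_, ?_⟩
  · rw [h1 _ (ix_lt (by omega) hk' hv) fun o' ho' => ?_, hz.copies t ht k' hk' v hv]
    rw [Ne, ix_inj hk' hv hk (by omega)]
    omega
  · rw [h1 _ (ix_lt le_rfl hk' hv) fun o' ho' => ?_, hz.later k' hk' v hv (by omega)]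
    rw [Ne, ix_inj hk' hv hk (by omega)]
    omega
  · rw [h1 _ (ix_lt le_rfl hk hv) fun o' ho' => ?_, hz.later _ hk v hv (by omega)]
    rw [Ne, ix_inj hk hv hk (by omega)]
    omega
  · rw [← hz.or]
    constructor
    · rintro ⟨o', ho', hv⟩
      by_contra hne
      push Not at hne
      have h3 := h2 o' ho' false (by
        rw [blockWeight, Finset.filter_false_of_mem, Finset.card_empty, Nat.zero_mod]
        · rfl
        · rintro i hi ⟨-, hi'⟩
          exact hne i (Finset.mem_range.1 hi) hi')
      rw [h3] at hv
      exact Bool.false_ne_true hv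
    · rintro ⟨i, hi, hiz⟩
      have hA : 0 < blockWeight w m (i / blockLen w m * m)
          (fun i => bitAt (qubits_pos n) z (ix n 2 k i)) := by
        refine Finset.card_pos.2 ⟨i, ?_⟩
        simp [hi, hiz, Nat.mul_div_cancel _ hm]
      obtain ⟨j, hj, hAj⟩ := exists_row hA ((blockWeight_le hm _).trans_lt (blockLen_lt w m))
      have hdiv : (i / blockLen w m * m + j) / m = i / blockLen w m := LevelOK.copy_index_div hj
      have hmod : (i / blockLen w m * m + j) % m = j := by
        rw [mul_comm, Nat.mul_add_mod, Nat.mod_eq_of_lt hj]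
      have hlt : i / blockLen w m * m + j < outs w m := by
        have h3 : i / blockLen w m ≤ (w - 1) / blockLen w m := Nat.div_le_div_right (by omega)
        unfold outs
        nlinarith
      refine ⟨_, hlt, h2 _ hlt true ?_⟩
      rw [hmod, if_pos rfl, ← hAj]
      simp only [blockWeight, hdiv, Nat.mul_div_cancel _ hm]

theorem exists_eq_of_cnot {N : ℕ} (hN : 0 < N) {c p : ℕ} (hc : c < N) (hp : p < N) (hcp : c ≠ p)
    {z u : Bits N} (hu : runGates (gates hN [[.fan c [p]]]) (ket z) u ≠ 0) :
    bitAt hN u p = xor (bitAt hN z p) (bitAt hN z c) ∧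
      ∀ q < N, q ≠ p → bitAt hN u q = bitAt hN z q := by
  obtain ⟨κ, h1, h2, h3, h4⟩ := exists_fan_action hN (ι := Unit) (c := fun _ => c)
    (t := fun _ => [p]) (l := [()]) (single_valid hc hp hcp)
  have h5 := h1 (ket z) u
  simp only [List.map_cons, List.map_nil] at h5
  rw [h5] at hu
  have h6 : κ u = z := by
    by_contra hne
    exact hu (by simp [ket, hne])
  have h7 : u = κ z := by rw [← h6, h2]
  rw [h7]
  exact ⟨h3 z () (by simp) p (by simp), fun q hq hqp => h4 z q hq (by simpa using hqp)⟩

/-- The initial string: the input, the target and clean ancilla qubits. -/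
structure InitialState (n : ℕ) (o : Bool) (z : Bits (qubits n)) : Prop where
  ancilla : ∀ t ≤ 2, ∀ k < span n, ∀ u < span n, bitAt (qubits_pos n) z (ix n t k u) = false
  or : (∃ i < n, bitAt (qubits_pos n) z i = true) ↔ o = true

theorem InitialState.inputLayer {n : ℕ} {o : Bool} {z u : Bits (qubits n)}
    (hz : InitialState n o z)
    (hu : runGates (gates (qubits_pos n) [inputLayer n]) (ket z) u ≠ 0) :
    LevelState n 0 n o u := by
  have hs : n < span n := by unfold span; omega
  obtain ⟨κ, h1, h2, h3, h4⟩ := exists_fan_action (qubits_pos n) (inputLayer_valid n)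
  rw [QuantumFanOut.inputLayer, h1] at hu
  have h6 : κ u = z := by
    by_contra hne
    exact hu (by simp [ket, hne])
  have h7 : u = κ z := by rw [← h6, h2]
  subst h7
  have hfix : ∀ t ≤ 2, ∀ k < span n, ∀ v < span n, (k = 0 → t = 2 → n ≤ v) →
      bitAt (qubits_pos n) (κ z) (ix n t k v) = false := fun t ht k hk v hv hne => by
    rw [h4 z _ (ix_lt ht hk hv) fun i hi => ?_, hz.ancilla t ht k hk v hv]
    rw [List.mem_range] at hi
    rw [List.mem_singleton, ix_inj hk hv (by omega) (by omega)]
    omega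
  refine ⟨fun t ht k hk v hv => hfix t ht.le k hk v hv (by omega),
    fun k hk v hv h0 => hfix 2 le_rfl k hk v hv (by omega),
    fun v hv h0 => hfix 2 le_rfl 0 (by omega) v hv (by omega), ?_⟩
  rw [← hz.or]
  refine exists_congr fun i => and_congr_right fun hi => ?_
  rw [h3 z i (List.mem_range.2 hi) _ (List.mem_singleton_self _),
    hz.ancilla 2 le_rfl 0 (by omega) i (by omega), Bool.false_xor]

/-- The levels before the last one. -/
def levels (n k : ℕ) : List (List Sym) :=
  (List.range k).flatMap fun k => level n k (width n k) (rows n k (width n k))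

/-- By linearity, every basis string in the support after a level arises from one in the support
before it. Each level therefore only has to be analysed on basis states. -/
theorem levels_support {n k : ℕ} (hk : k ≤ height n) {o : Bool} {z u : Bits (qubits n)}
    (hz : InitialState n o z)
    (hu : runGates (gates (qubits_pos n) ([inputLayer n] ++ levels n k)) (ket z) u ≠ 0) :
    LevelState n k (width n k) o u := by
  induction k generalizing u with
  | zero =>
    simp only [levels, List.range_zero, List.flatMap_nil, List.append_nil] at hu
    exact hz.inputLayer hu
  | succ k ih =>
    rw [levels, List.range_succ, List.flatMap_append, List.flatMap_singleton, ← levels,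
      ← List.append_assoc, gates_append, runGates_append] at hu
    obtain ⟨y, hy, hu⟩ := exists_of_runGates_ne_zero hu
    exact (ih (by omega) hy).level (levelOK_width hk) (fun j hj => pow_le_of_lt_rows hj) hu

/-- The last level, after a third wire has been set to the sum of the first two. -/
theorem LevelState.last {n L w : ℕ} (hok : LevelOK n L 3 2) (hw2 : w ≤ 2) {o : Bool}
    {x y' y u : Bits (qubits n)} (hst : LevelState n L w o x)
    (hy' : runGates (gates (qubits_pos n) [[.fan (ix n 2 L 0) [ix n 2 L 2]]]) (ket x) y' ≠ 0)
    (hy : runGates (gates (qubits_pos n) [[.fan (ix n 2 L 1) [ix n 2 L 2]]]) (ket y') y ≠ 0)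
    (hu : runGates (gates (qubits_pos n) (QuantumFanOut.level n L 3 2)) (ket y) u ≠ 0) :
    bitAt (qubits_pos n) u (ix n 2 (L + 1) 1) = o := by
  have hN := qubits_pos n
  have hk := hok.hk
  have hs : 16 ≤ span n := by unfold span; omega
  have hinj : ∀ k' < span n, ∀ t, ∀ v < span n, ix n t k' v = ix n 2 L 2 ↔ t = 2 ∧ k' = L ∧ v = 2 :=
    fun k' hk' t v hv => ix_inj hk' hv (by omega) (by omega)
  have hlt : ∀ v < span n, ix n 2 L v < qubits n := fun v hv => ix_lt le_rfl (by omega) hv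
  have hne : ∀ v < 2, ix n 2 L v ≠ ix n 2 L 2 := fun v hv => by
    rw [Ne, hinj _ (by omega) _ _ (by omega)]
    omega
  obtain ⟨h1, h2⟩ := exists_eq_of_cnot hN (hlt 0 (by omega)) (hlt 2 (by omega))
    (hne 0 (by omega)) hy'
  obtain ⟨h3, h4⟩ := exists_eq_of_cnot hN (hlt 1 (by omega)) (hlt 2 (by omega))
    (hne 1 (by omega)) hy
  have hyx : ∀ t ≤ 2, ∀ k' < span n, ∀ v < span n, ¬ (t = 2 ∧ k' = L ∧ v = 2) →
      bitAt hN y (ix n t k' v) = bitAt hN x (ix n t k' v) := fun t ht k' hk' v hv hne => by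
    have h5 : ix n t k' v ≠ ix n 2 L 2 := by rwa [Ne, hinj k' hk' t v hv]
    rw [h4 _ (ix_lt ht hk' hv) h5, h2 _ (ix_lt ht hk' hv) h5]
  -- Wire `2` lies beyond the at most two wires in use, so it is zero before the two additions. The
  -- same holds for wire `1` if only one is in use.
  have hx2 : bitAt hN x (ix n 2 L 2) = false := hst.beyond 2 (by omega) hw2
  have hy2 : bitAt hN y (ix n 2 L 2) =
      xor (bitAt hN x (ix n 2 L 0)) (bitAt hN x (ix n 2 L 1)) := by
    rw [h3, h1, h2 (ix n 2 L 1) (hlt 1 (by omega)) (hne 1 (by omega)), hx2, Bool.false_xor]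
  have hy0 := hyx 2 le_rfl L (by omega) 0 (by omega) (by omega)
  have hy1 := hyx 2 le_rfl L (by omega) 1 (by omega) (by omega)
  have hor : (bitAt hN x (ix n 2 L 0) || bitAt hN x (ix n 2 L 1)) = o := by
    have hlow : ∀ v < span n, bitAt hN x (ix n 2 L v) = true → v < w := fun v hv h => by
      by_contra hlt
      rw [hst.beyond v hv (by omega)] at h
      exact Bool.false_ne_true h
    rw [Bool.eq_iff_iff, ← hst.or, Bool.or_eq_true]
    constructor
    · rintro (h | h)
      · exact ⟨0, hlow 0 (by omega) h, h⟩
      · exact ⟨1, hlow 1 (by omega) h, h⟩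
    · rintro ⟨v, hv, h⟩
      have : v = 0 ∨ v = 1 := by omega
      rcases this with rfl | rfl
      · exact .inl h
      · exact .inr h
  have hden : ∀ j < 2, 2 ^ (j + 2) ≤ 4 * 3 + 4 := by decide
  have h5 := blockWeight_three (f := fun i => bitAt hN y (ix n 2 L i)) (by
    simp only [hy0, hy1, hy2])
  simp only [hy0, hy1, hor] at h5
  refine (level_support hok hden (fun t ht v hv => ?_) (fun o' ho' => ?_) hu).2 1
    (by rw [outs_three_two]; omega) o h5
  · rw [hyx t (by omega) L (by omega) v (by omega) (by omega)]
    exact hst.copies t ht L (by omega) v (by omega)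
  · rw [outs_three_two] at ho'
    rw [hyx 2 le_rfl (L + 1) hk o' (by omega) (by omega)]
    exact hst.later _ hk o' (by omega) (by omega)

theorem forward_support {n : ℕ} (hn : 1 ≤ n) {o : Bool} {z u : Bits (qubits n)}
    (hz : InitialState n o z)
    (hu : runGates (gates (qubits_pos n) (forward n)) (ket z) u ≠ 0) :
    bitAt (qubits_pos n) u (ix n 2 (height n + 1) 1) = o := by
  have e : forward n = ((([inputLayer n] ++ levels n (height n)) ++
      [[.fan (ix n 2 (height n) 0) [ix n 2 (height n) 2]]]) ++
      [[.fan (ix n 2 (height n) 1) [ix n 2 (height n) 2]]]) ++ level n (height n) 3 2 := by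
    simp only [forward, levels, List.append_assoc, List.cons_append, List.nil_append]
  rw [e, gates_append, runGates_append] at hu
  obtain ⟨y, hy, hu⟩ := exists_of_runGates_ne_zero hu
  rw [gates_append, runGates_append] at hy
  obtain ⟨y', hy', hy⟩ := exists_of_runGates_ne_zero hy
  rw [gates_append, runGates_append] at hy'
  obtain ⟨x, hx, hy'⟩ := exists_of_runGates_ne_zero hy'
  exact (levels_support le_rfl hz hx).last (levelOK_last n) (width_height_le hn) hy' hy hu

end QuantumFanOut

/-! ### Computing, copying and uncomputing the Or -/

namespace QuantumFanOut

/-! ### The circuit for the Or gate -/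

theorem forward_eq (n : ℕ) : forward n = [inputLayer n] ++ levels n (height n) ++
    [[.fan (ix n 2 (height n) 0) [ix n 2 (height n) 2]],
      [.fan (ix n 2 (height n) 1) [ix n 2 (height n) 2]]] ++ level n (height n) 3 2 := rfl

theorem forward_valid (n : ℕ) : ∀ L ∈ forward n, LayerValid (qubits n) L := by
  have hok := levelOK_last n
  have hk := hok.hk
  have hs : 16 ≤ span n := by unfold span; omega
  have hlt : ∀ v < 3, ix n 2 (height n) v < qubits n := fun v hv =>
    ix_lt le_rfl (by omega) (by omega)
  have hne : ∀ v < 2, ix n 2 (height n) v ≠ ix n 2 (height n) 2 := fun v hv => by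
    rw [Ne, ix_inj (by omega) (by omega) (by omega) (by omega)]
    omega
  intro L hL
  simp only [forward_eq, levels, List.mem_append, List.mem_cons, List.not_mem_nil, or_false,
    List.mem_flatMap, List.mem_range] at hL
  rcases hL with ((rfl | ⟨k, hk, hL⟩) | rfl | rfl) | hL
  · exact inputLayer_valid n
  · exact (levelOK_width hk).level_valid L hL
  · exact single_valid (hlt 0 (by omega)) (hlt 2 (by omega)) (hne 0 (by omega))
  · exact single_valid (hlt 1 (by omega)) (hlt 2 (by omega)) (hne 1 (by omega))
  · exact hok.level_valid L hL

theorem target_valid (n : ℕ) :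
    LayerValid (qubits n) [.fan (ix n 2 (height n + 1) 1) [n]] := by
  have hk := (levelOK_last n).hk
  refine single_valid (ix_lt le_rfl hk (by unfold span; omega)) (by unfold qubits; omega)
    (lt_ix _ _ _ _).ne'

theorem orLayers_valid (n : ℕ) : ∀ L ∈ orLayers n, LayerValid (qubits n) L := by
  intro L hL
  simp only [orLayers, invLayers, List.mem_append, List.mem_singleton, List.mem_map,
    List.mem_reverse] at hL
  rcases hL with (hL | rfl) | ⟨L', hL', rfl⟩
  · exact forward_valid n L hL
  · exact target_valid n
  · exact (forward_valid n L' hL').inv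

theorem ne_target_of_mem_level {n k w m : ℕ} : ∀ L ∈ level n k w m, ∀ g ∈ L, n ∉ g.qubits := by
  have h : ∀ t k u, ¬ n = ix n t k u := fun t k u => (lt_ix n t k u).ne
  have h' : ∀ t k u, ¬ ix n t k u = n := fun t k u => (lt_ix n t k u).ne'
  have h1 : ∀ g ∈ hadLayer n k w m, n ∉ g.qubits := by simp [hadLayer, Sym.qubits, h]
  have h2 : ∀ g ∈ copyLayer n k w m, n ∉ g.qubits := by simp [copyLayer, Sym.qubits, h, h']
  have h3 : ∀ g ∈ fanLayer n k w m, n ∉ g.qubits := by simp [fanLayer, targets, Sym.qubits, h]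
  have h4 : ∀ g ∈ rotLayer n k w m, n ∉ g.qubits := by
    simp only [rotLayer, List.mem_append, List.mem_map]
    rintro _ (⟨i, -, rfl⟩ | ⟨i, -, rfl⟩) <;> simp [Sym.qubits, h]
  intro L hL
  simp only [level, List.mem_cons, List.not_mem_nil, or_false] at hL
  rcases hL with rfl | rfl | rfl | rfl | rfl | rfl | rfl <;> assumption

theorem notMem_qubits_of_mem_forward {n : ℕ} : ∀ L ∈ forward n, ∀ g ∈ L, n ∉ g.qubits := by
  have h : ∀ t k u, ¬ n = ix n t k u := fun t k u => (lt_ix n t k u).ne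
  intro L hL
  simp only [forward_eq, levels, List.mem_append, List.mem_cons, List.not_mem_nil, or_false,
    List.mem_flatMap, List.mem_range] at hL
  rcases hL with ((rfl | ⟨k, hk, hL⟩) | rfl | rfl) | hL
  · simp only [inputLayer, List.mem_map, List.mem_range]
    rintro _ ⟨i, hi, rfl⟩
    simp [Sym.qubits, h, hi.ne']
  · exact ne_target_of_mem_level L hL
  · simp [Sym.qubits, h]
  · simp [Sym.qubits, h]
  · exact ne_target_of_mem_level L hL

theorem qubit_self {N : ℕ} (hN : 0 < N) (q : Fin N) : qubit hN q = q :=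
  Fin.ext (qubit_val hN q.2)

/-- The first half of the circuit never touches the target qubit. -/
theorem runGates_forward_pauliX (n : ℕ) (ψ : QState (qubits n)) :
    runGates (gates (qubits_pos n) (forward n))
        ((Gate.one pauliX (qubit (qubits_pos n) n)).apply ψ) =
      (Gate.one pauliX (qubit (qubits_pos n) n)).apply
        (runGates (gates (qubits_pos n) (forward n)) ψ) := by
  refine runGates_apply_comm (fun g hg => ?_) ψ
  simp only [gates, List.mem_flatten, List.mem_map] at hg
  obtain ⟨_, ⟨L, hL, rfl⟩, hg⟩ := hg
  obtain ⟨s, hs, rfl⟩ := List.mem_map.1 hg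
  rw [Sym.gate_qubits, Gate.qubits, Finset.disjoint_singleton_left, List.mem_toFinset,
    List.mem_map]
  rintro ⟨q, hq, h⟩
  rw [qubit_inj _ (((forward_valid n L hL).1 s hs).1 q hq) (by unfold qubits; omega)] at h
  subst h
  exact notMem_qubits_of_mem_forward L hL s hs hq

theorem gates_invLayers {N : ℕ} (hN : 0 < N) {U : List (List Sym)}
    (hU : ∀ L ∈ U, LayerValid N L) : gates hN (invLayers U) =
      ((U.map (List.map (Sym.gate hN))).reverse.map (List.map Gate.inv)).flatten := by
  rw [gates, invLayers, ← List.map_reverse, List.map_map, List.map_map]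
  congr 1
  refine List.map_congr_left fun L hL => ?_
  simp only [Function.comp, List.map_map]
  exact List.map_congr_left fun g hg => Sym.gate_inv hN ((hU L (List.mem_reverse.1 hL)).1 g hg)

theorem pauliX_ket {N : ℕ} (p : Fin N) (z : Bits N) :
    (Gate.one pauliX p).apply (ket z) = ket (Function.update z p (!z p)) := by
  funext v
  rw [pauliX_apply]
  have : Function.update v p (!v p) = z ↔ v = Function.update z p (!z p) := by
    constructor
    · rintro rfl
      simp
    · rintro rfl
      simp
  simp only [ket, Pi.single_apply, this]

/-- On the whole support after the first half, the last wire has the value `o`. Adding it to the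
target is therefore a bit flip if `o` holds and nothing otherwise. This commutes with the first
half, whose inverse then restores all ancilla qubits. -/
theorem runGates_orLayers {n : ℕ} (hn : 1 ≤ n) {o : Bool} {z z' : Bits (qubits n)}
    (hz : InitialState n o z) (hz' : InitialState n o z')
    (h : z' = Function.update z (qubit (qubits_pos n) n) (xor (z (qubit (qubits_pos n) n)) o)) :
    runGates (gates (qubits_pos n) (orLayers n)) (ket z) = ket z' := by
  have key : runGates (gates (qubits_pos n) [[.fan (ix n 2 (height n + 1) 1) [n]]])
      (runGates (gates (qubits_pos n) (forward n)) (ket z)) =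
      runGates (gates (qubits_pos n) (forward n)) (ket z') := by
    have hN := qubits_pos n
    have hc : ix n 2 (height n + 1) 1 < qubits n :=
      ix_lt le_rfl (levelOK_last n).hk (by unfold span; omega)
    have hcn : ix n 2 (height n + 1) 1 ≠ n := (lt_ix _ _ _ _).ne'
    have hnN : n < qubits n := by unfold qubits; omega
    obtain ⟨κ, h1, h2, h3, h4⟩ := exists_fan_action hN (ι := Unit)
      (c := fun _ => ix n 2 (height n + 1) 1) (t := fun _ => [n]) (l := [()]) (target_valid n)
    simp only [List.map_cons, List.map_nil] at h1
    funext u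
    rw [h1]
    have hκc : bitAt hN (κ u) (ix n 2 (height n + 1) 1) = bitAt hN u (ix n 2 (height n + 1) 1) :=
      h4 u _ hc (by simpa using hcn)
    have hκ : κ u = Function.update u (qubit hN n)
        (xor (u (qubit hN n)) (bitAt hN u (ix n 2 (height n + 1) 1))) := by
      funext q
      rw [← qubit_self hN q, Function.update_apply]
      split_ifs with hq
      · rw [hq]
        exact h3 u () (by simp) n (by simp)
      · exact h4 u q q.2 (by simpa using fun h : (q : ℕ) = n => hq (by rw [h]))
    -- Strings with the wrong value on the last wire have amplitude zero on both sides.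
    by_cases hu : bitAt hN u (ix n 2 (height n + 1) 1) = o
    · rw [hκ, hu, h]
      cases o
      · simp
      · simp only [Bool.xor_true]
        rw [← pauliX_ket, runGates_forward_pauliX, pauliX_apply]
    · have h5 : runGates (gates (qubits_pos n) (forward n)) (ket z) (κ u) = 0 := by
        by_contra h0
        exact hu (hκc ▸ forward_support hn hz h0)
      have h6 : runGates (gates (qubits_pos n) (forward n)) (ket z') u = 0 := by
        by_contra h0
        exact hu (forward_support hn hz' h0)
      rw [h5, h6]
  rw [orLayers, gates_append, gates_append, runGates_append, runGates_append, key,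
    gates_invLayers _ (forward_valid n)]
  refine runGates_invLayers (fun L hL => ?_) _
  obtain ⟨L', hL', rfl⟩ := List.mem_map.1 hL
  exact (forward_valid n L' hL').disjoint _

section Join

variable {n a : ℕ} (hN : 0 < n + 1 + a) (x : Bits n) (y : Bits 1) (z : Bits a)

theorem bitAt_join_left {i : ℕ} (hi : i < n) : bitAt hN (join x y z) i = x ⟨i, hi⟩ := by
  have : qubit hN i = Fin.castAdd a (Fin.castAdd 1 ⟨i, hi⟩) :=
    Fin.ext (qubit_val hN (by omega))
  rw [bitAt, this, join, Fin.append_left, Fin.append_left]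

theorem bitAt_join_mid : bitAt hN (join x y z) n = y 0 := by
  have : qubit hN n = Fin.castAdd a (Fin.natAdd n 0) :=
    Fin.ext (qubit_val hN (by omega))
  rw [bitAt, this, join, Fin.append_left, Fin.append_right]

theorem bitAt_join_right {p : ℕ} (hp : n < p) (hpN : p < n + 1 + a) :
    bitAt hN (join x y z) p = z ⟨p - (n + 1), by omega⟩ := by
  have : qubit hN p = Fin.natAdd (n + 1) ⟨p - (n + 1), by omega⟩ :=
    Fin.ext (by rw [qubit_val hN hpN]; simp; omega)
  rw [bitAt, this, join, Fin.append_right]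

end Join

theorem initialState_join {n : ℕ} (x : Bits n) (y : Bool) :
    InitialState n (logicalOr x)
      (join x (fun _ : Fin 1 => y) (zeros (3 * span n * span n))) := by
  refine ⟨fun t ht k hk u hu => ?_, ?_⟩
  · rw [bitAt_join_right _ _ _ _ (lt_ix n t k u) (ix_lt ht hk hu)]
    rfl
  · rw [logicalOr, decide_eq_true_iff]
    constructor
    · rintro ⟨i, hi, h⟩
      rw [bitAt_join_left _ _ _ _ hi] at h
      exact ⟨_, h⟩
    · rintro ⟨i, h⟩
      exact ⟨i, i.2, by rwa [bitAt_join_left _ _ _ _ i.2]⟩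

/-- The circuit for the Or gate. -/
noncomputable def orCircuit (n : ℕ) : Circuit (n + 1 + 3 * span n * span n) :=
  mkCircuit (qubits_pos n) (orLayers n) (orLayers_valid n)

theorem computesOr_orCircuit {n : ℕ} (hn : 1 ≤ n) : ComputesOr n (orCircuit n) := by
  intro x y
  refine runGates_orLayers hn (initialState_join x y) (initialState_join x _) ?_
  funext q
  have hN := qubits_pos n
  rw [Function.update_apply]
  split_ifs with hq
  · rw [hq]
    have h1 := bitAt_join_mid hN x (fun _ => xor y (logicalOr x)) (zeros (3 * span n * span n))
    have h2 := bitAt_join_mid hN x (fun _ => y) (zeros (3 * span n * span n))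
    exact h1.trans (congrArg (xor · (logicalOr x)) h2.symm)
  · have hne : (q : ℕ) ≠ n := fun h =>
      hq (Fin.ext (h.trans (qubit_val hN (by unfold qubits; omega)).symm))
    rw [← qubit_self hN q]
    rcases Nat.lt_or_gt_of_ne hne with h | h
    · exact (bitAt_join_left hN x _ _ h).trans (bitAt_join_left hN x _ _ h).symm
    · exact (bitAt_join_right hN x _ _ h q.2).trans (bitAt_join_right hN x _ _ h q.2).symm

theorem ketJoin_ket {n m a : ℕ} (x : Bits n) (y : Bits m) (z : Bits a) :
    ketJoin x (ket y) z = ket (join x y z) := by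
  rw [ketJoin, Finset.sum_eq_single y]
  · simp [ket]
  · intro y' _ hne
    simp [ket, hne]
  · simp

theorem ComputesOr.isOrReduction {n a : ℕ} {C : Circuit (n + 1 + a)} (h : ComputesOr n C) :
    IsOrReduction n 1 0 C := by
  intro x
  refine ⟨ket fun _ => logicalOr x, ?_, ?_, fun hx => ?_⟩
  · rw [ketJoin_ket]
    have := h x false
    simp only [Bool.false_xor] at this
    exact this
  · rintro rfl
    congr 1
    funext i
    simp [logicalOr, zeros]
  · have h1 : logicalOr x = true := by
      rw [logicalOr, decide_eq_true_iff]
      by_contra hne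
      push Not at hne
      exact hx (funext fun i => by simpa [zeros] using hne i)
    have h2 : zeros 1 ≠ fun _ => true := fun h => by simpa [zeros] using congrFun h 0
    simp [h1, ket, h2]

theorem isUniform_orCircuit : IsUniform orCircuit := by
  obtain ⟨M, hM, hw⟩ := Word.circuit.exists_machine
  exact ⟨M, hM, fun n => ⟨_, hw n, circuitCode_mkCircuit _ _ _⟩⟩

/-! ### Depth and size -/

/-- Each half has one input layer, two additions, and seven layers for each of `height n + 1`
levels; one more layer lies between the halves. -/
theorem length_orLayers (n : ℕ) : (orLayers n).length = 14 * height n + 21 := by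
  simp [orLayers, forward, invLayers, level, List.length_flatMap]
  ring

/-- `14 * (2 * L + 3) + 21 = 28 * L + 63`, which is at most `91 * L` as `L ≥ 1`. -/
theorem depth_orCircuit_le {n : ℕ} (hn : 1 ≤ n) : (orCircuit n).depth ≤ 91 * logStar n := by
  have h1 := height_le hn
  have h2 := one_le_logStar hn
  have h3 : (orCircuit n).depth = (orLayers n).length := by
    simp [Circuit.depth, orCircuit, mkCircuit]
  rw [h3, length_orLayers]
  omega

theorem symSize_append (U V : List (List Sym)) : symSize (U ++ V) = symSize U + symSize V := by
  simp [symSize]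

theorem symSize_invLayers (U : List (List Sym)) : symSize (invLayers U) = symSize U := by
  simp [symSize, invLayers, List.map_reverse, List.sum_reverse, Function.comp_def,
    Sym.inv_qubits]

theorem length_targets_le (n k w m o : ℕ) :
    (targets n k w m o).length ≤ 2 * blockLen w m := by
  simp [targets, List.length_flatMap]
  omega

/-- The blocks cover less than `w` wires before the last one, whose nominal length is at most `2 * w
+ 1` thanks to the cap. -/
theorem outs_mul_blockLen_le {w m : ℕ} (hw : 0 < w) : outs w m * blockLen w m ≤ 3 * (w * m) := by
  have h1 : (w - 1) / blockLen w m * blockLen w m ≤ w - 1 := Nat.div_mul_le_self _ _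
  have h2 : blockLen w m ≤ 2 * w + 1 := by unfold blockLen; omega
  have h3 : ((w - 1) / blockLen w m + 1) * blockLen w m ≤ 3 * w := by
    rw [add_mul, one_mul]; omega
  calc outs w m * blockLen w m = ((w - 1) / blockLen w m + 1) * blockLen w m * m := by
        rw [outs]; ring
    _ ≤ 3 * w * m := Nat.mul_le_mul_right _ h3
    _ = 3 * (w * m) := by ring

theorem sum_map_range_le {c B : ℕ} {f : ℕ → ℕ} (h : ∀ i < c, f i ≤ B) :
    ((List.range c).map f).sum ≤ c * B := by
  have := List.sum_le_card_nsmul ((List.range c).map f) B (by simpa using h)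
  simpa using this

/-- In units of `w * m`, each Hadamard layer costs at most `1`, each copy layer `2`, each fan-out
layer `7` and the rotations `2`; so `2 + 4 + 14 + 2 = 22`. -/
theorem symSize_level_le {n k w m : ℕ} (hw : 0 < w) (hm : 0 < m) :
    symSize (level n k w m) ≤ 22 * (w * m) := by
  have h1 := outs_mul_blockLen_le (m := m) hw
  have h2 := outs_le (m := m) hw
  have h3 : w ≤ w * m := Nat.le_mul_of_pos_right _ hm
  have hfan : ((List.range (outs w m)).map fun o => (targets n k w m o).length + 1).sum ≤
      outs w m * (2 * blockLen w m + 1) := sum_map_range_le fun o _ => by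
    have := length_targets_le n k w m o
    omega
  have h4 : outs w m * (2 * blockLen w m + 1) = 2 * (outs w m * blockLen w m) + outs w m := by ring
  have h5 : w * (m + 1) = w * m + w := by ring
  simp [symSize, level, hadLayer, copyLayer, fanLayer, rotLayer, Function.comp_def, Sym.qubits]
    at hfan ⊢
  omega

theorem symSize_levels_le (n : ℕ) : symSize (levels n (height n)) ≤ 22 * (16 * n) := by
  have h : ∀ k ≤ height n, symSize (levels n k) ≤ 22 * ∑ i ∈ Finset.range k, 8 * n / 2 ^ i := by
    intro k
    induction k with
    | zero => simp [levels, symSize]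
    | succ k ih =>
      intro hk
      have h1 := ih (by omega)
      have h2 := symSize_level_le (n := n) (k := k) (w := width n k)
        (by have := lt_width hk; omega) (rows_pos hk)
      have h3 : width n k * rows n k (width n k) ≤ 8 * n / 2 ^ k :=
        (Nat.le_div_iff_mul_le (by positivity)).2 (mul_rows_le n k _)
      rw [levels, List.range_succ, List.flatMap_append, List.flatMap_singleton, ← levels,
        symSize_append, Finset.sum_range_succ]
      omega
  have h1 := h _ le_rfl
  -- The budgets `8 * n / 2 ^ i` sum to at most `16 * n`.
  have h2 := Nat.geom_sum_le le_rfl (8 * n) (height n)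
  omega

theorem size_orCircuit_le {n : ℕ} (hn : 1 ≤ n) : (orCircuit n).size ≤ 1000 * n := by
  refine (size_mkCircuit_le _ _ _).trans ?_
  have h1 := symSize_levels_le n
  have h2 := symSize_level_le (n := n) (k := height n) (w := 3) (m := 2) (by omega) (by omega)
  have h3 : symSize [inputLayer n] = 2 * n := by
    simp [symSize, inputLayer, Function.comp_def, Sym.qubits]
    ring
  have h4 : ∀ c p c' p', symSize [[.fan c [p]], [.fan c' [p']]] = 4 := fun _ _ _ _ => rfl
  have h5 : ∀ c p, symSize [[.fan c [p]]] = 2 := fun _ _ => rfl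
  rw [orLayers, symSize_append, symSize_append, symSize_invLayers, forward_eq, symSize_append,
    symSize_append, symSize_append, h3, h4, h5]
  -- The total is at most `2 * (2 * n + 352 * n + 4 + 132) + 2 = 708 * n + 274`, which is below
  -- `1000 * n` for `n ≥ 1`.
  omega

end QuantumFanOut

theorem mainTheorem8 :
    ∃ (a : ℕ → ℕ) (C : ∀ n : ℕ, QuantumFanOut.Circuit (n + 1 + a n)) (K : ℕ),
      QuantumFanOut.IsUniform C ∧
      ∀ n : ℕ, 1 ≤ n →
        QuantumFanOut.IsOrReduction n 1 0 (C n) ∧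
        QuantumFanOut.ComputesOr n (C n) ∧
        (C n).depth ≤ K * QuantumFanOut.logStar n ∧
        (C n).size ≤ K * n := by
  refine ⟨_, QuantumFanOut.orCircuit, 1000, QuantumFanOut.isUniform_orCircuit, fun n hn => ?_⟩
  have hor := QuantumFanOut.computesOr_orCircuit hn
  have hdepth := QuantumFanOut.depth_orCircuit_le hn
  exact ⟨hor.isOrReduction, hor, by omega, QuantumFanOut.size_orCircuit_le hn⟩
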